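/- Let $X=\mathbb C^2$ with coordinates $x_1,x_2$, let $Y=\{x_2=0\}\subset X$, and let $\mathcal D_X$ be the sheaf of holomorphic linear differential operators on $X$. Let $0<a<b$ be integers, $d=\gcd(a,b)$, $\beta\in\mathbb C$, and let $$\mathcal M_A(\beta)=\mathcal D_X\big/\big(\mathcal D_X(\partial_1^{\,b/d}-\partial_2^{\,a/d})+\mathcal D_X(a x_1\partial_1+b x_2\partial_2-\beta)\big)$$ be the analytic hypergeometric $\mathcal D_X$-module of the matrix $A=(a\ \,b)$. Let $\mathcal O_{\widehat{X|Y}}$ be the formal completion of $\mathcal O_X$ along $Y$; its sections are the series $\sum_{j\ge0}f_j(x_1)x_2^j$ with the $f_j$ holomorphic on a common open subset of $Y$. For $1\le s<\infty$ let $\mathcal O_{\widehat{X|Y}}(s)$ be the subsheaf of Gevrey series of order $s$, i.e. of those $\sum_j f_j(x_1)x_2^j$ for which $\sum_j (j!)^{1-s}f_j(x_1)x_2^j$ converges near every point of the subset of $Y$ on which it is defined, and let $\mathcal O_{\widehat{X|Y}}(\infty)=\mathcal O_{\widehat{X|Y}}$. Let $\mathcal O_{X|Y}$ be the restriction of $\mathcal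 O_X$ to $Y$. All these sheaves are extended by $0$ to $X$. For $1\le s\le\infty$ put $\mathcal Q_Y(s)=\mathcal O_{\widehat{X|Y}}(s)/\mathcal O_{X|Y}$, and for a $\mathcal D_X$-module $\mathcal M$ put $$\operatorname{Irr}_Y^{(s)}(\mathcal M)=\mathbf R\mathcal Hom_{\mathcal D_X}(\mathcal M,\mathcal Q_Y(s)),$$ an object of the derived category of sheaves of $\mathbb C$-vector spaces on $X$. For $1\le s\le t\le\infty$ the morphism $\mathcal Q_Y(s)\to\mathcal Q_Y(t)$ induces a morphism $\operatorname{Irr}_Y^{(s)}(\mathcal M)\to\operatorname{Irr}_Y^{(t)}(\mathcal M)$. For $1<s\le\infty$ let $\mathcal O_{\widehat{X|Y}}(<s)=\bigcup_{1\le r<s}\mathcal O_{\widehat{X|Y}}(r)$ (a section belongs to it when its germ at every point belongs to some $\mathcal O_{\widehat{X|Y}}(r)$, $1\le r<s$), and call $s$ an analytic slope of $\mathcal M$ with respect to $Y$ if $$\mathbf R\mathcal Hom_{\mathcal D_X}\big(\mathcal M,\ \mathcal O_{\widehat{X|Y}}(s)/\mathcal O_{\widehat{X|Y}}(<s)\big)\neq0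 .$$ Proposition. With this notation, for all integers $0<a<b$ and all $\beta\in\mathbb C$: 1. $\mathcal Ext^1_{\mathcal D_X}(\mathcal M_A(\beta),\mathcal Q_Y(s))=0$ for every $1\le s\le\infty$. 2. $\operatorname{Irr}_Y^{(s)}(\mathcal M_A(\beta))=0$ for every $1\le s<b/a$. 3. For every $b/a\le s\le\infty$, the complex $\operatorname{Irr}_Y^{(s)}(\mathcal M_A(\beta))$ is nonzero and is concentrated in degree $0$: its cohomology sheaves in all degrees $n\neq0$ vanish. 4. The Gevrey filtration of the irregularity has $b/a$ as its only gap: for $1\le s\le t\le\infty$ the natural morphism $\operatorname{Irr}_Y^{(s)}(\mathcal M_A(\beta))\to\operatorname{Irr}_Y^{(t)}(\mathcal M_A(\beta))$ is an isomorphism if and only if $t<b/a$ or $b/a\le s$. 5. A number $s\in(1,\infty]$ is an analytic slope of $\mathcal M_A(\beta)$ with respect to $Y$ if and only if $s=b/a$. -/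

import Mathlib

open CategoryTheory Limits TopologicalSpace Opposite
open scoped Nat ENNReal

namespace GevreyIrr

/-- `X = ℂ²`. -/
noncomputable abbrev X : TopCat.{0} := TopCat.of (ℂ × ℂ)

/-- `ℂ⟦t₁⟧⟦t₂⟧`. -/
abbrev Ger : Type := PowerSeries (PowerSeries ℂ)

/-- The coefficient of `t₁ ^ i * t₂ ^ j`. -/
noncomputable def cf (i j : ℕ) : Ger →ₗ[ℂ] ℂ :=
  (PowerSeries.coeff (R := ℂ) i) ∘ₗ
    ((PowerSeries.coeff (R := PowerSeries ℂ) j).restrictScalars ℂ)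

/-- The series with coefficients `c i j`. -/
noncomputable def mkGer (c : ℕ → ℕ → ℂ) : Ger :=
  PowerSeries.mk fun j => PowerSeries.mk fun i => c i j

@[simp] theorem cf_mkGer (c : ℕ → ℕ → ℂ) (i j : ℕ) : cf i j (mkGer c) = c i j := by
  simp [cf, mkGer]

theorem ger_ext {f g : Ger} (h : ∀ i j, cf i j f = cf i j g) : f = g := by
  ext j i
  exact h i j

theorem cf_mul (f g : Ger) (i j : ℕ) :
    cf i j (f * g) = ∑ q ∈ Finset.HasAntidiagonal.antidiagonal j, ∑ p ∈ Finset.HasAntidiagonal.antidiagonal i,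
      cf p.1 q.1 f * cf p.2 q.2 g := by
  simp [cf, PowerSeries.coeff_mul, map_sum]

/-- `∂/∂t₁`. -/
noncomputable def d1 : Module.End ℂ Ger where
  toFun f := mkGer fun i j => (i + 1) * cf (i + 1) j f
  map_add' f g := ger_ext fun i j => by simp [mul_add]
  map_smul' c f := ger_ext fun i j => by simp [mul_left_comm]

/-- `∂/∂t₂`. -/
noncomputable def d2 : Module.End ℂ Ger where
  toFun f := mkGer fun i j => (j + 1) * cf i (j + 1) f
  map_add' f g := ger_ext fun i j => by simp [mul_add]
  map_smul' c f := ger_ext fun i j => by simp [mul_left_comm]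

@[simp] theorem cf_d1 (f : Ger) (i j : ℕ) : cf i j (d1 f) = (i + 1) * cf (i + 1) j f :=
  cf_mkGer (fun i j => (i + 1) * cf (i + 1) j f) i j

@[simp] theorem cf_d2 (f : Ger) (i j : ℕ) : cf i j (d2 f) = (j + 1) * cf i (j + 1) f :=
  cf_mkGer (fun i j => (j + 1) * cf i (j + 1) f) i j

/-- The derivative of a power series over an arbitrary ring. -/
noncomputable def der {R : Type} [CommRing R] (f : PowerSeries R) : PowerSeries R :=
  PowerSeries.derivative R f

theorem der_mul {R : Type} [CommRing R] (f g : PowerSeries R) :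
    der (f * g) = der f * g + f * der g := by
  simp only [der, Derivation.leibniz, smul_eq_mul]
  ring

theorem coeff_der {R : Type} [CommRing R] (f : PowerSeries R) (n : ℕ) :
    PowerSeries.coeff n (der f) = PowerSeries.coeff (n + 1) f * (n + 1) := by
  simp [der, PowerSeries.coeff_derivative]

theorem d1_mul (f g : Ger) : d1 (f * g) = d1 f * g + f * d1 g := by
  have h : ∀ f : Ger, ∀ j, PowerSeries.coeff j (d1 f) = der (PowerSeries.coeff j f) := by
    intro f j
    ext i
    have := cf_d1 f i j
    rw [coeff_der, mul_comm]
    exact this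
  ext j : 1
  rw [h, map_add, PowerSeries.coeff_mul, PowerSeries.coeff_mul, PowerSeries.coeff_mul,
    ← Finset.sum_add_distrib]
  have hsum : ∀ (s : Finset (ℕ × ℕ)) (F : ℕ × ℕ → PowerSeries ℂ),
      der (∑ x ∈ s, F x) = ∑ x ∈ s, der (F x) := fun s F => map_sum (PowerSeries.derivative ℂ) F s
  rw [hsum]
  exact Finset.sum_congr rfl fun x _ => by rw [der_mul, h, h]

theorem d2_mul (f g : Ger) : d2 (f * g) = d2 f * g + f * d2 g := by
  have h : ∀ f : Ger, d2 f = der f := by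
    intro f
    refine ger_ext fun i j => ?_
    rw [cf_d2]
    have e : ((j : PowerSeries ℂ) + 1) = PowerSeries.C ((j : ℂ) + 1) := by simp
    have := congrArg (PowerSeries.coeff i) (coeff_der f j)
    rw [e, PowerSeries.coeff_mul_C, mul_comm] at this
    exact this.symm
  rw [h, h, h, der_mul]

theorem d1_d2 (f : Ger) : d1 (d2 f) = d2 (d1 f) :=
  ger_ext fun i j => by simp; ring

/-! ### Holomorphic functions and their Taylor series -/

/-- The partial derivative of `f` in the direction of the vector `v`. -/
noncomputable def pd (v : ℂ × ℂ) (f : ℂ × ℂ → ℂ) : ℂ × ℂ → ℂ := fun x => fderiv ℂ f x v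

/-- The Taylor series of `f` at `p`, in the coordinates `t₁ = x₁ - p₁`, `t₂ = x₂ - p₂`. -/
noncomputable def taylor (f : ℂ × ℂ → ℂ) (p : ℂ × ℂ) : Ger :=
  mkGer fun i j => ((pd (1, 0))^[i] ((pd (0, 1))^[j] f)) p / (i ! * j !)

theorem pd_analytic {v : ℂ × ℂ} {f : ℂ × ℂ → ℂ} {V : Set (ℂ × ℂ)} (h : AnalyticOnNhd ℂ f V) :
    AnalyticOnNhd ℂ (pd v f) V := fun x hx =>
  ((ContinuousLinearMap.apply ℂ ℂ v).analyticAt _).comp (h.fderiv x hx)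

theorem pd_iter_analytic {v : ℂ × ℂ} {f : ℂ × ℂ → ℂ} {V : Set (ℂ × ℂ)} (h : AnalyticOnNhd ℂ f V)
    (n : ℕ) : AnalyticOnNhd ℂ ((pd v)^[n] f) V := by
  induction n generalizing f with
  | zero => exact h
  | succ n ih => rw [Function.iterate_succ_apply]; exact ih (pd_analytic h)

theorem pd_congr {v : ℂ × ℂ} {f g : ℂ × ℂ → ℂ} {V : Set (ℂ × ℂ)} (hV : IsOpen V)
    (h : Set.EqOn f g V) : Set.EqOn (pd v f) (pd v g) V := fun x hx => by
  have : f =ᶠ[nhds x] g := Filter.eventuallyEq_of_mem (hV.mem_nhds hx) h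
  simp [pd, this.fderiv_eq]

theorem pd_iter_congr {v : ℂ × ℂ} {f g : ℂ × ℂ → ℂ} {V : Set (ℂ × ℂ)} (hV : IsOpen V)
    (h : Set.EqOn f g V) (n : ℕ) : Set.EqOn ((pd v)^[n] f) ((pd v)^[n] g) V := by
  induction n generalizing f g with
  | zero => exact h
  | succ n ih => rw [Function.iterate_succ_apply, Function.iterate_succ_apply]
                 exact ih (pd_congr hV h)

theorem pd_comm {v w : ℂ × ℂ} {f : ℂ × ℂ → ℂ} {V : Set (ℂ × ℂ)} (h : AnalyticOnNhd ℂ f V) :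
    Set.EqOn (pd v (pd w f)) (pd w (pd v f)) V := fun x hx => by
  have hd : DifferentiableAt ℂ (fderiv ℂ f) x := (h.fderiv x hx).differentiableAt
  have key : ∀ a b : ℂ × ℂ, pd a (pd b f) x = fderiv ℂ (fderiv ℂ f) x a b := by
    intro a b
    have h2 : HasFDerivAt (pd b f) _ x :=
      (ContinuousLinearMap.apply ℂ ℂ b).hasFDerivAt.comp x hd.hasFDerivAt
    change fderiv ℂ (pd b f) x a = _
    rw [h2.fderiv]
    rfl
  rw [key, key]
  exact ((h x hx).contDiffAt (n := 2)).isSymmSndFDerivAt (by simp) v w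

theorem pd_iter_comm {v w : ℂ × ℂ} {f : ℂ × ℂ → ℂ} {V : Set (ℂ × ℂ)} (hV : IsOpen V)
    (h : AnalyticOnNhd ℂ f V) (n : ℕ) :
    Set.EqOn (pd v ((pd w)^[n] f)) ((pd w)^[n] (pd v f)) V := by
  induction n generalizing f with
  | zero => exact fun x _ => rfl
  | succ n ih =>
    rw [Function.iterate_succ_apply, Function.iterate_succ_apply]
    exact (ih (pd_analytic h)).trans (pd_iter_congr hV (pd_comm h) n)

/-- A field of formal power series on `V` is flat if it is the field of
Taylor series of a holomorphic function (`taylor_flat`, `Flat.eq_taylor`). -/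
def Flat (V : Set (ℂ × ℂ)) (S : ℂ × ℂ → Ger) : Prop :=
  ∀ p ∈ V, ∀ i j, HasFDerivAt (fun x => cf i j (S x))
    (cf i j (d1 (S p)) • ContinuousLinearMap.fst ℂ ℂ ℂ +
      cf i j (d2 (S p)) • ContinuousLinearMap.snd ℂ ℂ ℂ) p

theorem taylor_flat {f : ℂ × ℂ → ℂ} {V : Set (ℂ × ℂ)} (hV : IsOpen V)
    (h : AnalyticOnNhd ℂ f V) : Flat V (taylor f) := by
  intro p hp i j
  set G := (pd (1, 0))^[i] ((pd (0, 1))^[j] f) with hG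
  have hGa : AnalyticOnNhd ℂ G V := pd_iter_analytic (pd_iter_analytic h j) i
  have h1 : pd (1, 0) G p = (pd (1, 0))^[i + 1] ((pd (0, 1))^[j] f) p := by
    rw [Function.iterate_succ_apply']
  have h2 : pd (0, 1) G p = (pd (1, 0))^[i] ((pd (0, 1))^[j + 1] f) p := by
    rw [Function.iterate_succ_apply']
    exact pd_iter_comm hV (pd_iter_analytic h j) i hp
  have hd := (hGa p hp).differentiableAt.hasFDerivAt.const_mul ((i ! * j ! : ℂ)⁻¹)
  have e : (fun x => cf i j (taylor f x)) = fun x => (i ! * j ! : ℂ)⁻¹ * G x := by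
    funext x
    simp [taylor, ← hG, div_eq_mul_inv, mul_comm]
  rw [e]
  refine hd.congr_fderiv ?_
  have hi : (i ! : ℂ) ≠ 0 := by exact_mod_cast i.factorial_ne_zero
  have hj : (j ! : ℂ) ≠ 0 := by exact_mod_cast j.factorial_ne_zero
  have hi' : (i + 1 : ℂ) ≠ 0 := by exact_mod_cast i.succ_ne_zero
  have hj' : (j + 1 : ℂ) ≠ 0 := by exact_mod_cast j.succ_ne_zero
  apply ContinuousLinearMap.ext
  rintro ⟨u, w⟩
  have hs : fderiv ℂ G p (u, w) = u * pd (1, 0) G p + w * pd (0, 1) G p := by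
    have : (u, w) = u • ((1 : ℂ), (0 : ℂ)) + w • ((0 : ℂ), (1 : ℂ)) := by simp
    rw [this, map_add, map_smul, map_smul]
    rfl
  simp only [_root_.smul_apply, _root_.add_apply, hs, h1, h2, cf_d1, cf_d2,
    smul_eq_mul, taylor, cf_mkGer, Nat.factorial_succ, ContinuousLinearMap.coe_fst',
    ContinuousLinearMap.coe_snd']
  push_cast
  field_simp

theorem Flat.pd_one {V : Set (ℂ × ℂ)} {S : ℂ × ℂ → Ger} (h : Flat V S) (i j : ℕ) :
    Set.EqOn (pd (1, 0) fun x => cf i j (S x)) (fun x => (i + 1) * cf (i + 1) j (S x)) V :=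
  fun p hp => by simp [pd, (h p hp i j).fderiv]

theorem Flat.pd_two {V : Set (ℂ × ℂ)} {S : ℂ × ℂ → Ger} (h : Flat V S) (i j : ℕ) :
    Set.EqOn (pd (0, 1) fun x => cf i j (S x)) (fun x => (j + 1) * cf i (j + 1) (S x)) V :=
  fun p hp => by simp [pd, (h p hp i j).fderiv]

theorem pd_const_mul (v : ℂ × ℂ) (c : ℂ) (f : ℂ × ℂ → ℂ) :
    pd v (fun x => c * f x) = fun x => c * pd v f x := by
  funext x
  have : (fun x => c * f x) = c • f := rfl
  rw [this]
  simp [pd, fderiv_const_smul_field]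

theorem pd_iter_const_mul (v : ℂ × ℂ) (c : ℂ) (f : ℂ × ℂ → ℂ) (n : ℕ) :
    (pd v)^[n] (fun x => c * f x) = fun x => c * (pd v)^[n] f x := by
  induction n generalizing f with
  | zero => rfl
  | succ n ih => rw [Function.iterate_succ_apply, pd_const_mul, ih, Function.iterate_succ_apply]

theorem Flat.eq_taylor {V : Set (ℂ × ℂ)} (hV : IsOpen V) {S : ℂ × ℂ → Ger} (h : Flat V S)
    {p : ℂ × ℂ} (hp : p ∈ V) : S p = taylor (fun x => cf 0 0 (S x)) p := by
  have h2 : ∀ j, Set.EqOn ((pd (0, 1))^[j] fun x => cf 0 0 (S x))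
      (fun x => (j ! : ℂ) * cf 0 j (S x)) V := by
    intro j
    induction j with
    | zero => intro x _; simp
    | succ j ih =>
      intro x hx
      rw [Function.iterate_succ_apply', pd_congr hV ih hx, pd_const_mul]
      simp only
      rw [h.pd_two 0 j hx, Nat.factorial_succ]
      push_cast; ring
  have h1 : ∀ i j, Set.EqOn ((pd (1, 0))^[i] fun x => cf 0 j (S x))
      (fun x => (i ! : ℂ) * cf i j (S x)) V := by
    intro i j
    induction i with
    | zero => intro x _; simp
    | succ i ih =>
      intro x hx
      rw [Function.iterate_succ_apply', pd_congr hV ih hx, pd_const_mul]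
      simp only
      rw [h.pd_one i j hx, Nat.factorial_succ]
      push_cast; ring
  refine ger_ext fun i j => ?_
  rw [taylor, cf_mkGer, pd_iter_congr hV (h2 j) i hp, pd_iter_const_mul]
  simp only
  rw [h1 i j hp]
  have hi : (i ! : ℂ) ≠ 0 := by exact_mod_cast i.factorial_ne_zero
  have hj : (j ! : ℂ) ≠ 0 := by exact_mod_cast j.factorial_ne_zero
  field_simp

theorem Flat.mul {V : Set (ℂ × ℂ)} {S T : ℂ × ℂ → Ger} (hS : Flat V S) (hT : Flat V T) :
    Flat V fun p => S p * T p := by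
  intro p hp i j
  simp only [cf_mul]
  have := HasFDerivAt.fun_sum (u := Finset.HasAntidiagonal.antidiagonal j) fun q _ =>
    HasFDerivAt.fun_sum (u := Finset.HasAntidiagonal.antidiagonal i) fun r _ =>
      (hS p hp r.1 q.1).mul (hT p hp r.2 q.2)
  refine this.congr_fderiv ?_
  rw [d1_mul, d2_mul]
  apply ContinuousLinearMap.ext
  rintro ⟨u, w⟩
  simp only [_root_.sum_apply, _root_.smul_apply,
    _root_.add_apply, map_add, cf_mul, smul_eq_mul,
    ContinuousLinearMap.coe_fst', ContinuousLinearMap.coe_snd', add_mul, Finset.sum_mul]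
  simp only [← Finset.sum_add_distrib]
  exact Finset.sum_congr rfl fun q _ => Finset.sum_congr rfl fun r _ => by ring

theorem Flat.d1 {V : Set (ℂ × ℂ)} {S : ℂ × ℂ → Ger} (hS : Flat V S) :
    Flat V fun p => d1 (S p) := by
  intro p hp i j
  simp only [cf_d1 (S _)]
  refine ((hS p hp (i + 1) j).const_mul ((i : ℂ) + 1)).congr_fderiv ?_
  apply ContinuousLinearMap.ext
  rintro ⟨u, w⟩
  simp
  ring

theorem Flat.d2 {V : Set (ℂ × ℂ)} {S : ℂ × ℂ → Ger} (hS : Flat V S) :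
    Flat V fun p => d2 (S p) := by
  intro p hp i j
  simp only [cf_d2 (S _)]
  refine ((hS p hp i (j + 1)).const_mul ((j : ℂ) + 1)).congr_fderiv ?_
  apply ContinuousLinearMap.ext
  rintro ⟨u, w⟩
  simp
  ring

theorem taylor_mul {f g : ℂ × ℂ → ℂ} {V : Set (ℂ × ℂ)} (hV : IsOpen V)
    (hf : AnalyticOnNhd ℂ f V) (hg : AnalyticOnNhd ℂ g V) {p : ℂ × ℂ} (hp : p ∈ V) :
    taylor f p * taylor g p = taylor (fun x => f x * g x) p := by
  rw [((taylor_flat hV hf).mul (taylor_flat hV hg)).eq_taylor hV hp]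
  simp [cf_mul, taylor]

theorem d1_taylor {f : ℂ × ℂ → ℂ} {V : Set (ℂ × ℂ)} (hV : IsOpen V)
    (hf : AnalyticOnNhd ℂ f V) {p : ℂ × ℂ} (hp : p ∈ V) :
    d1 (taylor f p) = taylor (pd (1, 0) f) p := by
  rw [(taylor_flat hV hf).d1.eq_taylor hV hp]
  simp [taylor]

theorem d2_taylor {f : ℂ × ℂ → ℂ} {V : Set (ℂ × ℂ)} (hV : IsOpen V)
    (hf : AnalyticOnNhd ℂ f V) {p : ℂ × ℂ} (hp : p ∈ V) :
    d2 (taylor f p) = taylor (pd (0, 1) f) p := by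
  rw [(taylor_flat hV hf).d2.eq_taylor hV hp]
  simp [taylor]


/-! ### Convergent power series and Gevrey series -/

/-- The power series `g` in `t₁, t₂` converges (absolutely) on a polydisc around the origin. -/
def IsConvergent (g : Ger) : Prop :=
  ∃ r : ℝ, 0 < r ∧ Summable fun n : ℕ × ℕ => ‖cf n.1 n.2 g‖ * r ^ (n.1 + n.2)

/-- `ρ_s (∑ f_j(t₁) t₂ ^ j) = ∑ (1 / (j!) ^ (s - 1)) f_j(t₁) t₂ ^ j`. -/
noncomputable def rho (s : ℝ) (g : Ger) : Ger :=
  mkGer fun i j => ((((j ! : ℝ) ^ (s - 1))⁻¹ : ℝ) : ℂ) * cf i j g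

/-- Gevrey series of order `s` along `t₂ = 0`, for `1 ≤ s ≤ ∞`. -/
def IsGevrey (s : ℝ≥0∞) (g : Ger) : Prop := s = ⊤ ∨ IsConvergent (rho s.toReal g)

theorem isConvergent_iff {g : Ger} : IsConvergent g ↔
    ∃ C D : ℝ, 0 ≤ C ∧ 1 ≤ D ∧ ∀ i j, ‖cf i j g‖ ≤ C * D ^ (i + j) := by
  constructor
  · rintro ⟨r, hr, hs⟩
    refine ⟨∑' n : ℕ × ℕ, ‖cf n.1 n.2 g‖ * r ^ (n.1 + n.2), max 1 r⁻¹,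
      tsum_nonneg fun n => by positivity, le_max_left _ _, fun i j => ?_⟩
    have h1 := hs.le_tsum (i, j) fun n _ => by positivity
    simp only at h1
    have h2 : ‖cf i j g‖ = (‖cf i j g‖ * r ^ (i + j)) * r⁻¹ ^ (i + j) := by
      rw [mul_assoc, ← mul_pow, mul_inv_cancel₀ hr.ne', one_pow, mul_one]
    rw [h2]
    have h0 : 0 ≤ ∑' n : ℕ × ℕ, ‖cf n.1 n.2 g‖ * r ^ (n.1 + n.2) :=
      tsum_nonneg fun n => by positivity
    gcongr
    exact le_max_right _ _
  · rintro ⟨C, D, hC, hD, h⟩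
    have hD0 : 0 < D := by linarith
    refine ⟨(2 * D)⁻¹, by positivity, ?_⟩
    have hg := summable_geometric_two
    have hp := (hg.mul_of_nonneg hg (fun n => by positivity) (fun n => by positivity)).mul_left C
    refine Summable.of_nonneg_of_le (fun n => by positivity) (fun n => ?_) hp
    calc ‖cf n.1 n.2 g‖ * (2 * D)⁻¹ ^ (n.1 + n.2)
        ≤ C * D ^ (n.1 + n.2) * (2 * D)⁻¹ ^ (n.1 + n.2) := by gcongr; exact h _ _
      _ = C * ((D * (2 * D)⁻¹) ^ (n.1 + n.2)) := by rw [mul_pow]; ring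
      _ = C * ((1 / 2) ^ n.1 * (1 / 2) ^ n.2) := by
          rw [← pow_add]; congr 2; field_simp
      _ ≤ _ := le_rfl

theorem isGevrey_iff {s : ℝ≥0∞} (hs : s ≠ ⊤) {g : Ger} : IsGevrey s g ↔
    ∃ C D : ℝ, 0 ≤ C ∧ 1 ≤ D ∧
      ∀ i j, ‖cf i j g‖ ≤ C * D ^ (i + j) * (j ! : ℝ) ^ (s.toReal - 1) := by
  simp only [IsGevrey, hs, false_or, isConvergent_iff, rho, cf_mkGer]
  refine exists_congr fun C => exists_congr fun D => and_congr_right fun _ => and_congr_right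
    fun _ => forall_congr' fun i => forall_congr' fun j => ?_
  have hj : (0 : ℝ) < (j ! : ℝ) ^ (s.toReal - 1) :=
    Real.rpow_pos_of_pos (by exact_mod_cast j.factorial_pos) _
  rw [norm_mul, Complex.norm_real, norm_inv, Real.norm_of_nonneg hj.le, inv_mul_eq_div,
    div_le_iff₀ hj]

theorem IsGevrey.zero (s : ℝ≥0∞) : IsGevrey s 0 := by
  by_cases hs : s = ⊤
  · exact Or.inl hs
  · exact (isGevrey_iff hs).2 ⟨0, 1, le_rfl, le_rfl, by simp⟩

theorem IsGevrey.neg {s : ℝ≥0∞} {f : Ger} (hf : IsGevrey s f) : IsGevrey s (-f) := by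
  by_cases hs : s = ⊤
  · exact Or.inl hs
  · simpa only [isGevrey_iff hs, map_neg, norm_neg] using hf

theorem IsGevrey.add {s : ℝ≥0∞} {f g : Ger} (hf : IsGevrey s f) (hg : IsGevrey s g) :
    IsGevrey s (f + g) := by
  by_cases hs : s = ⊤
  · exact Or.inl hs
  · rw [isGevrey_iff hs] at *
    obtain ⟨C, D, hC, hD, h⟩ := hf
    obtain ⟨C', D', hC', hD', h'⟩ := hg
    refine ⟨C + C', max D D', by positivity, hD.trans (le_max_left _ _), fun i j => ?_⟩
    have h0 : (0 : ℝ) ≤ (j ! : ℝ) ^ (s.toReal - 1) := by positivity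
    calc ‖cf i j (f + g)‖ ≤ ‖cf i j f‖ + ‖cf i j g‖ := by rw [map_add]; exact norm_add_le _ _
      _ ≤ C * D ^ (i + j) * (j ! : ℝ) ^ (s.toReal - 1) +
          C' * D' ^ (i + j) * (j ! : ℝ) ^ (s.toReal - 1) := add_le_add (h i j) (h' i j)
      _ ≤ C * (max D D') ^ (i + j) * (j ! : ℝ) ^ (s.toReal - 1) +
          C' * (max D D') ^ (i + j) * (j ! : ℝ) ^ (s.toReal - 1) := by
          gcongr
          · exact le_max_left _ _
          · exact le_max_right _ _
      _ = _ := by ring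

theorem IsGevrey.mono {s t : ℝ≥0∞} (hst : s ≤ t) {f : Ger} (hf : IsGevrey s f) :
    IsGevrey t f := by
  by_cases ht : t = ⊤
  · exact Or.inl ht
  · have hs : s ≠ ⊤ := fun h => ht (top_le_iff.1 (h ▸ hst))
    rw [isGevrey_iff hs] at hf
    rw [isGevrey_iff ht]
    obtain ⟨C, D, hC, hD, h⟩ := hf
    refine ⟨C, D, hC, hD, fun i j => (h i j).trans ?_⟩
    have h1 : (1 : ℝ) ≤ j ! := by exact_mod_cast j.factorial_pos
    have := ENNReal.toReal_mono ht hst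
    gcongr

theorem IsGevrey.d1 {s : ℝ≥0∞} {f : Ger} (hf : IsGevrey s f) : IsGevrey s (d1 f) := by
  by_cases hs : s = ⊤
  · exact Or.inl hs
  · rw [isGevrey_iff hs] at *
    obtain ⟨C, D, hC, hD, h⟩ := hf
    refine ⟨C * D, 2 * D, by positivity, by linarith, fun i j => ?_⟩
    have h0 : (0 : ℝ) ≤ (j ! : ℝ) ^ (s.toReal - 1) := by positivity
    have hi : ((i : ℝ) + 1) ≤ 2 ^ (i + j) := by
      have : i + 1 ≤ 2 ^ (i + j) :=
        (Nat.lt_two_pow_self (n := i)).trans_le (Nat.pow_le_pow_right (by norm_num) (by lia))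
      exact_mod_cast this
    rw [cf_d1, norm_mul]
    have hn : ‖(i : ℂ) + 1‖ = (i : ℝ) + 1 := by
      rw [← Nat.cast_succ, Complex.norm_natCast]; push_cast; rfl
    rw [hn]
    calc ((i : ℝ) + 1) * ‖cf (i + 1) j f‖
        ≤ 2 ^ (i + j) * (C * D ^ (i + 1 + j) * (j ! : ℝ) ^ (s.toReal - 1)) := by
          gcongr; exact h _ _
      _ = _ := by rw [mul_pow]; ring

theorem IsGevrey.d2 {s : ℝ≥0∞} (h1s : 1 ≤ s) {f : Ger} (hf : IsGevrey s f) :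
    IsGevrey s (d2 f) := by
  by_cases hs : s = ⊤
  · exact Or.inl hs
  · rw [isGevrey_iff hs] at *
    obtain ⟨C, D, hC, hD, h⟩ := hf
    have h1 : (1 : ℝ) ≤ s.toReal := by
      simpa using ENNReal.toReal_mono hs h1s
    have hK : (1 : ℝ) ≤ 2 ^ s.toReal := Real.one_le_rpow (by norm_num) (by linarith)
    refine ⟨C * D, 2 ^ s.toReal * D, by positivity, by nlinarith, fun i j => ?_⟩
    have h0 : (0 : ℝ) ≤ (j ! : ℝ) ^ (s.toReal - 1) := by positivity
    have hj : ((j : ℝ) + 1) ^ s.toReal ≤ (2 ^ s.toReal) ^ (i + j) := by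
      have : (j : ℝ) + 1 ≤ 2 ^ (i + j) := by
        have : j + 1 ≤ 2 ^ (i + j) :=
          (Nat.lt_two_pow_self (n := j)).trans_le (Nat.pow_le_pow_right (by norm_num) (by lia))
        exact_mod_cast this
      calc ((j : ℝ) + 1) ^ s.toReal ≤ ((2 : ℝ) ^ (i + j)) ^ s.toReal :=
            Real.rpow_le_rpow (by positivity) this (by linarith)
        _ = _ := by
          rw [← Real.rpow_natCast, ← Real.rpow_natCast, ← Real.rpow_mul (by norm_num),
            ← Real.rpow_mul (by norm_num), mul_comm]
    rw [cf_d2, norm_mul]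
    have hn : ‖(j : ℂ) + 1‖ = (j : ℝ) + 1 := by
      rw [← Nat.cast_succ, Complex.norm_natCast]; push_cast; rfl
    rw [hn]
    have hfac : ((j + 1)! : ℝ) ^ (s.toReal - 1) =
        ((j : ℝ) + 1) ^ (s.toReal - 1) * (j ! : ℝ) ^ (s.toReal - 1) := by
      rw [Nat.factorial_succ]
      push_cast
      exact Real.mul_rpow (by positivity) (by positivity)
    have hpow : ((j : ℝ) + 1) * ((j : ℝ) + 1) ^ (s.toReal - 1) = ((j : ℝ) + 1) ^ s.toReal := by
      rw [Real.rpow_sub_one (by positivity)]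
      field_simp
    calc ((j : ℝ) + 1) * ‖cf i (j + 1) f‖
        ≤ ((j : ℝ) + 1) * (C * D ^ (i + (j + 1)) * ((j + 1)! : ℝ) ^ (s.toReal - 1)) := by
          gcongr; exact h _ _
      _ = ((j : ℝ) + 1) ^ s.toReal * (C * D ^ (i + (j + 1)) * (j ! : ℝ) ^ (s.toReal - 1)) := by
          rw [hfac, ← hpow]; ring
      _ ≤ (2 ^ s.toReal) ^ (i + j) * (C * D ^ (i + (j + 1)) * (j ! : ℝ) ^ (s.toReal - 1)) := by
          gcongr
      _ = _ := by rw [mul_pow]; ring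

theorem IsGevrey.mul {s : ℝ≥0∞} (h1s : 1 ≤ s) {a f : Ger} (ha : IsConvergent a)
    (hf : IsGevrey s f) : IsGevrey s (a * f) := by
  by_cases hs : s = ⊤
  · exact Or.inl hs
  · rw [isGevrey_iff hs] at *
    rw [isConvergent_iff] at ha
    obtain ⟨A, B, hA, hB, hab⟩ := ha
    obtain ⟨C, D, hC, hD, h⟩ := hf
    have h1 : (1 : ℝ) ≤ s.toReal := by
      simpa using ENNReal.toReal_mono hs h1s
    set M := max B D with hM
    have hM1 : 1 ≤ M := hB.trans (le_max_left _ _)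
    refine ⟨A * C, 2 * M, by positivity, by linarith, fun i j => ?_⟩
    have h0 : ∀ k : ℕ, (0 : ℝ) ≤ (k ! : ℝ) ^ (s.toReal - 1) := fun k => by positivity
    have hcard : ((i : ℝ) + 1) * ((j : ℝ) + 1) ≤ 2 ^ (i + j) := by
      have hh : ∀ n : ℕ, n + 1 ≤ 2 ^ n := fun n => Nat.lt_two_pow_self
      have : (i + 1) * (j + 1) ≤ 2 ^ (i + j) := by
        rw [pow_add]; exact Nat.mul_le_mul (hh i) (hh j)
      exact_mod_cast this
    rw [cf_mul]
    have hterm : ∀ q ∈ Finset.HasAntidiagonal.antidiagonal j,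
        ∀ p ∈ Finset.HasAntidiagonal.antidiagonal i, ‖cf p.1 q.1 a * cf p.2 q.2 f‖ ≤
          A * C * M ^ (i + j) * (j ! : ℝ) ^ (s.toReal - 1) := by
      intro q hq p hp
      rw [Finset.HasAntidiagonal.mem_antidiagonal] at hq hp
      rw [norm_mul]
      have hq2 : (q.2 ! : ℝ) ^ (s.toReal - 1) ≤ (j ! : ℝ) ^ (s.toReal - 1) := by
        apply Real.rpow_le_rpow (by positivity) _ (by linarith)
        exact_mod_cast Nat.factorial_le (by lia)
      have e : A * C * M ^ (i + j) * (j ! : ℝ) ^ (s.toReal - 1) =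
          (A * M ^ (p.1 + q.1)) * (C * M ^ (p.2 + q.2) * (j ! : ℝ) ^ (s.toReal - 1)) := by
        rw [← hp, ← hq]; ring
      rw [e]
      refine mul_le_mul ((hab _ _).trans ?_) ((h _ _).trans ?_) (norm_nonneg _) (by positivity)
      · gcongr; exact le_max_left _ _
      · have := h0 q.2
        gcongr
        exact le_max_right _ _
    calc ‖_‖ ≤ ∑ q ∈ Finset.HasAntidiagonal.antidiagonal j,
          ∑ p ∈ Finset.HasAntidiagonal.antidiagonal i, ‖cf p.1 q.1 a * cf p.2 q.2 f‖ :=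
          (norm_sum_le _ _).trans (Finset.sum_le_sum fun q _ => norm_sum_le _ _)
      _ ≤ ∑ q ∈ Finset.HasAntidiagonal.antidiagonal j,
          ∑ p ∈ Finset.HasAntidiagonal.antidiagonal i,
            A * C * M ^ (i + j) * (j ! : ℝ) ^ (s.toReal - 1) :=
          Finset.sum_le_sum fun q hq => Finset.sum_le_sum fun p hp => hterm q hq p hp
      _ = (((i : ℝ) + 1) * ((j : ℝ) + 1)) *
            (A * C * M ^ (i + j) * (j ! : ℝ) ^ (s.toReal - 1)) := by
          simp; ring
      _ ≤ 2 ^ (i + j) * (A * C * M ^ (i + j) * (j ! : ℝ) ^ (s.toReal - 1)) := by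
          have := h0 j
          gcongr
      _ = _ := by rw [mul_pow]; ring

theorem pd_one_iter_eq {G : ℂ × ℂ → ℂ} {V : Set (ℂ × ℂ)} (hV : IsOpen V)
    (hG : AnalyticOnNhd ℂ G V) (n : ℕ) {p : ℂ × ℂ} (hp : p ∈ V) :
    (pd (1, 0))^[n] G p = iteratedDeriv n (fun z => G (z, p.2)) p.1 := by
  induction n generalizing p with
  | zero => simp
  | succ n ih =>
    rw [Function.iterate_succ_apply', iteratedDeriv_succ]
    have hl : HasDerivAt (fun z : ℂ => (z, p.2)) ((1 : ℂ), (0 : ℂ)) p.1 :=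
      (hasDerivAt_id _).prodMk (hasDerivAt_const _ _)
    have hd : HasFDerivAt ((pd (1, 0))^[n] G) _ (p.1, p.2) :=
      (pd_iter_analytic hG n p hp).differentiableAt.hasFDerivAt
    have hc := hd.comp_hasDerivAt p.1 hl
    have he : (((pd (1, 0))^[n] G) ∘ fun z : ℂ => (z, p.2)) =ᶠ[nhds p.1]
        iteratedDeriv n (fun z => G (z, p.2)) := by
      have : ∀ᶠ z in nhds p.1, (z, p.2) ∈ V :=
        hl.continuousAt.eventually_mem (hV.mem_nhds hp)
      filter_upwards [this] with z hz using ih hz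
    rw [← he.deriv_eq, hc.deriv]
    rfl

theorem pd_two_iter_eq {G : ℂ × ℂ → ℂ} {V : Set (ℂ × ℂ)} (hV : IsOpen V)
    (hG : AnalyticOnNhd ℂ G V) (n : ℕ) {p : ℂ × ℂ} (hp : p ∈ V) :
    (pd (0, 1))^[n] G p = iteratedDeriv n (fun z => G (p.1, z)) p.2 := by
  induction n generalizing p with
  | zero => simp
  | succ n ih =>
    rw [Function.iterate_succ_apply', iteratedDeriv_succ]
    have hl : HasDerivAt (fun z : ℂ => (p.1, z)) ((0 : ℂ), (1 : ℂ)) p.2 :=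
      (hasDerivAt_const _ _).prodMk (hasDerivAt_id _)
    have hd : HasFDerivAt ((pd (0, 1))^[n] G) _ (p.1, p.2) :=
      (pd_iter_analytic hG n p hp).differentiableAt.hasFDerivAt
    have hc := hd.comp_hasDerivAt p.2 hl
    have he : (((pd (0, 1))^[n] G) ∘ fun z : ℂ => (p.1, z)) =ᶠ[nhds p.2]
        iteratedDeriv n (fun z => G (p.1, z)) := by
      have : ∀ᶠ z in nhds p.2, (p.1, z) ∈ V :=
        hl.continuousAt.eventually_mem (hV.mem_nhds hp)
      filter_upwards [this] with z hz using ih hz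
    rw [← he.deriv_eq, hc.deriv]
    rfl

theorem taylor_convergent {f : ℂ × ℂ → ℂ} {V : Set (ℂ × ℂ)} (hV : IsOpen V)
    (hf : AnalyticOnNhd ℂ f V) {p : ℂ × ℂ} (hp : p ∈ V) : IsConvergent (taylor f p) := by
  obtain ⟨r, hr, hsub⟩ := Metric.nhds_basis_closedBall.mem_iff.1 (hV.mem_nhds hp)
  obtain ⟨M, hM⟩ := (isCompact_closedBall p r).exists_bound_of_continuousOn
    (hf.continuousOn.mono hsub)
  have hM0 : 0 ≤ M := (norm_nonneg _).trans (hM p (Metric.mem_closedBall_self hr.le))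
  have hmem : ∀ z w : ℂ, z ∈ Metric.closedBall p.1 r → w ∈ Metric.closedBall p.2 r →
      (z, w) ∈ Metric.closedBall p r := by
    intro z w hz hw
    rw [Metric.mem_closedBall] at *
    rw [Prod.dist_eq]
    exact max_le hz hw
  have hp2 : p.2 ∈ Metric.closedBall p.2 r := Metric.mem_closedBall_self hr.le
  have hB : ∀ j : ℕ, ∀ z ∈ Metric.closedBall p.1 r,
      ‖(pd (0, 1))^[j] f (z, p.2)‖ ≤ j ! * M / r ^ j := by
    intro j z hz
    rw [pd_two_iter_eq hV hf j (hsub (hmem z p.2 hz hp2))]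
    refine Complex.norm_iteratedDeriv_le_of_forall_mem_sphere_norm_le j hr ?_ ?_
    · refine DifferentiableOn.diffContOnCl_ball (U := Metric.closedBall p.2 r) ?_ le_rfl
      intro w hw
      have h1 : DifferentiableAt ℂ f (z, w) := (hf _ (hsub (hmem z w hz hw))).differentiableAt
      have h2 : DifferentiableAt ℂ (fun w : ℂ => (z, w)) w := by fun_prop
      exact (h1.comp w h2).differentiableWithinAt
    · exact fun w hw => hM _ (hmem z w hz (Metric.sphere_subset_closedBall hw))
  rw [isConvergent_iff]
  refine ⟨M, max 1 r⁻¹, hM0, le_max_left _ _, fun i j => ?_⟩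
  have hG := pd_iter_analytic (v := (0, 1)) hf j
  have hA : ‖(pd (1, 0))^[i] ((pd (0, 1))^[j] f) p‖ ≤ i ! * (j ! * M / r ^ j) / r ^ i := by
    rw [pd_one_iter_eq hV hG i hp]
    refine Complex.norm_iteratedDeriv_le_of_forall_mem_sphere_norm_le i hr ?_ ?_
    · refine DifferentiableOn.diffContOnCl_ball (U := Metric.closedBall p.1 r) ?_ le_rfl
      intro z hz
      have h1 : DifferentiableAt ℂ ((pd (0, 1))^[j] f) (z, p.2) :=
        (hG _ (hsub (hmem z p.2 hz hp2))).differentiableAt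
      have h2 : DifferentiableAt ℂ (fun z : ℂ => (z, p.2)) z := by fun_prop
      exact (h1.comp z h2).differentiableWithinAt
    · exact fun z hz => hB j z (Metric.sphere_subset_closedBall hz)
  have hi : (0 : ℝ) < i ! := by exact_mod_cast i.factorial_pos
  have hj : (0 : ℝ) < j ! := by exact_mod_cast j.factorial_pos
  rw [taylor, cf_mkGer, norm_div, norm_mul, Complex.norm_natCast, Complex.norm_natCast]
  calc _ ≤ (i ! * (j ! * M / r ^ j) / r ^ i) / ((i ! : ℝ) * j !) := by gcongr
    _ = M * r⁻¹ ^ (i + j) := by rw [pow_add, inv_pow, inv_pow]; field_simp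
    _ ≤ _ := by gcongr; exact le_max_right _ _


/-! ### The sheaf of differential operators -/

/-- Restriction of functions from `U` to `V`. -/
def res {α : Type} {U V : Opens X} (h : V ≤ U) (s : U → α) : V → α := fun q => s ⟨q.1, h q.2⟩

/-- Restriction of fields of operators, as a morphism of algebras. -/
noncomputable def resAlg {U V : Opens X} (h : V ≤ U) :
    (U → Module.End ℂ Ger) →ₐ[ℂ] (V → Module.End ℂ Ger) :=
  AlgHom.pi fun q => Pi.evalAlgHom ℂ _ (⟨q.1, h q.2⟩ : U)

/-- The operators on `V` that generate all differential operators: multiplication by a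
holomorphic function, `∂₁` and `∂₂`, acting on Taylor series at each point of `V`. -/
def gens (V : Opens X) : Set (V → Module.End ℂ Ger) :=
  {T | (∃ f : ℂ × ℂ → ℂ, AnalyticOnNhd ℂ f V ∧ T = fun p : V => LinearMap.mulLeft ℂ (taylor f p.1)) ∨
    (T = fun _ => d1) ∨ T = fun _ => d2}

theorem resAlg_adjoin {U V : Opens X} (h : V ≤ U) {T : U → Module.End ℂ Ger}
    (hT : T ∈ Algebra.adjoin ℂ (gens U)) : resAlg h T ∈ Algebra.adjoin ℂ (gens V) := by
  have h1 : resAlg h T ∈ (Algebra.adjoin ℂ (gens U)).map (resAlg h) :=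
    Subalgebra.mem_map.2 ⟨T, hT, rfl⟩
  rw [AlgHom.map_adjoin] at h1
  refine Algebra.adjoin_mono ?_ h1
  rintro _ ⟨S, hS, rfl⟩
  rcases hS with ⟨f, hf, rfl⟩ | rfl | rfl
  · exact Or.inl ⟨f, hf.mono h, rfl⟩
  · exact Or.inr (Or.inl rfl)
  · exact Or.inr (Or.inr rfl)

/-- The ring `𝒟_X(U)` of holomorphic linear differential operators on `U`: the operators which
near every point of `U` lie in the algebra generated by the holomorphic functions,
`∂₁` and `∂₂`. An operator is given by its action on the Taylor series at every point. -/
noncomputable def DOp (U : Opens X) : Subalgebra ℂ (U → Module.End ℂ Ger) where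
  carrier := {T | ∀ p : U, ∃ (V : Opens X) (h : V ≤ U), p.1 ∈ V ∧
    resAlg h T ∈ Algebra.adjoin ℂ (gens V)}
  mul_mem' {S T} hS hT p := by
    obtain ⟨V, h, hp, hV⟩ := hS p
    obtain ⟨W, k, hq, hW⟩ := hT p
    refine ⟨V ⊓ W, inf_le_left.trans h, ⟨hp, hq⟩, ?_⟩
    rw [map_mul]
    exact mul_mem (resAlg_adjoin (inf_le_left : V ⊓ W ≤ V) hV)
      (resAlg_adjoin (inf_le_right : V ⊓ W ≤ W) hW)
  add_mem' {S T} hS hT p := by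
    obtain ⟨V, h, hp, hV⟩ := hS p
    obtain ⟨W, k, hq, hW⟩ := hT p
    refine ⟨V ⊓ W, inf_le_left.trans h, ⟨hp, hq⟩, ?_⟩
    rw [map_add]
    exact add_mem (resAlg_adjoin (inf_le_left : V ⊓ W ≤ V) hV)
      (resAlg_adjoin (inf_le_right : V ⊓ W ≤ W) hW)
  algebraMap_mem' c p := ⟨U, le_rfl, p.2, by
    rw [AlgHom.commutes]; exact Subalgebra.algebraMap_mem _ _⟩

theorem DOp_of_adjoin {U : Opens X} {T : U → Module.End ℂ Ger}
    (hT : T ∈ Algebra.adjoin ℂ (gens U)) : T ∈ DOp U :=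
  fun p => ⟨U, le_rfl, p.2, resAlg_adjoin le_rfl hT⟩

theorem resAlg_mem {U V : Opens X} (h : V ≤ U) {T : U → Module.End ℂ Ger} (hT : T ∈ DOp U) :
    resAlg h T ∈ DOp V := by
  intro p
  obtain ⟨W, k, hp, hW⟩ := hT ⟨p.1, h p.2⟩
  exact ⟨W ⊓ V, inf_le_right, ⟨hp, p.2⟩, resAlg_adjoin (inf_le_left : W ⊓ V ≤ W) hW⟩

theorem DOp_local {U : Opens X} {T : U → Module.End ℂ Ger}
    (hT : ∀ p : U, ∃ (V : Opens X) (h : V ≤ U), p.1 ∈ V ∧ resAlg h T ∈ DOp V) : T ∈ DOp U := by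
  intro p
  obtain ⟨V, h, hp, hV⟩ := hT p
  obtain ⟨W, k, hq, hW⟩ := hV ⟨p.1, hp⟩
  exact ⟨W, k.trans h, hq, hW⟩

/-- Restriction of differential operators. -/
noncomputable def DOpRes {U V : Opens X} (h : V ≤ U) : DOp U →ₐ[ℂ] DOp V :=
  ((resAlg h).comp (DOp U).val).codRestrict (DOp V) fun T => resAlg_mem h T.2

/-- The presheaf of rings `U ↦ 𝒟_X(U)`. -/
noncomputable def DPre : (Opens X)ᵒᵖ ⥤ RingCat.{0} where
  obj U := RingCat.of (DOp U.unop)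
  map i := RingCat.ofHom (DOpRes i.unop.le).toRingHom
  map_id _ := rfl
  map_comp _ _ := rfl

/-- The local predicate on families `(s p)_{p ∈ U}` attached to a property `P` that can be
restricted and is of local nature. -/
def locPred {α : Type} (P : ∀ U : Opens X, (U → α) → Prop)
    (hres : ∀ {U V : Opens X} (h : V ≤ U) (s : U → α), P U s → P V (res h s))
    (hloc : ∀ {U : Opens X} (s : U → α),
      (∀ p : U, ∃ (V : Opens X) (h : V ≤ U), p.1 ∈ V ∧ P V (res h s)) → P U s) :
    TopCat.LocalPredicate (fun _ : X => α) where
  pred {U} s := P U s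
  res i s hs := hres i.le s hs
  locality {U} s hs := hloc s fun p => by
    obtain ⟨V, hp, i, hV⟩ := hs p
    exact ⟨V, i.le, hp, hV⟩

theorem DPre_isSheaf : Presheaf.IsSheaf (Opens.grothendieckTopology X) DPre := by
  refine (TopCat.Presheaf.isSheaf_iff_isSheaf_comp (forget RingCat) DPre).2 ?_
  refine TopCat.Presheaf.isSheaf_of_iso ?_ (TopCat.subsheafToTypes
    (locPred (fun U T => T ∈ DOp U) (fun h _ hs => resAlg_mem h hs)
      (fun _ hs => DOp_local hs))).2
  exact Iso.refl _

/-- The sheaf of rings `𝒟_X`. -/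
noncomputable def DX : Sheaf (Opens.grothendieckTopology X) RingCat.{0} := ⟨DPre, DPre_isSheaf⟩

/-! ### Sheaves of `𝒟_X`-modules of families of power series -/

/-- A property of families `(s p)_{p ∈ U}` of power series which defines a sheaf of
`𝒟_X`-modules. -/
structure DFam where
  pred : ∀ U : Opens X, (U → Ger) → Prop
  zero : ∀ U : Opens X, pred U 0
  neg : ∀ {U : Opens X} {s : U → Ger}, pred U s → pred U (-s)
  add : ∀ {U : Opens X} {s t : U → Ger}, pred U s → pred U t → pred U (s + t)
  mul : ∀ {U : Opens X} {f : ℂ × ℂ → ℂ} {s : U → Ger}, AnalyticOnNhd ℂ f U → pred U s →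
    pred U fun p => taylor f p.1 * s p
  d1 : ∀ {U : Opens X} {s : U → Ger}, pred U s → pred U fun p => d1 (s p)
  d2 : ∀ {U : Opens X} {s : U → Ger}, pred U s → pred U fun p => d2 (s p)
  res : ∀ {U V : Opens X} (h : V ≤ U) (s : U → Ger), pred U s → pred V (res h s)
  loc : ∀ {U : Opens X} (s : U → Ger),
    (∀ p : U, ∃ (V : Opens X) (h : V ≤ U), p.1 ∈ V ∧ pred V (GevreyIrr.res h s)) → pred U s

namespace DFam

variable (F : DFam)

theorem const_mul {U : Opens X} (c : ℂ) {s : U → Ger} (hs : F.pred U s) :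
    F.pred U fun p => c • s p := by
  have h : ∀ p, taylor (fun _ => c) p = algebraMap ℂ Ger c := by
    intro p
    have hfl : Flat Set.univ fun _ => algebraMap ℂ Ger c := by
      intro q _ i j
      have h1 : GevreyIrr.d1 (algebraMap ℂ Ger c) = 0 := by
        refine ger_ext fun i j => ?_
        have : PowerSeries.coeff (i + 1) (PowerSeries.coeff j (algebraMap ℂ Ger c)) = 0 := by
          rw [PowerSeries.algebraMap_apply, PowerSeries.coeff_C]
          split_ifs
          · rw [PowerSeries.algebraMap_apply, PowerSeries.coeff_C]; simp
          · simp
        rw [cf_d1]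
        simp [cf, this]
      have h2 : GevreyIrr.d2 (algebraMap ℂ Ger c) = 0 := by
        refine ger_ext fun i j => ?_
        have : PowerSeries.coeff i (PowerSeries.coeff (j + 1) (algebraMap ℂ Ger c)) = 0 := by
          rw [PowerSeries.algebraMap_apply, PowerSeries.coeff_C]
          simp
        rw [cf_d2]
        simp [cf, this]
      rw [h1, h2]
      refine (hasFDerivAt_const (𝕜 := ℂ) (cf i j (algebraMap ℂ Ger c)) q).congr_fderiv ?_
      apply ContinuousLinearMap.ext
      rintro ⟨u, w⟩
      simp
    rw [hfl.eq_taylor isOpen_univ (Set.mem_univ p)]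
    congr 1
    funext x
    simp [cf, PowerSeries.algebraMap_apply]
  have := F.mul (f := fun _ => c) (fun x _ => analyticAt_const) hs
  simpa [h, Algebra.smul_def] using this

theorem adjoin_apply {U : Opens X} {T : U → Module.End ℂ Ger}
    (hT : T ∈ Algebra.adjoin ℂ (gens U)) :
    ∀ {s : U → Ger}, F.pred U s → F.pred U fun p => T p (s p) := by
  induction hT using Algebra.adjoin_induction with
  | mem T hT =>
    intro s hs
    rcases hT with ⟨f, hf, rfl⟩ | rfl | rfl
    · exact F.mul hf hs
    · exact F.d1 hs
    · exact F.d2 hs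
  | algebraMap c => exact fun hs => F.const_mul c hs
  | add S T _ _ h1 h2 => exact fun hs => F.add (h1 hs) (h2 hs)
  | mul S T _ _ h1 h2 => exact fun hs => h1 (h2 hs)

theorem DOp_apply {U : Opens X} {T : U → Module.End ℂ Ger} (hT : T ∈ DOp U) {s : U → Ger}
    (hs : F.pred U s) : F.pred U fun p => T p (s p) := by
  refine F.loc _ fun p => ?_
  obtain ⟨V, h, hp, hV⟩ := hT p
  exact ⟨V, h, hp, F.adjoin_apply hV (F.res h s hs)⟩

/-- The sections over `U`. -/
def sec (U : Opens X) : AddSubgroup (U → Ger) where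
  carrier := {s | F.pred U s}
  zero_mem' := F.zero U
  add_mem' := F.add
  neg_mem' := F.neg

/-- Differential operators act pointwise. -/
noncomputable instance secModule (U : Opens X) : Module (DOp U) (F.sec U) where
  smul T s := ⟨fun p => T.1 p (s.1 p), F.DOp_apply T.2 s.2⟩
  one_smul _ := rfl
  mul_smul _ _ _ := rfl
  smul_zero T := Subtype.ext (funext fun p => map_zero (T.1 p))
  smul_add T s t := Subtype.ext (funext fun p => map_add (T.1 p) (s.1 p) (t.1 p))
  add_smul _ _ _ := rfl
  zero_smul _ := rfl

/-- The underlying presheaf of abelian groups. -/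
def abPre : (Opens X)ᵒᵖ ⥤ AddCommGrpCat.{0} where
  obj U := AddCommGrpCat.of (F.sec U.unop)
  map {_ V} i := AddCommGrpCat.ofHom
    { toFun := fun s => (⟨GevreyIrr.res i.unop.le s.1, F.res i.unop.le s.1 s.2⟩ : F.sec V.unop)
      map_zero' := rfl
      map_add' := fun _ _ => rfl }
  map_id _ := rfl
  map_comp _ _ := rfl

theorem abPre_isSheaf : Presheaf.IsSheaf (Opens.grothendieckTopology X) F.abPre := by
  refine (TopCat.Presheaf.isSheaf_iff_isSheaf_comp (forget AddCommGrpCat) F.abPre).2 ?_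
  refine TopCat.Presheaf.isSheaf_of_iso ?_ (TopCat.subsheafToTypes
    (locPred F.pred F.res F.loc)).2
  exact Iso.refl _

noncomputable instance (U : (Opens X)ᵒᵖ) : Module (DX.obj.obj U) (F.abPre.obj U) :=
  F.secModule U.unop

/-- The sheaf of left `𝒟_X`-modules. -/
noncomputable def sheaf : SheafOfModules.{0} DX where
  val := PresheafOfModules.ofPresheaf (R := DX.obj) F.abPre fun _ _ _ _ _ => rfl
  isSheaf := F.abPre_isSheaf

variable {F}

/-- The inclusion of sheaves of `𝒟_X`-modules. -/
noncomputable def incl {G : DFam} (h : ∀ U s, F.pred U s → G.pred U s) : F.sheaf ⟶ G.sheaf :=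
  ⟨PresheafOfModules.homMk
    { app := fun U => AddCommGrpCat.ofHom
        { toFun := fun s => (⟨s.1, h _ _ s.2⟩ : G.sec U.unop)
          map_zero' := rfl
          map_add' := fun _ _ => rfl }
      naturality := fun _ _ _ => rfl } fun _ _ _ => rfl⟩

end DFam


/-! ### Formal, Gevrey and convergent power series along `Y = {x₂ = 0}` -/

/-- A family `s` on `U` is a section over `U` of the formal completion of `𝒪_X` along
`Y = {x₂ = 0}`, a sheaf on `X` supported by `Y`: there are holomorphic functions `f_j(x₁)` on
`U ∩ Y` such that `s p` is the Taylor series of `∑ f_j(x₁) x₂ ^ j` at each `p ∈ U ∩ Y`. -/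
def IsFormal (U : Opens X) (s : U → Ger) : Prop :=
  (∀ p : U, p.1.2 ≠ 0 → s p = 0) ∧
  ∃ f : ℕ → ℂ → ℂ, (∀ j, DifferentiableOn ℂ (f j) {z | ((z, 0) : ℂ × ℂ) ∈ U}) ∧
    ∀ p : U, p.1.2 = 0 → ∀ i j, cf i j (s p) = iteratedDeriv i (f j) p.1.1 / i !

/-- A family `s` on `U` is a section over `U` of the restriction of `𝒪_X` to `Y = {x₂ = 0}`,
extended by zero: locally on `U ∩ Y` it is the family of Taylor series of a holomorphic function
on an open subset of `X`. -/
def IsConv (U : Opens X) (s : U → Ger) : Prop :=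
  (∀ p : U, p.1.2 ≠ 0 → s p = 0) ∧
  ∀ p : U, p.1.2 = 0 → ∃ (V : Opens X) (f : ℂ × ℂ → ℂ), p.1 ∈ V ∧ AnalyticOnNhd ℂ f V ∧
    ∀ q : U, q.1 ∈ V → q.1.2 = 0 → s q = taylor f q.1

open Classical in
/-- Extension by zero. -/
noncomputable def ext (U : Opens X) (s : U → Ger) (x : ℂ × ℂ) : Ger :=
  if h : x ∈ U then s ⟨x, h⟩ else 0

theorem ext_apply {U : Opens X} (s : U → Ger) {x : ℂ × ℂ} (h : x ∈ U) : ext U s x = s ⟨x, h⟩ :=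
  dif_pos h

theorem isOpen_slice (U : Opens X) : IsOpen {z : ℂ | ((z, 0) : ℂ × ℂ) ∈ U} :=
  U.2.preimage (Continuous.prodMk_left 0)

theorem isFormal_iff {U : Opens X} {s : U → Ger} : IsFormal U s ↔
    (∀ p : U, p.1.2 ≠ 0 → s p = 0) ∧ ∀ z : ℂ, ((z, 0) : ℂ × ℂ) ∈ U → ∀ i j,
      HasDerivAt (fun w => cf i j (ext U s (w, 0))) (cf i j (d1 (ext U s (z, 0)))) z := by
  have hU := isOpen_slice U
  refine and_congr_right fun _ => ⟨?_, fun h => ?_⟩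
  · rintro ⟨f, hf, hs⟩ z hz i j
    have ha : AnalyticOnNhd ℂ (deriv^[i] (f j)) {z | ((z, 0) : ℂ × ℂ) ∈ U} :=
      ((hf j).analyticOnNhd hU).iterated_deriv i
    have he : ∀ w, ((w, 0) : ℂ × ℂ) ∈ U → ∀ i j, cf i j (ext U s (w, 0)) =
        iteratedDeriv i (f j) w / i ! := by
      intro w hw i j
      rw [ext_apply s hw]
      exact hs _ rfl i j
    rw [cf_d1, he z hz]
    have hd : HasDerivAt (fun w => iteratedDeriv i (f j) w / (i ! : ℂ))
        (iteratedDeriv (i + 1) (f j) z / (i ! : ℂ)) z := by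
      rw [iteratedDeriv_succ]
      have : DifferentiableAt ℂ (iteratedDeriv i (f j)) z := by
        rw [iteratedDeriv_eq_iterate]; exact (ha z hz).differentiableAt
      exact this.hasDerivAt.div_const _
    have hi' : (i + 1 : ℂ) ≠ 0 := by exact_mod_cast i.succ_ne_zero
    have hi : (i ! : ℂ) ≠ 0 := by exact_mod_cast i.factorial_ne_zero
    refine (hd.congr_of_eventuallyEq ?_).congr_deriv ?_
    · filter_upwards [hU.mem_nhds hz] with w hw using he w hw i j
    · rw [Nat.factorial_succ]; push_cast; field_simp
  · refine ⟨fun j w => cf 0 j (ext U s (w, 0)), fun j z hz =>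
      (h z hz 0 j).differentiableAt.differentiableWithinAt, ?_⟩
    have key : ∀ i j, ∀ z : ℂ, ((z, 0) : ℂ × ℂ) ∈ U →
        iteratedDeriv i (fun w => cf 0 j (ext U s (w, 0))) z =
          i ! * cf i j (ext U s (z, 0)) := by
      intro i j
      induction i with
      | zero => intro z _; simp
      | succ i ih =>
        intro z hz
        have hev : iteratedDeriv i (fun w => cf 0 j (ext U s (w, 0))) =ᶠ[nhds z]
            fun w => i ! * cf i j (ext U s (w, 0)) := by
          filter_upwards [hU.mem_nhds hz] with w hw using ih w hw
        rw [iteratedDeriv_succ, hev.deriv_eq, ((h z hz i j).const_mul _).deriv, cf_d1,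
          Nat.factorial_succ]
        push_cast; ring
    rintro ⟨⟨z, w⟩, hp⟩ hw i j
    obtain rfl : w = 0 := hw
    have hi : (i ! : ℂ) ≠ 0 := by exact_mod_cast i.factorial_ne_zero
    rw [key i j z hp, ext_apply s hp]
    field_simp

theorem IsFormal.zero (U : Opens X) : IsFormal U 0 := by
  rw [isFormal_iff]
  refine ⟨fun _ _ => rfl, fun z hz i j => ?_⟩
  have : ∀ x, ext U 0 x = 0 := fun x => by unfold ext; split_ifs <;> rfl
  simpa [this] using hasDerivAt_const z (0 : ℂ)

theorem IsFormal.neg {U : Opens X} {s : U → Ger} (hs : IsFormal U s) : IsFormal U (-s) := by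
  rw [isFormal_iff] at *
  refine ⟨fun p hp => by simp [hs.1 p hp], fun z hz i j => ?_⟩
  have : ∀ x, ext U (-s) x = -ext U s x := fun x => by unfold ext; split_ifs <;> simp
  simp only [this, map_neg]
  exact (hs.2 z hz i j).neg

theorem IsFormal.add {U : Opens X} {s t : U → Ger} (hs : IsFormal U s) (ht : IsFormal U t) :
    IsFormal U (s + t) := by
  rw [isFormal_iff] at *
  refine ⟨fun p hp => by simp [hs.1 p hp, ht.1 p hp], fun z hz i j => ?_⟩
  have : ∀ x, ext U (s + t) x = ext U s x + ext U t x := fun x => by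
    unfold ext; split_ifs <;> simp
  simp only [this, map_add]
  exact (hs.2 z hz i j).add (ht.2 z hz i j)

theorem IsFormal.d1 {U : Opens X} {s : U → Ger} (hs : IsFormal U s) :
    IsFormal U fun p => d1 (s p) := by
  rw [isFormal_iff] at *
  refine ⟨fun p hp => by simp [hs.1 p hp], fun z hz i j => ?_⟩
  have : ∀ x, ext U (fun p => GevreyIrr.d1 (s p)) x = GevreyIrr.d1 (ext U s x) := fun x => by
    unfold ext; split_ifs <;> simp
  simp only [this, cf_d1 (ext U s _), cf_d1 (GevreyIrr.d1 _)]
  exact ((hs.2 z hz (i + 1) j).const_mul _).congr_deriv (by simp)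

theorem IsFormal.d2 {U : Opens X} {s : U → Ger} (hs : IsFormal U s) :
    IsFormal U fun p => d2 (s p) := by
  rw [isFormal_iff] at *
  refine ⟨fun p hp => by simp [hs.1 p hp], fun z hz i j => ?_⟩
  have : ∀ x, ext U (fun p => GevreyIrr.d2 (s p)) x = GevreyIrr.d2 (ext U s x) := fun x => by
    unfold ext; split_ifs <;> simp
  simp only [this, d1_d2]
  simp only [cf_d2]
  exact (hs.2 z hz i (j + 1)).const_mul _

theorem Flat.slice {V : Set (ℂ × ℂ)} {S : ℂ × ℂ → Ger} (h : Flat V S) {z w : ℂ}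
    (hz : (z, w) ∈ V) (i j : ℕ) :
    HasDerivAt (fun u => cf i j (S (u, w))) (cf i j (GevreyIrr.d1 (S (z, w)))) z := by
  have hl : HasDerivAt (fun u : ℂ => (u, w)) ((1 : ℂ), (0 : ℂ)) z :=
    (hasDerivAt_id _).prodMk (hasDerivAt_const _ _)
  have := (h (z, w) hz i j).comp_hasDerivAt z hl
  refine this.congr_deriv ?_
  simp

theorem IsFormal.mul {U : Opens X} {f : ℂ × ℂ → ℂ} {s : U → Ger} (hf : AnalyticOnNhd ℂ f U)
    (hs : IsFormal U s) : IsFormal U fun p => taylor f p.1 * s p := by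
  rw [isFormal_iff] at *
  refine ⟨fun p hp => by simp [hs.1 p hp], fun z hz i j => ?_⟩
  have h : ∀ x, ext U (fun p => taylor f p.1 * s p) x = taylor f x * ext U s x := fun x => by
    unfold ext; split_ifs <;> simp
  have hfl := taylor_flat U.2 hf
  simp only [h, cf_mul]
  have := HasDerivAt.fun_sum (u := Finset.HasAntidiagonal.antidiagonal j) fun q _ =>
    HasDerivAt.fun_sum (u := Finset.HasAntidiagonal.antidiagonal i) fun r _ =>
      (hfl.slice hz r.1 q.1).mul (hs.2 z hz r.2 q.2)
  refine this.congr_deriv ?_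
  rw [d1_mul, map_add, cf_mul, cf_mul]
  simp only [← Finset.sum_add_distrib]

theorem IsFormal.res {U V : Opens X} (h : V ≤ U) (s : U → Ger) (hs : IsFormal U s) :
    IsFormal V (res h s) := by
  obtain ⟨h0, f, hf, hs⟩ := hs
  exact ⟨fun p hp => h0 _ hp, f, fun j => (hf j).mono fun z hz => h hz, fun p hp => hs _ hp⟩

theorem IsFormal.loc {U : Opens X} (s : U → Ger)
    (hs : ∀ p : U, ∃ (V : Opens X) (h : V ≤ U), p.1 ∈ V ∧ IsFormal V (GevreyIrr.res h s)) :
    IsFormal U s := by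
  rw [isFormal_iff]
  refine ⟨fun p hp => ?_, fun z hz i j => ?_⟩
  · obtain ⟨V, h, hpV, hV⟩ := hs p
    exact hV.1 ⟨p.1, hpV⟩ hp
  · obtain ⟨V, h, hpV, hV⟩ := hs ⟨(z, 0), hz⟩
    have he : ∀ x, x ∈ V → ext V (GevreyIrr.res h s) x = ext U s x := fun x hx => by
      rw [ext_apply _ hx, ext_apply _ (h hx)]; rfl
    have := (isFormal_iff.1 hV).2 z hpV i j
    rw [he _ hpV] at this
    refine this.congr_of_eventuallyEq ?_
    filter_upwards [(isOpen_slice V).mem_nhds hpV] with w hw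
    rw [he _ hw]

/-- The sections of the formal completion whose germs satisfy a pointwise condition. -/
def formalFam (C : Ger → Prop) (h0 : C 0) (hn : ∀ f, C f → C (-f))
    (ha : ∀ f g, C f → C g → C (f + g)) (hm : ∀ a f, IsConvergent a → C f → C (a * f))
    (h1 : ∀ f, C f → C (d1 f)) (h2 : ∀ f, C f → C (d2 f)) : DFam where
  pred U s := IsFormal U s ∧ ∀ p, C (s p)
  zero U := ⟨.zero U, fun _ => h0⟩
  neg hs := ⟨hs.1.neg, fun p => hn _ (hs.2 p)⟩
  add hs ht := ⟨hs.1.add ht.1, fun p => ha _ _ (hs.2 p) (ht.2 p)⟩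
  mul {U} _ _ hf hs := ⟨hs.1.mul hf, fun p => hm _ _ (taylor_convergent U.2 hf p.2) (hs.2 p)⟩
  d1 hs := ⟨hs.1.d1, fun p => h1 _ (hs.2 p)⟩
  d2 hs := ⟨hs.1.d2, fun p => h2 _ (hs.2 p)⟩
  res h s hs := ⟨hs.1.res h s, fun _ => hs.2 _⟩
  loc s hs := ⟨.loc s fun p => let ⟨V, h, hp, hV⟩ := hs p; ⟨V, h, hp, hV.1⟩,
    fun p => let ⟨_, _, hp, hV⟩ := hs p; hV.2 ⟨p.1, hp⟩⟩

/-- `𝒪_{X^|Y}(s)`, the sheaf of Gevrey series of order `s` along `Y`, for `1 ≤ s ≤ ∞`. -/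
def gevrey (s : Set.Ici (1 : ℝ≥0∞)) : DFam :=
  formalFam (IsGevrey s.1) (.zero _) (fun _ => .neg) (fun _ _ => .add)
    (fun _ _ => .mul s.2) (fun _ => .d1) (fun _ => .d2 s.2)

/-- `𝒪_{X^|Y}(<s)`, the union of the sheaves `𝒪_{X^|Y}(r)` with `1 ≤ r < s`, for `1 < s ≤ ∞`. -/
def gevreyLT (s : Set.Ioi (1 : ℝ≥0∞)) : DFam :=
  formalFam (fun f => ∃ r, 1 ≤ r ∧ r < s.1 ∧ IsGevrey r f) ⟨1, le_rfl, s.2, .zero _⟩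
    (fun _ ⟨r, h1, h2, h⟩ => ⟨r, h1, h2, h.neg⟩)
    (fun _ _ ⟨r, h1, h2, h⟩ ⟨r', _, h2', h'⟩ => ⟨max r r', h1.trans (le_max_left _ _),
      max_lt h2 h2', (h.mono (le_max_left _ _)).add (h'.mono (le_max_right _ _))⟩)
    (fun _ _ ha ⟨r, h1, h2, h⟩ => ⟨r, h1, h2, h.mul h1 ha⟩)
    (fun _ ⟨r, h1, h2, h⟩ => ⟨r, h1, h2, h.d1⟩)
    (fun _ ⟨r, h1, h2, h⟩ => ⟨r, h1, h2, h.d2 h1⟩)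

/-- `𝒪_{X|Y}`, the restriction of `𝒪_X` to `Y`, extended by zero. -/
def conv : DFam where
  pred := IsConv
  zero U := ⟨fun _ _ => rfl, fun p _ => ⟨U, fun _ => 0, p.2, fun _ _ => analyticAt_const,
    fun q _ _ => by
      have := (show Flat Set.univ fun _ => (0 : Ger) from fun q _ i j => by
        refine ((hasFDerivAt_const (𝕜 := ℂ) (0 : ℂ) q).congr_fderiv ?_).congr_of_eventuallyEq ?_
        · apply ContinuousLinearMap.ext
          rintro ⟨u, w⟩
          simp
        · simp).eq_taylor isOpen_univ (Set.mem_univ q.1)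
      simpa using this⟩⟩
  neg {U s} hs := ⟨fun p hp => by simp [hs.1 p hp], fun p hp => by
    obtain ⟨V, f, hpV, hf, h⟩ := hs.2 p hp
    refine ⟨V, fun x => -1 * f x, hpV, fun x hx => analyticAt_const.mul (hf x hx), ?_⟩
    intro q hq hq0
    refine ger_ext fun i j => ?_
    simp only [Pi.neg_apply, map_neg, h q hq hq0, taylor, cf_mkGer, pd_iter_const_mul]
    ring⟩
  add {U s t} hs ht := ⟨fun p hp => by simp [hs.1 p hp, ht.1 p hp], fun p hp => by
    obtain ⟨V, f, hpV, hf, h⟩ := hs.2 p hp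
    obtain ⟨W, g, hpW, hg, k⟩ := ht.2 p hp
    refine ⟨V ⊓ W, fun x => f x + g x, ⟨hpV, hpW⟩, fun x hx => (hf x hx.1).add (hg x hx.2), ?_⟩
    intro q hq hq0
    have hF := taylor_flat V.2 hf
    have hG := taylor_flat W.2 hg
    have hFG : Flat (V ⊓ W : Opens X) fun x => taylor f x + taylor g x := fun x hx i j => by
      simp only [map_add]
      refine ((hF x hx.1 i j).add (hG x hx.2 i j)).congr_fderiv ?_
      apply ContinuousLinearMap.ext
      rintro ⟨u, w⟩
      simp
      ring
    have := hFG.eq_taylor (V ⊓ W).2 hq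
    rw [Pi.add_apply, h q hq.1 hq0, k q hq.2 hq0, this]
    simp [taylor]⟩
  mul {U f s} hf hs := ⟨fun p hp => by simp [hs.1 p hp], fun p hp => by
    obtain ⟨V, g, hpV, hg, h⟩ := hs.2 p hp
    refine ⟨U ⊓ V, fun x => f x * g x, ⟨p.2, hpV⟩, fun x hx => (hf x hx.1).mul (hg x hx.2), ?_⟩
    intro q hq hq0
    simp only [h q hq.2 hq0]
    exact taylor_mul (U ⊓ V).2 (hf.mono fun x hx => hx.1) (hg.mono fun x hx => hx.2) hq⟩
  d1 {U s} hs := ⟨fun p hp => by simp [hs.1 p hp], fun p hp => by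
    obtain ⟨V, g, hpV, hg, h⟩ := hs.2 p hp
    refine ⟨V, pd (1, 0) g, hpV, pd_analytic hg, fun q hq hq0 => ?_⟩
    simp only [h q hq hq0]
    exact d1_taylor V.2 hg hq⟩
  d2 {U s} hs := ⟨fun p hp => by simp [hs.1 p hp], fun p hp => by
    obtain ⟨V, g, hpV, hg, h⟩ := hs.2 p hp
    refine ⟨V, pd (0, 1) g, hpV, pd_analytic hg, fun q hq hq0 => ?_⟩
    simp only [h q hq hq0]
    exact d2_taylor V.2 hg hq⟩
  res h s hs := ⟨fun p hp => hs.1 _ hp, fun p hp => by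
    obtain ⟨V, g, hpV, hg, k⟩ := hs.2 ⟨p.1, h p.2⟩ hp
    exact ⟨V, g, hpV, hg, fun q hq hq0 => k _ hq hq0⟩⟩
  loc {U} s hs := ⟨fun p hp => by
      obtain ⟨V, h, hpV, hV⟩ := hs p
      exact hV.1 ⟨p.1, hpV⟩ hp, fun p hp => by
    obtain ⟨V, h, hpV, hV⟩ := hs p
    obtain ⟨W, g, hpW, hg, k⟩ := hV.2 ⟨p.1, hpV⟩ hp
    exact ⟨V ⊓ W, g, ⟨hpV, hpW⟩, fun x hx => hg x hx.2,
      fun q hq hq0 => k ⟨q.1, hq.1⟩ hq.2 hq0⟩⟩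

theorem conv_le_gevrey (t : Set.Ici (1 : ℝ≥0∞)) (U : Opens X) (s : U → Ger)
    (hs : conv.pred U s) : (gevrey t).pred U s := by
  refine ⟨.loc s fun p => ?_, fun p => ?_⟩
  · by_cases hp : p.1.2 = 0
    · obtain ⟨V, f, hpV, hf, h⟩ := hs.2 p hp
      refine ⟨U ⊓ V, inf_le_left, ⟨p.2, hpV⟩, isFormal_iff.2 ⟨fun q hq => hs.1 _ hq, ?_⟩⟩
      intro z hz i j
      have he : ∀ w, ((w, 0) : ℂ × ℂ) ∈ U ⊓ V →
          ext (U ⊓ V) (res inf_le_left s) (w, 0) = taylor f (w, 0) := fun w hw => by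
        rw [ext_apply _ hw]; exact h ⟨(w, 0), hw.1⟩ hw.2 rfl
      rw [he z hz]
      refine ((taylor_flat V.2 hf).slice hz.2 i j).congr_of_eventuallyEq ?_
      filter_upwards [(isOpen_slice (U ⊓ V)).mem_nhds hz] with w hw
      rw [he w hw]
    · refine ⟨U ⊓ ⟨{x : ℂ × ℂ | x.2 ≠ 0}, isOpen_ne_fun continuous_snd continuous_const⟩,
        inf_le_left, ⟨p.2, hp⟩, isFormal_iff.2 ⟨fun q hq => hs.1 _ hq, ?_⟩⟩
      intro z hz
      exact absurd rfl hz.2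
  · by_cases hp : p.1.2 = 0
    · obtain ⟨V, f, hpV, hf, h⟩ := hs.2 p hp
      rw [h p hpV hp]
      refine IsGevrey.mono t.2 ((isGevrey_iff (by simp)).2 ?_)
      simpa using isConvergent_iff.1 (taylor_convergent V.2 hf hpV)
    · rw [hs.1 p hp]; exact .zero _

theorem gevrey_mono {s t : Set.Ici (1 : ℝ≥0∞)} (hst : s ≤ t) (U : Opens X) (f : U → Ger)
    (hf : (gevrey s).pred U f) : (gevrey t).pred U f :=
  ⟨hf.1, fun p => (hf.2 p).mono hst⟩

theorem gevreyLT_le (s : Set.Ioi (1 : ℝ≥0∞)) (U : Opens X) (f : U → Ger)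
    (hf : (gevreyLT s).pred U f) : (gevrey ⟨s.1, Set.Ioi_subset_Ici_self s.2⟩).pred U f :=
  ⟨hf.1, fun p => let ⟨_, _, h2, h⟩ := hf.2 p; h.mono h2.le⟩

/-! ### The sheaf of homomorphisms -/

section Sections

variable (F : SheafOfModules.{0} DX)

/-- The sections of a sheaf of `𝒟_X`-modules over `U`. -/
def Sec (U : Opens X) : Type := F.val.presheaf.obj (op U)

noncomputable instance (U : Opens X) : AddCommGroup (Sec F U) :=
  inferInstanceAs (AddCommGroup (F.val.obj (op U)))

noncomputable instance (U : Opens X) : Module (DOp U) (Sec F U) :=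
  inferInstanceAs (Module (DX.obj.obj (op U)) (F.val.obj (op U)))

noncomputable instance (U : Opens X) : Module ℂ (Sec F U) :=
  Module.compHom _ (algebraMap ℂ (DOp U))

theorem sec_smul_comm {U : Opens X} (c : ℂ) (T : DOp U) (s : Sec F U) : c • T • s = T • c • s := by
  change algebraMap ℂ (DOp U) c • T • s = T • algebraMap ℂ (DOp U) c • s
  rw [smul_smul, smul_smul, Algebra.commutes]

/-- Restriction of sections. -/
noncomputable def Sec.res {U V : Opens X} (h : V ≤ U) : Sec F U →+ Sec F V :=
  (F.val.presheaf.map (homOfLE h).op).hom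

theorem Sec.res_smul {U V : Opens X} (h : V ≤ U) (T : DOp U) (s : Sec F U) :
    Sec.res F h (T • s) = DOpRes h T • Sec.res F h s :=
  PresheafOfModules.map_smul F.val (homOfLE h).op (show DX.obj.obj (op U) from T) s

theorem Sec.res_csmul {U V : Opens X} (h : V ≤ U) (c : ℂ) (s : Sec F U) :
    Sec.res F h (c • s) = c • Sec.res F h s := by
  change Sec.res F h (algebraMap ℂ (DOp U) c • s) = algebraMap ℂ (DOp V) c • Sec.res F h s
  rw [Sec.res_smul, AlgHom.commutes]

theorem Sec.res_res {U V W : Opens X} (h : V ≤ U) (k : W ≤ V) (s : Sec F U) :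
    Sec.res F k (Sec.res F h s) = Sec.res F (k.trans h) s := by
  have := F.val.presheaf.map_comp (homOfLE h).op (homOfLE k).op
  exact (congrArg (fun f => f.hom s) this).symm

theorem Sec.glue {ι : Type} (U : Opens X) (V : ι → Opens X) (hV : ∀ i, V i ≤ U)
    (hU : U ≤ iSup V) (s : ∀ i, Sec F (V i))
    (hs : ∀ i j, Sec.res F (inf_le_left : V i ⊓ V j ≤ V i) (s i) =
      Sec.res F (inf_le_right : V i ⊓ V j ≤ V j) (s j)) :
    ∃! t : Sec F U, ∀ i, Sec.res F (hV i) t = s i :=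
  TopCat.Sheaf.existsUnique_gluing' (X := X) ⟨F.val.presheaf, F.isSheaf⟩ V U
    (fun i => homOfLE (hV i)) hU s hs

theorem Sec.eq_of_local {ι : Type} (U : Opens X) (V : ι → Opens X) (hV : ∀ i, V i ≤ U)
    (hU : U ≤ iSup V) {s t : Sec F U} (h : ∀ i, Sec.res F (hV i) s = Sec.res F (hV i) t) :
    s = t :=
  (Sec.glue F U V hV hU (fun i => Sec.res F (hV i) t) (fun i j => by
    rw [Sec.res_res, Sec.res_res])).unique h fun _ => rfl

/-- The map on sections induced by a morphism of sheaves of `𝒟_X`-modules. -/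
noncomputable def Sec.map {F G : SheafOfModules.{0} DX} (f : F ⟶ G) (U : Opens X) :
    Sec F U →ₗ[DOp U] Sec G U :=
  (f.val.app (op U)).hom

theorem Sec.map_res {F G : SheafOfModules.{0} DX} (f : F ⟶ G) {U V : Opens X} (h : V ≤ U)
    (s : Sec F U) : Sec.map f V (Sec.res F h s) = Sec.res G h (Sec.map f U s) :=
  PresheafOfModules.naturality_apply f.val (homOfLE h).op s

theorem Sec.map_csmul {F G : SheafOfModules.{0} DX} (f : F ⟶ G) {U : Opens X} (c : ℂ)
    (s : Sec F U) : Sec.map f U (c • s) = c • Sec.map f U s :=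
  (Sec.map f U).map_smul (algebraMap ℂ (DOp U) c) s

end Sections

/-- The vector space `Hom_{𝒟_U}(M|_U, F|_U)`: families of `𝒟_X(V)`-linear maps `M(V) → F(V)` for
`V ⊆ U`, compatible with restrictions. -/
noncomputable def HomOn (M F : SheafOfModules.{0} DX) (U : Opens X) :
    Submodule ℂ (∀ V : Set.Iic U, Sec M V.1 → Sec F V.1) where
  carrier := {ξ | (∀ V m n, ξ V (m + n) = ξ V m + ξ V n) ∧
    (∀ V (T : DOp V.1) m, ξ V (T • m) = T • ξ V m) ∧
    ∀ V W (h : W.1 ≤ V.1) m, ξ W (Sec.res M h m) = Sec.res F h (ξ V m)}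
  zero_mem' := ⟨fun _ _ _ => (add_zero _).symm, fun _ _ _ => (smul_zero _).symm,
    fun _ _ _ _ => (map_zero _).symm⟩
  add_mem' {ξ η} hξ hη := by
    refine ⟨fun V m n => ?_, fun V T m => ?_, fun V W h m => ?_⟩
    · simp only [Pi.add_apply, hξ.1, hη.1]; abel
    · simp only [Pi.add_apply, hξ.2.1, hη.2.1, smul_add]
    · simp only [Pi.add_apply, hξ.2.2 V W h, hη.2.2 V W h, map_add]
  smul_mem' c ξ hξ := by
    refine ⟨fun V m n => ?_, fun V T m => ?_, fun V W h m => ?_⟩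
    · simp only [Pi.smul_apply, hξ.1, smul_add]
    · simp only [Pi.smul_apply, hξ.2.1]; exact sec_smul_comm _ _ _ _
    · simp only [Pi.smul_apply, hξ.2.2 V W h, Sec.res_csmul]

/-- Restriction of homomorphisms. -/
noncomputable def HomOn.res (M F : SheafOfModules.{0} DX) {U V : Opens X} (h : V ≤ U) :
    HomOn M F U →ₗ[ℂ] HomOn M F V where
  toFun ξ := ⟨fun W => ξ.1 ⟨W.1, W.2.trans h⟩, fun W => ξ.2.1 ⟨W.1, W.2.trans h⟩,
    fun W => ξ.2.2.1 ⟨W.1, W.2.trans h⟩,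
    fun W W' => ξ.2.2.2 ⟨W.1, W.2.trans h⟩ ⟨W'.1, W'.2.trans h⟩⟩
  map_add' _ _ := rfl
  map_smul' _ _ := rfl

/-- Composition with a morphism of sheaves. -/
noncomputable def HomOn.map (M : SheafOfModules.{0} DX) {F G : SheafOfModules.{0} DX} (f : F ⟶ G)
    (U : Opens X) : HomOn M F U →ₗ[ℂ] HomOn M G U where
  toFun ξ := ⟨fun V m => Sec.map f V.1 (ξ.1 V m),
    fun V m n => by simp only [ξ.2.1, map_add],
    fun V T m => by simp only [ξ.2.2.1, map_smul],
    fun V W h m => by simp only [ξ.2.2.2 V W h]; exact Sec.map_res f h _⟩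
  map_add' ξ η := Subtype.ext (by
    funext V m; exact map_add (Sec.map f V.1) (ξ.1 V m) (η.1 V m))
  map_smul' c ξ := Subtype.ext (by
    funext V m; exact Sec.map_csmul f c (ξ.1 V m))

/-- The presheaf `U ↦ Hom_{𝒟_U}(M|_U, F|_U)` of vector spaces. -/
noncomputable def homPre (M F : SheafOfModules.{0} DX) : (Opens X)ᵒᵖ ⥤ ModuleCat.{0} ℂ where
  obj U := ModuleCat.of ℂ (HomOn M F U.unop)
  map i := ModuleCat.ofHom (HomOn.res M F i.unop.le)
  map_id _ := rfl
  map_comp _ _ := rfl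

theorem homPre_isSheaf (M F : SheafOfModules.{0} DX) :
    Presheaf.IsSheaf (Opens.grothendieckTopology X) (homPre M F) := by
  refine (TopCat.Presheaf.isSheaf_iff_isSheafUniqueGluing (X := X) (homPre M F)).2 ?_
  intro ι U s hs
  let σ : ∀ i, HomOn M F (U i) := s
  have hc : ∀ i j W (hi : W ≤ U i) (hj : W ≤ U j), (σ i).1 ⟨W, hi⟩ = (σ j).1 ⟨W, hj⟩ := by
    intro i j W hi hj
    have h : HomOn.res M F (inf_le_left : U i ⊓ U j ≤ U i) (σ i) =
        HomOn.res M F (inf_le_right : U i ⊓ U j ≤ U j) (σ j) := hs i j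
    exact congrFun (congrArg Subtype.val h) (⟨W, le_inf hi hj⟩ : Set.Iic (U i ⊓ U j))
  have hcov : ∀ {W : Opens X}, W ≤ iSup U → W ≤ ⨆ i, W ⊓ U i := fun h => by
    rw [← inf_iSup_eq]; exact le_inf le_rfl h
  have hg : ∀ (W : Set.Iic (iSup U)) (m : Sec M W.1), ∃! t : Sec F W.1, ∀ i,
      Sec.res F inf_le_left t = (σ i).1 ⟨W.1 ⊓ U i, Set.mem_Iic.2 inf_le_right⟩ (Sec.res M inf_le_left m) := by
    intro W m
    refine Sec.glue F W.1 (fun i => W.1 ⊓ U i) (fun i => inf_le_left) (hcov W.2)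
      (fun i => (σ i).1 ⟨W.1 ⊓ U i, Set.mem_Iic.2 inf_le_right⟩ (Sec.res M inf_le_left m)) fun i j => ?_
    have hi := (σ i).2.2.2 ⟨W.1 ⊓ U i, Set.mem_Iic.2 inf_le_right⟩
      ⟨(W.1 ⊓ U i) ⊓ (W.1 ⊓ U j), Set.mem_Iic.2 (inf_le_left.trans inf_le_right)⟩ inf_le_left
      (Sec.res M inf_le_left m)
    have hj := (σ j).2.2.2 ⟨W.1 ⊓ U j, Set.mem_Iic.2 inf_le_right⟩
      ⟨(W.1 ⊓ U i) ⊓ (W.1 ⊓ U j), Set.mem_Iic.2 (inf_le_right.trans inf_le_right)⟩ inf_le_right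
      (Sec.res M inf_le_left m)
    rw [Sec.res_res] at hi hj
    exact hi.symm.trans ((congrFun (hc i j _ _ _) _).trans hj)
  choose ξ hξ hu using hg
  refine ⟨(⟨ξ, fun W m n => ?_, fun W T m => ?_, fun V W k m => ?_⟩ : HomOn M F (iSup U)),
    fun i => ?_, ?_⟩
  · refine (hu W _ _ fun i => ?_).symm
    rw [map_add, hξ, hξ, map_add, (σ i).2.1]
  · refine (hu W _ _ fun i => ?_).symm
    rw [Sec.res_smul, hξ, Sec.res_smul, (σ i).2.2.1]
  · refine (hu W _ _ fun i => ?_).symm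
    have h1 := (σ i).2.2.2 ⟨V.1 ⊓ U i, Set.mem_Iic.2 inf_le_right⟩ ⟨W.1 ⊓ U i, Set.mem_Iic.2 inf_le_right⟩
      (inf_le_inf_right (U i) k) (Sec.res M inf_le_left m)
    rw [← hξ V m i, Sec.res_res, Sec.res_res] at h1
    rw [Sec.res_res, Sec.res_res]
    exact h1.symm
  · refine Subtype.ext ?_
    funext W m
    refine (hu ⟨W.1, W.2.trans (le_iSup U i)⟩ m ((σ i).1 W m) fun j => ?_).symm
    have h1 := (σ i).2.2.2 W ⟨W.1 ⊓ U j, Set.mem_Iic.2 (inf_le_left.trans W.2)⟩ inf_le_left m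
    exact h1.symm.trans (congrFun (hc i j (W.1 ⊓ U j) _ _) _)
  · intro η hη
    refine Subtype.ext ?_
    funext W m
    refine hu W m _ fun i => ?_
    have h1 := (show HomOn M F (iSup U) from η).2.2.2 W ⟨W.1 ⊓ U i, Set.mem_Iic.2 (inf_le_left.trans W.2)⟩
      inf_le_left m
    exact h1.symm.trans
      (congrFun (congrFun (congrArg Subtype.val (hη i)) ⟨W.1 ⊓ U i, Set.mem_Iic.2 inf_le_right⟩) _)

/-- The functor `Hom_{𝒟_X}(M, -)` from sheaves of `𝒟_X`-modules to sheaves of complex vector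
spaces. -/
noncomputable def sheafHom (M : SheafOfModules.{0} DX) :
    SheafOfModules.{0} DX ⥤ Sheaf (Opens.grothendieckTopology X) (ModuleCat.{0} ℂ) where
  obj F := ⟨homPre M F, homPre_isSheaf M F⟩
  map f := ⟨
    { app := fun U => ModuleCat.ofHom (HomOn.map M f U.unop)
      naturality := fun _ _ _ => rfl }⟩
  map_id _ := rfl
  map_comp _ _ := rfl

instance (M : SheafOfModules.{0} DX) : (sheafHom M).Additive where
  map_add {F G f g} := by
    ext U ξ
    rfl

/-! ### The derived functor -/

theorem isGrothendieckAbelian_sheafOfModules {C : Type} [SmallCategory C]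
    {J : GrothendieckTopology C} (R : Sheaf J RingCat.{0}) :
    IsGrothendieckAbelian.{0} (SheafOfModules.{0} R) := by
  have adj := PresheafOfModules.sheafificationAdjunction (𝟙 R.obj)
  have hAB : AB5OfSize.{0, 0} (PresheafOfModules.{0} R.obj) :=
    ⟨fun K _ _ => HasExactColimitsOfShape.domain_of_functor K (PresheafOfModules.toPresheaf R.obj)⟩
  have h5 : AB5OfSize.{0, 0} (SheafOfModules.{0} R) :=
    ⟨fun K _ _ => adj.hasExactColimitsOfShape K⟩
  have hsep : HasSeparator (SheafOfModules.{0} R) := by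
    let S : C → SheafOfModules.{0} R := fun X =>
      (PresheafOfModules.sheafification (𝟙 R.obj)).obj
        ((PresheafOfModules.free R.obj).obj (yoneda.obj X))
    have hS : ObjectProperty.IsSeparating (.ofObj S) := by
      intro F G f g hfg
      apply (SheafOfModules.forget R ⋙ PresheafOfModules.restrictScalars (𝟙 R.obj)).map_injective
      apply PresheafOfModules.freeYoneda.isSeparating
      rintro _ ⟨X⟩ a
      apply (adj.homEquiv _ _).symm.injective
      have h := hfg _ (ObjectProperty.ofObj_apply _ X) ((adj.homEquiv _ _).symm a)
      rw [← Adjunction.homEquiv_naturality_right_symm,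
        ← Adjunction.homEquiv_naturality_right_symm] at h
      exact h
    exact ⟨_, hS.isSeparator_coproduct⟩
  exact {}

instance : EnoughInjectives (SheafOfModules.{0} DX) :=
  have := isGrothendieckAbelian_sheafOfModules DX
  inferInstance

noncomputable instance : HasDerivedCategory (SheafOfModules.{0} DX) := .standard _

noncomputable instance :
    HasDerivedCategory (Sheaf (Opens.grothendieckTopology X) (ModuleCat.{0} ℂ)) := .standard _

/-- The functor `F ↦ RHom_{𝒟_X}(M, F)` with values in the derived category of sheaves of complex
vector spaces on `X`. -/
noncomputable def RHom (M : SheafOfModules.{0} DX) : SheafOfModules.{0} DX ⥤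
    DerivedCategory.Plus (Sheaf (Opens.grothendieckTopology X) (ModuleCat.{0} ℂ)) :=
  DerivedCategory.Plus.singleFunctor _ 0 ⋙ (sheafHom M).rightDerivedFunctorPlus

/-- The sheaf `Ext^n_{𝒟_X}(M, F)`. -/
noncomputable def sheafExt (n : ℤ) (M F : SheafOfModules.{0} DX) :
    Sheaf (Opens.grothendieckTopology X) (ModuleCat.{0} ℂ) :=
  (DerivedCategory.Plus.homologyFunctor _ n).obj ((RHom M).obj F)

/-! ### The hypergeometric module, irregularity and slopes -/

/-- A holomorphic function as a differential operator of order zero. -/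
noncomputable def opFn (f : ℂ × ℂ → ℂ) (hf : AnalyticOnNhd ℂ f Set.univ) (U : Opens X) : DOp U :=
  ⟨fun p => LinearMap.mulLeft ℂ (taylor f p.1), DOp_of_adjoin
    (Algebra.subset_adjoin (Or.inl ⟨f, hf.mono (Set.subset_univ _), rfl⟩))⟩

/-- The coordinate `x₁`. -/
noncomputable def x1 (U : Opens X) : DOp U := opFn Prod.fst (fun _ _ => analyticAt_fst) U

/-- The coordinate `x₂`. -/
noncomputable def x2 (U : Opens X) : DOp U := opFn Prod.snd (fun _ _ => analyticAt_snd) U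

/-- The operator `∂₁`. -/
noncomputable def D1 (U : Opens X) : DOp U :=
  ⟨fun _ => d1, DOp_of_adjoin (Algebra.subset_adjoin (Or.inr (Or.inl rfl)))⟩

/-- The operator `∂₂`. -/
noncomputable def D2 (U : Opens X) : DOp U :=
  ⟨fun _ => d2, DOp_of_adjoin (Algebra.subset_adjoin (Or.inr (Or.inr rfl)))⟩

/-- The toric operator `P = ∂₁ ^ (b / d) - ∂₂ ^ (a / d)`, where `d = gcd (a, b)`. -/
noncomputable def opP (a b : ℕ) (U : Opens X) : DOp U :=
  D1 U ^ (b / a.gcd b) - D2 U ^ (a / a.gcd b)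

/-- The Euler operator `E = a x₁ ∂₁ + b x₂ ∂₂ - β`. -/
noncomputable def opE (a b : ℕ) (β : ℂ) (U : Opens X) : DOp U :=
  (a : ℂ) • (x1 U * D1 U) + (b : ℂ) • (x2 U * D2 U) - algebraMap ℂ (DOp U) β

theorem opP_res (a b : ℕ) (U V : Opens X) (h : V ≤ U) : DOpRes h (opP a b U) = opP a b V :=
  rfl

theorem opE_res (a b : ℕ) (β : ℂ) (U V : Opens X) (h : V ≤ U) :
    DOpRes h (opE a b β U) = opE a b β V :=
  rfl

/-- The endomorphism `T ↦ T * S` of the left `𝒟_X`-module `𝒟_X` given by a global section `S`: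
the one that maps `1` to `S`. -/
noncomputable def rightMul (S : ∀ U : Opens X, DOp U)
    (hS : ∀ (U V : Opens X) (h : V ≤ U), DOpRes h (S U) = S V) :
    SheafOfModules.unit DX ⟶ SheafOfModules.unit DX :=
  (SheafOfModules.unitHomEquiv _).symm
    (PresheafOfModules.sectionsMk (fun U => S U.unop) fun _ _ i => hS _ _ i.unop.le)

/-- The hypergeometric `𝒟_X`-module `ℳ_A(β) = 𝒟_X / (𝒟_X P + 𝒟_X E)`, for `A = (a b)`. -/
noncomputable def hypergeometric (a b : ℕ) (β : ℂ) : SheafOfModules.{0} DX :=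
  cokernel (biprod.desc (rightMul (opP a b) (opP_res a b)) (rightMul (opE a b β) (opE_res a b β)))

/-- `𝒬_Y(s) = 𝒪_{X^|Y}(s) / 𝒪_{X|Y}`. -/
noncomputable def Q (s : Set.Ici (1 : ℝ≥0∞)) : SheafOfModules.{0} DX :=
  cokernel (DFam.incl (conv_le_gevrey s))

/-- The natural morphism `𝒬_Y(s) → 𝒬_Y(t)` for `s ≤ t`. -/
noncomputable def qMap {s t : Set.Ici (1 : ℝ≥0∞)} (h : s ≤ t) : Q s ⟶ Q t :=
  cokernel.map _ _ (𝟙 _) (DFam.incl (gevrey_mono h)) rfl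

/-- The irregularity complex of order `s` along `Y`. -/
noncomputable def Irr (s : Set.Ici (1 : ℝ≥0∞)) (M : SheafOfModules.{0} DX) :
    DerivedCategory.Plus (Sheaf (Opens.grothendieckTopology X) (ModuleCat.{0} ℂ)) :=
  (RHom M).obj (Q s)

/-- The natural morphism from the irregularity complex of order `s` to that of order `t`. -/
noncomputable def irrMap {s t : Set.Ici (1 : ℝ≥0∞)} (h : s ≤ t) (M : SheafOfModules.{0} DX) :
    Irr s M ⟶ Irr t M :=
  (RHom M).map (qMap h)

/-- The graded piece `𝒪_{X^|Y}(s) / 𝒪_{X^|Y}(<s)` of the Gevrey filtration. -/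
noncomputable def grGevrey (s : Set.Ioi (1 : ℝ≥0∞)) : SheafOfModules.{0} DX :=
  cokernel (DFam.incl (gevreyLT_le s))

/-- `s` is an analytic slope of `M` along `Y`: the graded piece of order `s` of the Gevrey
filtration of the irregularity does not vanish. -/
def IsAnalyticSlope (M : SheafOfModules.{0} DX) (s : Set.Ioi (1 : ℝ≥0∞)) : Prop :=
  ¬ IsZero ((RHom M).obj (grGevrey s))

end GevreyIrr

namespace GevreyIrr

/-! ### Exactness in terms of sections -/

/-! Write `P` for the toric operator, `E` for the Euler operator of parameter `β`, and `E'` for the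
one of parameter `shiftParam a b β`. Both terms of `P` have the same weight, so `E' P = P E`
(`opE_mul_opP`), and every sheaf `F` has a Koszul complex `F → F² → F`, `w ↦ (P w, E w)`, `(u, v) ↦
E' u - P v`.

Algebra. Right multiplication by `P` is injective on `𝒟_X`, and the syzygies of `(P, E)` are
generated by the one coming from this commutation (`mul_opP_injective`, `exists_local_syzygy`).
Hence injective sheaves have Koszul complexes exact in positive degrees. By dimension shifting,
`RHom` from the hypergeometric module into any sheaf with this property is the sheaf of solutions of
`P u = E u = 0`, placed in degree zero (`koszulExact_and_epi`, `isZero_RHom_iff`,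
`isIso_RHom_map_iff`). It remains to prove this exactness for the quotients of Gevrey sheaves and to
find the solutions in them.

Analysis near `(c, 0)`. On `∑ f_j(x₁) x₂ ^ j` the Euler operator acts on each coefficient
separately, as `a z d/dz + (b j - γ)`. For large `j` it can be inverted with bounds geometric in `j`
(`exists_euler_solution`), so no Gevrey order is lost; the finitely many other terms form a
convergent series, which is zero in all the quotients. Modulo finitely many terms the kernel of `E`
is zero if `c = 0`, and for `c ≠ 0` it consists of the series `∑ x_j (x₁ / c) ^ ((γ - b j) / a) x₂ ^
j`, with `x` any sequence of numbers. On these `P` becomes a recurrence `A_j x_j - B_j x_{j+p}`,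
where `p = a / d`, `B_j = (j + p)! / j!` and `|A_j|` is comparable to `B_j ^ (b / a)`
(`hgCoeff_bounds`).

For Gevrey order below `b / a` the term `A_j x_j` dominates: the recurrence is solved backwards by a
convergent series, uniquely up to finitely many terms. From order `b / a` on it is solved forwards
without loss of order, and nonzero homogeneous solutions have exact order `b / a`. So the recurrence
is always solvable, which gives concentration in degree zero, while new solutions appear at `s = b /
a` and at no other order (`isGevrey_of_opP_opE`, `exists_solution_gevrey`). This yields the
vanishing, the single gap and the single slope. -/

instance {C : Type} [SmallCategory C] {J : GrothendieckTopology C} (R : Sheaf J RingCat.{0}) :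
    (SheafOfModules.toSheaf.{0} R).PreservesEpimorphisms where
  preserves {F G} f _ := by
    let α : R.obj ⟶ R.obj := 𝟙 _
    let S := PresheafOfModules.sheafification.{0} α
    let T := SheafOfModules.forget.{0} R ⋙ PresheafOfModules.restrictScalars α
    let adj : S ⊣ T := PresheafOfModules.sheafificationAdjunction α
    let e : T ⋙ S ≅ 𝟭 _ := asIso adj.counit
    have h1 : Epi (S.map (T.map f)) := by
      have h := e.hom.naturality f
      have : S.map (T.map f) = e.hom.app F ≫ f ≫ e.inv.app G := by
        have h' : S.map (T.map f) ≫ e.hom.app G = e.hom.app F ≫ f := h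
        rw [← Category.assoc, ← h', Category.assoc, Iso.hom_inv_id_app]
        exact (Category.comp_id _).symm
      rw [this]
      exact epi_comp' inferInstance (epi_comp' ‹Epi f› inferInstance)
    -- Sheafification is exact, so the image inclusion stays mono; it is also epi because the
    -- sheafified map is. Being an isomorphism, it can be discarded, and what is left is the
    -- sheafification of a presheaf epimorphism.
    have hm : Mono (S.map (Abelian.image.ι (T.map f))) := inferInstance
    have hfac : S.map (T.map f) =
        S.map (Abelian.factorThruImage (T.map f)) ≫ S.map (Abelian.image.ι (T.map f)) := by
      rw [← S.map_comp, Abelian.image.fac]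
    have he : Epi (S.map (Abelian.image.ι (T.map f))) := by
      rw [hfac] at h1
      exact epi_of_epi (S.map (Abelian.factorThruImage (T.map f))) _
    have hi : IsIso (S.map (Abelian.image.ι (T.map f))) := isIso_of_mono_of_epi _
    have he2 : Epi ((SheafOfModules.toSheaf R).map
        (S.map (Abelian.factorThruImage (T.map f)))) := by
      have : Epi ((PresheafOfModules.toPresheaf _ ⋙ presheafToSheaf J AddCommGrpCat).map
        (Abelian.factorThruImage (T.map f))) := inferInstance
      exact this
    have he3 : Epi ((SheafOfModules.toSheaf R).map (S.map (T.map f))) := by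
      rw [hfac, Functor.map_comp]
      infer_instance
    have h2 : f = e.inv.app F ≫ S.map (T.map f) ≫ e.hom.app G := by
      have h' : S.map (T.map f) ≫ e.hom.app G = e.hom.app F ≫ f := e.hom.naturality f
      rw [h', Iso.inv_hom_id_app_assoc]
    rw [h2, Functor.map_comp, Functor.map_comp]
    infer_instance

section

variable {F G : SheafOfModules.{0} DX}

/-- An epimorphism of sheaves is surjective only locally; this is the source of the shrinking
neighbourhoods in all the lifting arguments. -/
theorem Sec.exists_local_of_epi (f : F ⟶ G) [Epi f] {U : Opens X} (t : Sec G U) {x : X}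
    (hx : x ∈ U) : ∃ (V : Opens X) (h : V ≤ U), x ∈ V ∧ ∃ s : Sec F V,
      Sec.map f V s = Sec.res G h t := by
  have h1 : Epi ((SheafOfModules.toSheaf DX).map f) := inferInstance
  have h2 := (TopCat.Sheaf.isLocallySurjective_iff_epi (X := X) _).2 h1
  obtain ⟨V, i, ⟨s, hs⟩, hV⟩ := h2.imageSieve_mem t x hx
  exact ⟨V, i.le, hV, s, hs⟩

theorem Sec.map_injective (f : F ⟶ G) [Mono f] (U : Opens X) :
    Function.Injective (Sec.map f U) := by
  have : Mono ((SheafOfModules.evaluation DX (op U)).map f) := inferInstance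
  exact (ModuleCat.mono_iff_injective _).1 this

theorem Sec.map_comp {H : SheafOfModules.{0} DX} (f : F ⟶ G) (g : G ⟶ H) (U : Opens X)
    (s : Sec F U) : Sec.map (f ≫ g) U s = Sec.map g U (Sec.map f U s) := rfl

theorem Sec.map_id (U : Opens X) (s : Sec F U) : Sec.map (𝟙 F) U s = s := rfl

theorem Sec.map_zero (U : Opens X) (s : Sec F U) : Sec.map (0 : F ⟶ G) U s = 0 := rfl

theorem Sec.map_add (f g : F ⟶ G) (U : Opens X) (s : Sec F U) :
    Sec.map (f + g) U s = Sec.map f U s + Sec.map g U s := rfl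

instance (U : (Opens X)ᵒᵖ) : (SheafOfModules.evaluation.{0} DX U).Additive where
  map_add := rfl

/-- Taking sections is left exact, so when `f` is mono no shrinking is needed. -/
theorem Sec.exists_of_exact {H : SheafOfModules.{0} DX} {f : F ⟶ G} {g : G ⟶ H} {w : f ≫ g = 0}
    (hS : (ShortComplex.mk f g w).Exact) [Mono f] {U : Opens X} (t : Sec G U)
    (ht : Sec.map g U t = 0) : ∃ s : Sec F U, Sec.map f U s = t := by
  have h := hS.map_of_mono_of_preservesKernel (SheafOfModules.evaluation DX (op U)) ‹Mono f›
    inferInstance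
  exact (ShortComplex.moduleCat_exact_iff _).1 h t ht

theorem Sec.exists_local_of_exact {H : SheafOfModules.{0} DX} {f : F ⟶ G} {g : G ⟶ H}
    {w : f ≫ g = 0} (hS : (ShortComplex.mk f g w).Exact)
    {U : Opens X} (t : Sec G U) (ht : Sec.map g U t = 0) {x : X} (hx : x ∈ U) :
    ∃ (V : Opens X) (h : V ≤ U), x ∈ V ∧ ∃ s : Sec F V, Sec.map f V s = Sec.res G h t := by
  -- Lift to the kernel over all of `U` by left exactness, then from the kernel to `F` locally.
  have h1 : Epi (kernel.lift g f w) := (ShortComplex.exact_iff_epi_kernel_lift _).1 hS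
  obtain ⟨k, hk⟩ := Sec.exists_of_exact (ShortComplex.exact_kernel g) t ht
  obtain ⟨V, h, hV, s, hs⟩ := Sec.exists_local_of_epi (kernel.lift g f w) k hx
  refine ⟨V, h, hV, s, ?_⟩
  have h2 : Sec.map f V s = Sec.map (kernel.ι g) V (Sec.map (kernel.lift g f w) V s) := by
    rw [← Sec.map_comp, kernel.lift_ι]
  rw [h2, hs, Sec.map_res, hk]

end

/-- Sheaves of complex vector spaces on `X`. -/
abbrev VSheaf : Type 1 := Sheaf (Opens.grothendieckTopology X) (ModuleCat.{0} ℂ)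

theorem VSheaf.epi_of_local {F G : VSheaf} (f : F ⟶ G)
    (h : ∀ (U : Opens X) (t : G.obj.obj (op U)) (x : X), x ∈ U → ∃ (V : Opens X) (i : V ⟶ U),
      x ∈ V ∧ ∃ s : F.obj.obj (op V), f.hom.app (op V) s = G.obj.map i.op t) : Epi f := by
  refine (TopCat.Sheaf.isLocallySurjective_iff_epi (X := X) f).1 ⟨fun {U} t x hx => ?_⟩
  obtain ⟨V, i, hV, s, hs⟩ := h U t x hx
  exact ⟨V, i, ⟨s, hs⟩, hV⟩

theorem VSheaf.mono_of_injective {F G : VSheaf} (f : F ⟶ G)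
    (h : ∀ U : Opens X, Function.Injective (f.hom.app (op U))) : Mono f := by
  refine (sheafToPresheaf _ _).mono_of_mono_map ?_
  have : ∀ U, Mono (f.hom.app U) := fun U => (ModuleCat.mono_iff_injective _).2 (h U.unop)
  exact NatTrans.mono_of_mono_app f.hom

theorem VSheaf.isZero_of_sections {F : VSheaf} (h : ∀ (U : Opens X) (s : F.obj.obj (op U)), s = 0) :
    IsZero F := by
  rw [IsZero.iff_id_eq_zero]
  ext U s
  rw [h U.unop s]
  exact (h _ _).trans (h _ _).symm

theorem VSheaf.section_eq_zero_of_isZero {F : VSheaf} (h : IsZero F) (U : Opens X)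
    (s : F.obj.obj (op U)) : s = 0 := by
  rw [IsZero.iff_id_eq_zero] at h
  have := congrArg (fun f : F ⟶ F => f.hom.app (op U) s) h
  exact this

theorem VSheaf.exact_of_local (S : ShortComplex VSheaf)
    (h : ∀ (U : Opens X) (t : S.X₂.obj.obj (op U)), S.g.hom.app (op U) t = 0 → ∀ x : X, x ∈ U →
      ∃ (V : Opens X) (i : V ⟶ U), x ∈ V ∧ ∃ s : S.X₁.obj.obj (op V),
        S.f.hom.app (op V) s = S.X₂.obj.map i.op t) : S.Exact := by
  rw [S.exact_iff_epi_kernel_lift]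
  refine VSheaf.epi_of_local _ fun U t x hx => ?_
  obtain ⟨V, i, hV, s, hs⟩ := h U ((kernel.ι S.g).hom.app (op U) t) (by
    have : (kernel.ι S.g ≫ S.g).hom.app (op U) t = 0 := by rw [kernel.condition]; rfl
    exact this) x hx
  refine ⟨V, i, hV, s, ?_⟩
  have hm : Mono ((sheafToPresheaf (Opens.grothendieckTopology X) (ModuleCat.{0} ℂ) ⋙
      (evaluation _ _).obj (op V)).map (kernel.ι S.g)) := inferInstance
  have hinj := (ModuleCat.mono_iff_injective _).1 hm
  apply hinj
  have h1 : (kernel.lift S.g S.f S.zero ≫ kernel.ι S.g).hom.app (op V) s =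
      S.f.hom.app (op V) s := by rw [kernel.lift_ι]
  have h2 : (kernel.ι S.g).hom.app (op V) ((kernel S.g).obj.map i.op t) =
      S.X₂.obj.map i.op ((kernel.ι S.g).hom.app (op U) t) :=
    NatTrans.naturality_apply (kernel.ι S.g).hom i.op t
  exact h1.trans (hs.trans h2.symm)

/-! ### Normal forms of differential operators -/

theorem taylor_congr {f g : ℂ × ℂ → ℂ} {V : Set (ℂ × ℂ)} (hV : IsOpen V) (h : Set.EqOn f g V)
    {p : ℂ × ℂ} (hp : p ∈ V) : taylor f p = taylor g p := by
  refine ger_ext fun i j => ?_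
  rw [taylor, taylor, cf_mkGer, cf_mkGer, pd_iter_congr hV (pd_iter_congr hV h j) i hp]

theorem pd_add {v : ℂ × ℂ} {f g : ℂ × ℂ → ℂ} {V : Set (ℂ × ℂ)} (hf : AnalyticOnNhd ℂ f V)
    (hg : AnalyticOnNhd ℂ g V) : Set.EqOn (pd v (f + g)) (pd v f + pd v g) V := fun x hx => by
  simp [pd, fderiv_add (hf x hx).differentiableAt (hg x hx).differentiableAt]

theorem pd_iter_add {v : ℂ × ℂ} {f g : ℂ × ℂ → ℂ} {V : Set (ℂ × ℂ)} (hV : IsOpen V)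
    (hf : AnalyticOnNhd ℂ f V) (hg : AnalyticOnNhd ℂ g V) (n : ℕ) :
    Set.EqOn ((pd v)^[n] (f + g)) ((pd v)^[n] f + (pd v)^[n] g) V := by
  induction n generalizing f g with
  | zero => exact fun _ _ => rfl
  | succ n ih =>
    rw [Function.iterate_succ_apply, Function.iterate_succ_apply, Function.iterate_succ_apply]
    exact (pd_iter_congr hV (pd_add hf hg) n).trans (ih (pd_analytic hf) (pd_analytic hg))

theorem taylor_add {f g : ℂ × ℂ → ℂ} {V : Set (ℂ × ℂ)} (hV : IsOpen V)
    (hf : AnalyticOnNhd ℂ f V) (hg : AnalyticOnNhd ℂ g V) {p : ℂ × ℂ} (hp : p ∈ V) :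
    taylor (f + g) p = taylor f p + taylor g p := by
  refine ger_ext fun i j => ?_
  rw [map_add, taylor, taylor, taylor, cf_mkGer, cf_mkGer, cf_mkGer,
    pd_iter_congr hV (pd_iter_add hV hf hg j) i hp,
    pd_iter_add hV (pd_iter_analytic hf j) (pd_iter_analytic hg j) i hp, Pi.add_apply, add_div]

theorem taylor_const_mul (c : ℂ) (f : ℂ × ℂ → ℂ) (p : ℂ × ℂ) :
    taylor (fun x => c * f x) p = c • taylor f p := by
  refine ger_ext fun i j => ?_
  simp only [map_smul, taylor, cf_mkGer, pd_iter_const_mul, smul_eq_mul]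
  ring

/-- The holomorphic functions on `V`. -/
def hol (V : Opens X) : Submodule ℂ (ℂ × ℂ → ℂ) where
  carrier := {f | AnalyticOnNhd ℂ f V}
  zero_mem' := fun _ _ => analyticAt_const
  add_mem' hf hg := fun x hx => (hf x hx).add (hg x hx)
  smul_mem' _ _ hf := fun x hx => analyticAt_const.mul (hf x hx)

/-- The operator `f ∂₁ ^ k ∂₂ ^ l`. -/
noncomputable def monOp (V : Opens X) (n : ℕ × ℕ) : hol V →ₗ[ℂ] (V → Module.End ℂ Ger) where
  toFun f := fun p => LinearMap.mulLeft ℂ (taylor f.1 p.1) * (d1 ^ n.1 * d2 ^ n.2)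
  map_add' f g := funext fun p => by
    have : taylor (f + g).1 p.1 = taylor f.1 p.1 + taylor g.1 p.1 :=
      taylor_add V.2 f.2 g.2 p.2
    rw [this, Pi.add_apply, ← add_mul]
    congr 1
    ext x : 1
    simp [add_mul]
  map_smul' c f := funext fun p => by
    have : taylor (c • f).1 p.1 = c • taylor f.1 p.1 := taylor_const_mul c f.1 p.1
    rw [this, Pi.smul_apply, RingHom.id_apply, ← smul_mul_assoc]
    congr 1
    ext x : 1
    simp

/-- The operator `∑ f_{kl} ∂₁ ^ k ∂₂ ^ l`. -/
noncomputable def ofCoeff (V : Opens X) : (ℕ × ℕ →₀ hol V) →ₗ[ℂ] (V → Module.End ℂ Ger) :=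
  Finsupp.lsum ℂ (monOp V)

theorem ofCoeff_single (V : Opens X) (n : ℕ × ℕ) (f : hol V) :
    ofCoeff V (Finsupp.single n f) = monOp V n f := by
  simp [ofCoeff]

theorem d1_pow_comm_d2 (n : ℕ) : d2 * d1 ^ n = d1 ^ n * d2 := by
  have : Commute d2 d1 := LinearMap.ext fun f => (d1_d2 f).symm
  exact (this.pow_right n).eq

/-- The Leibniz rule moves a derivation past a coefficient function, at the cost of one more
normal-form term with the differentiated coefficient. -/
theorem gen_mul_ofCoeff {V : Opens X} {T : V → Module.End ℂ Ger} (hT : T ∈ gens V)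
    (F : ℕ × ℕ →₀ hol V) : ∃ G, T * ofCoeff V F = ofCoeff V G := by
  induction F using Finsupp.induction_linear with
  | zero => exact ⟨0, by simp⟩
  | add F G hF hG =>
    obtain ⟨F', hF⟩ := hF
    obtain ⟨G', hG⟩ := hG
    exact ⟨F' + G', by rw [map_add, map_add, mul_add, hF, hG]⟩
  | single n f =>
    rcases hT with ⟨g, hg, rfl⟩ | rfl | rfl
    · refine ⟨Finsupp.single n ⟨fun x => g x * f.1 x, fun x hx => (hg x hx).mul (f.2 x hx)⟩, ?_⟩
      rw [ofCoeff_single, ofCoeff_single]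
      funext p
      have : taylor (fun x => g x * f.1 x) p.1 = taylor g p.1 * taylor f.1 p.1 :=
        (taylor_mul V.2 hg f.2 p.2).symm
      simp only [Pi.mul_apply, monOp, LinearMap.coe_mk, AddHom.coe_mk, this, LinearMap.mulLeft_mul,
        ← mul_assoc]
      rfl
    · refine ⟨Finsupp.single (n.1 + 1, n.2) f +
        Finsupp.single n ⟨pd (1, 0) f.1, pd_analytic f.2⟩, ?_⟩
      rw [map_add, ofCoeff_single, ofCoeff_single, ofCoeff_single]
      funext p
      have h := d1_taylor V.2 f.2 p.2
      ext x : 1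
      simp only [Pi.mul_apply, Pi.add_apply, monOp, LinearMap.coe_mk, AddHom.coe_mk,
        Module.End.mul_apply, LinearMap.mulLeft_apply, d1_mul, h, LinearMap.add_apply, pow_succ']
      rw [add_comm]
    · refine ⟨Finsupp.single (n.1, n.2 + 1) f +
        Finsupp.single n ⟨pd (0, 1) f.1, pd_analytic f.2⟩, ?_⟩
      rw [map_add, ofCoeff_single, ofCoeff_single, ofCoeff_single]
      funext p
      have h := d2_taylor V.2 f.2 p.2
      have h2 := fun x => LinearMap.congr_fun (d1_pow_comm_d2 n.1) x
      ext x : 1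
      simp only [Module.End.mul_apply] at h2
      simp only [Pi.mul_apply, Pi.add_apply, monOp, LinearMap.coe_mk, AddHom.coe_mk,
        Module.End.mul_apply, LinearMap.mulLeft_apply, d2_mul, h, LinearMap.add_apply, pow_succ', h2]
      rw [add_comm]

theorem exists_ofCoeff {V : Opens X} {T : V → Module.End ℂ Ger}
    (hT : T ∈ Algebra.adjoin ℂ (gens V)) : ∃ F, T = ofCoeff V F := by
  -- Stability of normal forms under left multiplication by `T` passes to products, unlike the bare
  -- existence of a normal form; applying it to the operator `1` gives the claim.
  have key : ∀ G, ∃ F, T * ofCoeff V G = ofCoeff V F := by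
    induction hT using Algebra.adjoin_induction with
    | mem T hT => exact gen_mul_ofCoeff hT
    | algebraMap c =>
      exact fun G => ⟨c • G, by rw [map_smul, Algebra.algebraMap_eq_smul_one, smul_one_mul]⟩
    | add S T _ _ h1 h2 =>
      intro G
      obtain ⟨F, hF⟩ := h1 G
      obtain ⟨F', hF'⟩ := h2 G
      exact ⟨F + F', by rw [add_mul, hF, hF', map_add]⟩
    | mul S T _ _ h1 h2 =>
      intro G
      obtain ⟨F, hF⟩ := h2 G
      obtain ⟨F', hF'⟩ := h1 F
      exact ⟨F', by rw [mul_assoc, hF, hF']⟩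
  obtain ⟨F, hF⟩ := key (Finsupp.single 0 ⟨fun _ => 1, fun _ _ => analyticAt_const⟩)
  refine ⟨F, ?_⟩
  rw [← hF, ofCoeff_single]
  have : monOp V 0 ⟨fun _ => 1, fun _ _ => analyticAt_const⟩ = 1 := by
    funext p
    have h1 : taylor (fun _ => 1) p.1 = 1 := by
      -- The Taylor series of the constant `1` is a nonzero idempotent in a domain.
      have h := taylor_mul (f := fun _ => (1 : ℂ)) (g := fun _ => 1) V.2
        (fun _ _ => analyticAt_const) (fun _ _ => analyticAt_const) p.2
      simp only [mul_one] at h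
      have h0 : taylor (fun _ => (1 : ℂ)) p.1 ≠ 0 := fun h0 => by
        have := congrArg (cf 0 0) h0
        simp [taylor] at this
      exact mul_left_cancel₀ h0 (h.trans (mul_one _).symm)
    ext x : 1
    simp [monOp, h1]
  rw [this, mul_one]

theorem ofCoeff_mem (V : Opens X) (F : ℕ × ℕ →₀ hol V) :
    ofCoeff V F ∈ Algebra.adjoin ℂ (gens V) := by
  induction F using Finsupp.induction_linear with
  | zero => rw [map_zero]; exact zero_mem _
  | add F G hF hG => rw [map_add]; exact add_mem hF hG
  | single n f =>
    rw [ofCoeff_single]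
    have h1 : (fun _ => d1 : V → Module.End ℂ Ger) ∈ Algebra.adjoin ℂ (gens V) :=
      Algebra.subset_adjoin (Or.inr (Or.inl rfl))
    have h2 : (fun _ => d2 : V → Module.End ℂ Ger) ∈ Algebra.adjoin ℂ (gens V) :=
      Algebra.subset_adjoin (Or.inr (Or.inr rfl))
    exact mul_mem (Algebra.subset_adjoin (Or.inl ⟨f.1, f.2, rfl⟩))
      (mul_mem (pow_mem h1 n.1) (pow_mem h2 n.2))

/-! ### Symbols -/

/-- The divided monomial `t₁ ^ k t₂ ^ l / (k! l!)`. -/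
noncomputable def dmon (k l : ℕ) : Ger :=
  mkGer fun i j => if i = k ∧ j = l then ((k ! : ℂ) * l !)⁻¹ else 0

theorem d1_dmon_zero (l : ℕ) : d1 (dmon 0 l) = 0 := ger_ext fun i j => by simp [dmon]

theorem d1_dmon_succ (k l : ℕ) : d1 (dmon (k + 1) l) = dmon k l := ger_ext fun i j => by
  simp only [cf_d1, dmon, cf_mkGer, add_left_inj]
  split_ifs with h
  · obtain ⟨rfl, rfl⟩ := h
    have : (i + 1 : ℂ) ≠ 0 := by exact_mod_cast i.succ_ne_zero
    rw [Nat.factorial_succ]; push_cast; field_simp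
  · simp

theorem d2_dmon_zero (k : ℕ) : d2 (dmon k 0) = 0 := ger_ext fun i j => by simp [dmon]

theorem d2_dmon_succ (k l : ℕ) : d2 (dmon k (l + 1)) = dmon k l := ger_ext fun i j => by
  simp only [cf_d2, dmon, cf_mkGer, add_left_inj]
  split_ifs with h
  · obtain ⟨rfl, rfl⟩ := h
    have : (j + 1 : ℂ) ≠ 0 := by exact_mod_cast j.succ_ne_zero
    rw [Nat.factorial_succ]; push_cast; field_simp
  · simp

/-- The coefficient of `∂₁ ^ k ∂₂ ^ l` in an operator, at the origin of the coordinates. -/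
noncomputable def sym (k l : ℕ) : Module.End ℂ Ger →ₗ[ℂ] ℂ :=
  cf 0 0 ∘ₗ LinearMap.applyₗ (dmon k l)

theorem sym_apply (k l : ℕ) (T : Module.End ℂ Ger) : sym k l T = cf 0 0 (T (dmon k l)) := rfl

/-- The derivations act on divided monomials as pure shifts, so right multiplication by them shifts
the array of symbols without numerical factors. -/
theorem sym_mul_d1 (T : Module.End ℂ Ger) (k l : ℕ) :
    sym k l (T * d1) = if 1 ≤ k then sym (k - 1) l T else 0 := by
  rcases k with - | k
  · simp [sym_apply, d1_dmon_zero]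
  · simp [sym_apply, d1_dmon_succ]

theorem sym_mul_d2 (T : Module.End ℂ Ger) (k l : ℕ) :
    sym k l (T * d2) = if 1 ≤ l then sym k (l - 1) T else 0 := by
  rcases l with - | l
  · simp [sym_apply, d2_dmon_zero]
  · simp [sym_apply, d2_dmon_succ]

theorem sym_mul_d1_pow (T : Module.End ℂ Ger) (n k l : ℕ) :
    sym k l (T * d1 ^ n) = if n ≤ k then sym (k - n) l T else 0 := by
  induction n generalizing k with
  | zero => simp
  | succ n ih =>
    rw [pow_succ, ← mul_assoc, sym_mul_d1]
    rcases k with - | k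
    · simp
    · simp [ih]

theorem sym_mul_d2_pow (T : Module.End ℂ Ger) (n k l : ℕ) :
    sym k l (T * d2 ^ n) = if n ≤ l then sym k (l - n) T else 0 := by
  induction n generalizing l with
  | zero => simp
  | succ n ih =>
    rw [pow_succ, ← mul_assoc, sym_mul_d2]
    rcases l with - | l
    · simp
    · simp [ih]

/-- The Taylor series of `x₁` at `p` is `p₁ + t₁`: the family `q ↦ q₁ + t₁` is flat with constant
term `q₁`, and a flat family is determined by its constant term. -/
theorem cf_taylor_fst_mul (p : ℂ × ℂ) (g : Ger) (i j : ℕ) :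
    cf i j (taylor Prod.fst p * g) = p.1 * cf i j g + if 1 ≤ i then cf (i - 1) j g else 0 := by
  have hf : Flat Set.univ fun q : ℂ × ℂ =>
      (PowerSeries.C (PowerSeries.C q.1 + PowerSeries.X) : Ger) := by
    intro q _ i j
    have h1 : d1 (PowerSeries.C (PowerSeries.C q.1 + PowerSeries.X) : Ger) = 1 := by
      refine ger_ext fun i j => ?_
      rw [cf_d1]
      rcases j with - | j <;> rcases i with - | i <;>
        simp [cf, PowerSeries.coeff_X, PowerSeries.coeff_one]
    have h2 : d2 (PowerSeries.C (PowerSeries.C q.1 + PowerSeries.X) : Ger) = 0 := by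
      refine ger_ext fun i j => ?_
      rw [cf_d2]
      simp [cf]
    rw [h1, h2]
    by_cases hij : i = 0 ∧ j = 0
    · obtain ⟨rfl, rfl⟩ := hij
      refine (hasFDerivAt_fst.congr_fderiv ?_).congr_of_eventuallyEq
        (Filter.Eventually.of_forall fun x => ?_)
      · apply ContinuousLinearMap.ext
        rintro ⟨u, w⟩
        simp [cf]
      · simp [cf]
    · refine ((hasFDerivAt_const (if i = 1 ∧ j = 0 then (1 : ℂ) else 0) q).congr_fderiv
        ?_).congr_of_eventuallyEq (Filter.Eventually.of_forall fun x => ?_)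
      · apply ContinuousLinearMap.ext
        rintro ⟨u, w⟩
        rcases j with - | j <;> rcases i with - | i <;>
          simp_all [cf, PowerSeries.coeff_one]
      · rcases j with - | j <;> rcases i with - | i <;>
          simp_all [cf, PowerSeries.coeff_X]
  have h0 : taylor Prod.fst p = (PowerSeries.C (PowerSeries.C p.1 + PowerSeries.X) : Ger) := by
    rw [hf.eq_taylor isOpen_univ (Set.mem_univ p)]
    congr 1
    funext x
    simp [cf]
  rw [h0]
  rcases i with - | i <;> simp [cf, add_mul, PowerSeries.coeff_succ_X_mul]

theorem cf_taylor_snd_mul (p : ℂ × ℂ) (g : Ger) (i j : ℕ) :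
    cf i j (taylor Prod.snd p * g) = p.2 * cf i j g + if 1 ≤ j then cf i (j - 1) g else 0 := by
  have hf : Flat Set.univ fun q : ℂ × ℂ =>
      (PowerSeries.C (PowerSeries.C q.2) + PowerSeries.X : Ger) := by
    intro q _ i j
    have h1 : d1 (PowerSeries.C (PowerSeries.C q.2) + PowerSeries.X : Ger) = 0 := by
      refine ger_ext fun i j => ?_
      rw [cf_d1]
      rcases j with - | - | j <;>
        simp [cf, PowerSeries.coeff_X, PowerSeries.coeff_one]
    have h2 : d2 (PowerSeries.C (PowerSeries.C q.2) + PowerSeries.X : Ger) = 1 := by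
      refine ger_ext fun i j => ?_
      rw [cf_d2]
      rcases j with - | j <;> rcases i with - | i <;>
        simp [cf, PowerSeries.coeff_X, PowerSeries.coeff_one]
    rw [h1, h2]
    by_cases hij : i = 0 ∧ j = 0
    · obtain ⟨rfl, rfl⟩ := hij
      refine (hasFDerivAt_snd.congr_fderiv ?_).congr_of_eventuallyEq
        (Filter.Eventually.of_forall fun x => ?_)
      · apply ContinuousLinearMap.ext
        rintro ⟨u, w⟩
        simp [cf]
      · simp [cf]
    · refine ((hasFDerivAt_const (if i = 0 ∧ j = 1 then (1 : ℂ) else 0) q).congr_fderiv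
        ?_).congr_of_eventuallyEq (Filter.Eventually.of_forall fun x => ?_)
      · apply ContinuousLinearMap.ext
        rintro ⟨u, w⟩
        rcases j with - | j <;> rcases i with - | i <;>
          simp_all [cf, PowerSeries.coeff_one]
      · rcases j with - | - | j <;> rcases i with - | i <;>
          simp_all [cf, PowerSeries.coeff_X, PowerSeries.coeff_one]
  have h0 : taylor Prod.snd p = (PowerSeries.C (PowerSeries.C p.2) + PowerSeries.X : Ger) := by
    rw [hf.eq_taylor isOpen_univ (Set.mem_univ p)]
    congr 1
    funext x
    simp [cf]
  rw [h0]
  rcases j with - | j <;> simp [cf, add_mul, PowerSeries.coeff_succ_X_mul]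

theorem taylor_fst_mul_dmon (p : ℂ × ℂ) (k l : ℕ) :
    taylor Prod.fst p * dmon k l = p.1 • dmon k l + ((k : ℂ) + 1) • dmon (k + 1) l := by
  refine ger_ext fun i j => ?_
  have : (k + 1 : ℂ) ≠ 0 := by exact_mod_cast k.succ_ne_zero
  rw [cf_taylor_fst_mul]
  simp only [map_add, map_smul, smul_eq_mul, dmon, cf_mkGer, Nat.factorial_succ]
  rcases i with - | i
  · simp
  · simp only [Nat.le_add_left, if_true, Nat.add_sub_cancel, add_left_inj]
    congr 1
    split_ifs
    · push_cast; field_simp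
    · simp

theorem taylor_snd_mul_dmon (p : ℂ × ℂ) (k l : ℕ) :
    taylor Prod.snd p * dmon k l = p.2 • dmon k l + ((l : ℂ) + 1) • dmon k (l + 1) := by
  refine ger_ext fun i j => ?_
  have : (l + 1 : ℂ) ≠ 0 := by exact_mod_cast l.succ_ne_zero
  rw [cf_taylor_snd_mul]
  simp only [map_add, map_smul, smul_eq_mul, dmon, cf_mkGer, Nat.factorial_succ]
  rcases j with - | j
  · simp
  · simp only [Nat.le_add_left, if_true, Nat.add_sub_cancel, add_left_inj]
    congr 1
    split_ifs
    · push_cast; field_simp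
    · simp

/-- Since `x₁ = p₁ + t₁`, the part `p₁ ∂₁` shifts symbols and `t₁ ∂₁` multiplies a monomial by its
degree. The diagonal part is the lower-order perturbation `e` allowed in `eq_zero_of_symbol_eq`. -/
theorem sym_mul_x1_d1 (T : Module.End ℂ Ger) (p : ℂ × ℂ) (k l : ℕ) :
    sym k l (T * (LinearMap.mulLeft ℂ (taylor Prod.fst p) * d1)) =
      p.1 * (if 1 ≤ k then sym (k - 1) l T else 0) + k * sym k l T := by
  rw [← mul_assoc, sym_mul_d1]
  rcases k with - | k
  · simp
  · simp [sym_apply, taylor_fst_mul_dmon]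

theorem sym_mul_x2_d2 (T : Module.End ℂ Ger) (p : ℂ × ℂ) (k l : ℕ) :
    sym k l (T * (LinearMap.mulLeft ℂ (taylor Prod.snd p) * d2)) =
      p.2 * (if 1 ≤ l then sym k (l - 1) T else 0) + l * sym k l T := by
  rw [← mul_assoc, sym_mul_d2]
  rcases l with - | l
  · simp
  · simp [sym_apply, taylor_snd_mul_dmon]

/-- Evaluation at the origin kills every term except the one in `∂₁ ^ k ∂₂ ^ l`. Normal forms are
therefore unique, and identities of operators can be tested on arrays of numbers. -/
theorem sym_ofCoeff {V : Opens X} (F : ℕ × ℕ →₀ hol V) (p : V) (k l : ℕ) :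
    sym k l (ofCoeff V F p) = (F (k, l)).1 p.1 := by
  induction F using Finsupp.induction_linear with
  | zero => simp
  | add F G hF hG => rw [map_add, Pi.add_apply, map_add, hF, hG]; rfl
  | single n f =>
    rw [ofCoeff_single]
    simp only [monOp, LinearMap.coe_mk, AddHom.coe_mk]
    rw [← mul_assoc, sym_mul_d2_pow, sym_mul_d1_pow]
    have h : ∀ k l, sym k l (LinearMap.mulLeft ℂ (taylor f.1 p.1)) =
        if k = 0 ∧ l = 0 then f.1 p.1 else 0 := by
      intro k l
      rw [sym_apply, LinearMap.mulLeft_apply]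
      rcases k with - | k <;> rcases l with - | l <;> simp [cf_mul, dmon, taylor]
    rw [h, Finsupp.single_apply]
    by_cases hn : n = (k, l)
    · subst hn; simp
    · rw [if_neg hn]
      have : ¬ (n.1 = k ∧ n.2 = l) := fun h => hn (Prod.ext h.1 h.2)
      split_ifs <;> first | rfl | (exfalso; omega)

/-! ### Syzygies of the toric and the Euler operator -/

/-- Two polynomials `h`, `t` in two variables, `h` of degree less than `n` in the first one, such
that a perturbation of `(x ξ₁ + y ξ₂) h` by terms of lower order is `(ξ₂ ^ m - ξ₁ ^ n) t`. -/
theorem eq_zero_of_symbol_eq {m n N : ℕ} (hm : 0 < m) (hmn : m < n) {x y : ℂ} (hy : y ≠ 0)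
    (e h t : ℕ → ℕ → ℂ) (hN : ∀ k l, N ≤ k ∨ N ≤ l → h k l = 0)
    (tN : ∀ k l, N ≤ k ∨ N ≤ l → t k l = 0) (hn : ∀ k l, n ≤ k → h k l = 0)
    (heq : ∀ k l, x * (if 1 ≤ k then h (k - 1) l else 0) + y * (if 1 ≤ l then h k (l - 1) else 0) +
      e k l * h k l = (if m ≤ l then t k (l - m) else 0) - (if n ≤ k then t (k - n) l else 0)) :
    -- The proof shows that `t` is a polynomial in the second variable alone: in degree `k + n` with
    -- `1 ≤ k` no term of `h` survives, so `t k l` is expressed by `t (k + n) (l - m)`, and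
    -- descending induction on `k` applies.
    ∀ k l, h k l = 0 := by
  have h1 : ∀ r k l, 1 ≤ k → N ≤ k + r → t k l = 0 := by
    intro r
    induction r with
    | zero => exact fun k l _ h => tN k l (Or.inl h)
    | succ r ih =>
      intro k l hk hr
      have := heq (k + n) l
      rw [hn (k + n) l (by omega), if_pos (by omega), if_pos (by omega : n ≤ k + n),
        hn (k + n - 1) l (by omega), hn (k + n) (l - 1) (by omega), Nat.add_sub_cancel,
        ih (k + n) (l - m) (by omega) (by omega)] at this
      simpa using this.symm
  have ht : ∀ k l, 1 ≤ k → t k l = 0 := fun k l hk => h1 N k l hk (by omega)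
  -- Descending induction on the weight `m k + (m + 1) l`. In the equation of index `(k, l + 1)` the
  -- unknown `y h k l` is accompanied only by terms of larger weight: passing from `(k, l)` to `(k -
  -- 1, l + 1)` raises the weight by exactly `1`.
  have h2 : ∀ r k l, m * N + (m + 1) * N ≤ r + (m * k + (m + 1) * l) → h k l = 0 := by
    intro r
    induction r with
    | zero =>
      intro k l hr
      refine hN k l ?_
      by_contra! hc
      have h1 : m * k ≤ m * N := Nat.mul_le_mul_left _ hc.1.le
      have h2 : (m + 1) * l < (m + 1) * N := Nat.mul_lt_mul_of_pos_left hc.2 (by omega)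
      omega
    | succ r ih =>
      intro k l hr
      have h3 : h k (l + 1) = 0 := ih k (l + 1) (by linarith)
      have h4 := heq k (l + 1)
      rw [h3, if_pos (by omega : 1 ≤ l + 1), Nat.add_sub_cancel] at h4
      rcases k with - | k
      · rw [if_neg (by omega : ¬ 1 ≤ 0), if_neg (by omega : ¬ n ≤ 0)] at h4
        have h5 : (if m ≤ l + 1 then t 0 (l + 1 - m) else 0) = 0 := by
          split_ifs with hl
          -- For `k = 0` the remaining value of `t` is `-x h (n - 1) (l + 1 - m)` by the equation of
          -- index `(n, l + 1 - m)`. Its weight exceeds that of `(0, l)` by `m (n - 1 - m) + 1`,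
          -- which is positive because `m < n`.
          · have h6 := heq n (l + 1 - m)
            rw [hn n _ le_rfl, hn n _ le_rfl, if_pos (by omega : 1 ≤ n), if_pos le_rfl,
              Nat.sub_self, ht n _ (by omega), ih (n - 1) (l + 1 - m) ?_] at h6
            · simpa using h6
            · obtain ⟨q, hq⟩ := Nat.exists_eq_add_of_le hl
              obtain ⟨w, rfl⟩ := Nat.exists_eq_add_of_lt hmn
              obtain rfl : l + 1 - m = q := by omega
              have e1 : m + w + 1 - 1 = m + w := by omega
              rw [e1]
              have e2 : (m + 1) * (l + 1) = (m + 1) * m + (m + 1) * (l + 1 - m) := by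
                rw [← mul_add]; congr 1
              have e3 : m * (m + w) = m * m + m * w := by ring
              have e4 : (m + 1) * (l + 1) = (m + 1) * l + m + 1 := by ring
              have e5 : (m + 1) * m = m * m + m := by ring
              have := Nat.zero_le (m * w)
              omega
          · rfl
        rw [h5] at h4
        simpa [hy] using h4
      · have h5 : h k (l + 1) = 0 := ih k (l + 1) (by nlinarith)
        have h6 : (if n ≤ k + 1 then t (k + 1 - n) (l + 1) else 0) = 0 ∨ h (k + 1) l = 0 := by
          by_cases hk : n ≤ k + 1
          · exact Or.inr (hn _ _ hk)
          · exact Or.inl (if_neg hk)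
        rcases h6 with h6 | h6
        · rw [h6, if_pos (by omega), Nat.add_sub_cancel, h5, ht (k + 1) _ (by omega)] at h4
          simpa [hy] using h4
        · exact h6
  exact fun k l => h2 _ k l (Nat.le_add_right _ _)

theorem exists_bound_support {V : Opens X} (F : ℕ × ℕ →₀ hol V) :
    ∃ N, ∀ k l, N ≤ k ∨ N ≤ l → F (k, l) = 0 := by
  refine ⟨F.support.sup (fun n => max n.1 n.2) + 1, fun k l h => ?_⟩
  by_contra hF
  have := Finset.le_sup (f := fun n : ℕ × ℕ => max n.1 n.2) (Finsupp.mem_support_iff.2 hF)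
  simp only at this
  omega

/-- Division by the toric operator. -/
theorem exists_division {V : Opens X} (m n : ℕ) (hn : 0 < n) (F : ℕ × ℕ →₀ hol V) :
    ∃ R G : ℕ × ℕ →₀ hol V, (∀ k l, n ≤ k → G (k, l) = 0) ∧
      ofCoeff V F = (ofCoeff V R * fun _ => (d1 ^ n - d2 ^ m)) + ofCoeff V G := by
  induction F using Finsupp.induction_linear with
  | zero => exact ⟨0, 0, by simp, by simp⟩
  | add F F' hF hF' =>
    obtain ⟨R, G, hG, h⟩ := hF
    obtain ⟨R', G', hG', h'⟩ := hF'
    refine ⟨R + R', G + G', fun k l hk => ?_, ?_⟩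
    · rw [Finsupp.add_apply, hG k l hk, hG' k l hk, add_zero]
    · rw [map_add, h, h', map_add, map_add, add_mul]; abel
  | single q f =>
    obtain ⟨k, l⟩ := q
    induction k using Nat.strong_induction_on generalizing l with
    | _ k ih =>
      by_cases hk : k < n
      · refine ⟨0, Finsupp.single (k, l) f, fun k' l' hk' => ?_, by simp⟩
        rw [Finsupp.single_apply, if_neg]
        intro h
        have := congrArg Prod.fst h
        simp only at this
        omega
      -- Modulo left multiples of `∂₁ ^ n - ∂₂ ^ m`, replace `∂₁ ^ k ∂₂ ^ l` by `∂₁ ^ (k - n) ∂₂ ^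
      -- (l + m)`; coefficients stay on the left and are unaffected.
      · obtain ⟨R, G, hG, h⟩ := ih (k - n) (by omega) (l + m)
        refine ⟨Finsupp.single (k - n, l) f + R, G, hG, ?_⟩
        rw [map_add, add_mul, add_assoc, ← h, ofCoeff_single, ofCoeff_single, ofCoeff_single]
        funext p
        simp only [monOp, LinearMap.coe_mk, AddHom.coe_mk, Pi.add_apply, Pi.mul_apply, mul_sub]
        have h1 : d1 ^ (k - n) * d2 ^ l * d1 ^ n = d1 ^ k * d2 ^ l := by
          have hc : Commute (d2 ^ l) (d1 ^ n) := by
            have : Commute d2 d1 := LinearMap.ext fun f => (d1_d2 f).symm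
            exact this.pow_pow l n
          rw [mul_assoc, hc.eq, ← mul_assoc, ← pow_add]
          congr 2
          omega
        rw [mul_assoc _ _ (d1 ^ n), h1, mul_assoc _ _ (d2 ^ m), mul_assoc (d1 ^ (k - n)), ← pow_add]
        abel

/-- The Euler operator at the point `p`. -/
noncomputable def eulerAt (a b : ℕ) (β : ℂ) (p : ℂ × ℂ) : Module.End ℂ Ger :=
  (a : ℂ) • (LinearMap.mulLeft ℂ (taylor Prod.fst p) * d1) +
    (b : ℂ) • (LinearMap.mulLeft ℂ (taylor Prod.snd p) * d2) - algebraMap ℂ (Module.End ℂ Ger) β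

/-- The toric operator. -/
noncomputable def toricOp (a b : ℕ) : Module.End ℂ Ger :=
  d1 ^ (b / a.gcd b) - d2 ^ (a / a.gcd b)

theorem exists_ofCoeff_of_DOp {U : Opens X} (T : DOp U) {x : X} (hx : x ∈ U) :
    ∃ (V : Opens X) (h : V ≤ U), x ∈ V ∧ ∃ F, (DOpRes h T).1 = ofCoeff V F := by
  obtain ⟨V, h, hxV, hV⟩ := T.2 ⟨x, hx⟩
  exact ⟨V, h, hxV, exists_ofCoeff hV⟩

theorem DOp_eq_of_local {U : Opens X} {S T : DOp U}
    (h : ∀ x ∈ U, ∃ (V : Opens X) (h : V ≤ U), x ∈ V ∧ DOpRes h S = DOpRes h T) : S = T := by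
  refine Subtype.ext (funext fun p => ?_)
  obtain ⟨V, h, hV, e⟩ := h p.1 p.2
  exact congrFun (congrArg Subtype.val e) ⟨p.1, hV⟩

theorem d1_d2_commute : Commute d1 d2 := LinearMap.ext fun f => d1_d2 f

theorem mulLeft_fst_d1 (p : ℂ × ℂ) (n : ℕ) :
    LinearMap.mulLeft ℂ (taylor Prod.fst p) * d1 * d1 ^ n =
      d1 ^ n * (LinearMap.mulLeft ℂ (taylor Prod.fst p) * d1) - (n : ℂ) • d1 ^ n := by
  have h : d1 * LinearMap.mulLeft ℂ (taylor Prod.fst p) =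
      LinearMap.mulLeft ℂ (taylor Prod.fst p) * d1 + 1 := by
    refine LinearMap.ext fun g => ger_ext fun i j => ?_
    simp only [Module.End.mul_apply, LinearMap.mulLeft_apply, LinearMap.add_apply,
      Module.End.one_apply, cf_d1, cf_taylor_fst_mul, map_add]
    rcases i with - | i
    · simp
    · simp; ring
  induction n with
  | zero => simp
  | succ n ih =>
    rw [pow_succ', ← mul_assoc, mul_assoc _ d1 d1, ← mul_assoc, ]
    have : LinearMap.mulLeft ℂ (taylor Prod.fst p) * d1 * d1 * d1 ^ n =
        d1 * (LinearMap.mulLeft ℂ (taylor Prod.fst p) * d1 * d1 ^ n) - d1 * d1 ^ n := by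
      simp only [← mul_assoc, h]
      simp only [add_mul, one_mul]
      abel
    rw [this, ih, mul_sub, mul_smul_comm, ← mul_assoc, ← mul_assoc, Nat.cast_succ, add_smul, one_smul]
    simp only [mul_assoc]
    abel

theorem mulLeft_snd_d2 (p : ℂ × ℂ) (n : ℕ) :
    LinearMap.mulLeft ℂ (taylor Prod.snd p) * d2 * d2 ^ n =
      d2 ^ n * (LinearMap.mulLeft ℂ (taylor Prod.snd p) * d2) - (n : ℂ) • d2 ^ n := by
  have h : d2 * LinearMap.mulLeft ℂ (taylor Prod.snd p) =
      LinearMap.mulLeft ℂ (taylor Prod.snd p) * d2 + 1 := by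
    refine LinearMap.ext fun g => ger_ext fun i j => ?_
    simp only [Module.End.mul_apply, LinearMap.mulLeft_apply, LinearMap.add_apply,
      Module.End.one_apply, cf_d2, cf_taylor_snd_mul, map_add]
    rcases j with - | j
    · simp
    · simp; ring
  induction n with
  | zero => simp
  | succ n ih =>
    rw [pow_succ', ← mul_assoc, mul_assoc _ d2 d2, ← mul_assoc, ]
    have : LinearMap.mulLeft ℂ (taylor Prod.snd p) * d2 * d2 * d2 ^ n =
        d2 * (LinearMap.mulLeft ℂ (taylor Prod.snd p) * d2 * d2 ^ n) - d2 * d2 ^ n := by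
      simp only [← mul_assoc, h]
      simp only [add_mul, one_mul]
      abel
    rw [this, ih, mul_sub, mul_smul_comm, ← mul_assoc, ← mul_assoc, Nat.cast_succ, add_smul, one_smul]
    simp only [mul_assoc]
    abel

theorem mulLeft_fst_d1_d2 (p : ℂ × ℂ) (n : ℕ) :
    Commute (LinearMap.mulLeft ℂ (taylor Prod.fst p) * d1) (d2 ^ n) := by
  have h : Commute (LinearMap.mulLeft ℂ (taylor Prod.fst p)) d2 := by
    refine LinearMap.ext fun g => ger_ext fun i j => ?_
    simp only [Module.End.mul_apply, LinearMap.mulLeft_apply, cf_d2, cf_taylor_fst_mul]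
    split_ifs <;> ring
  exact (h.mul_left d1_d2_commute).pow_right n

theorem mulLeft_snd_d2_d1 (p : ℂ × ℂ) (n : ℕ) :
    Commute (LinearMap.mulLeft ℂ (taylor Prod.snd p) * d2) (d1 ^ n) := by
  have h : Commute (LinearMap.mulLeft ℂ (taylor Prod.snd p)) d1 := by
    refine LinearMap.ext fun g => ger_ext fun i j => ?_
    simp only [Module.End.mul_apply, LinearMap.mulLeft_apply, cf_d1, cf_taylor_snd_mul]
    split_ifs <;> ring
  exact (h.mul_left d1_d2_commute.symm).pow_right n

/-- The parameter of the Euler operator which is conjugate to that of parameter `β` by the toric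
operator. -/
noncomputable def shiftParam (a b : ℕ) (β : ℂ) : ℂ := β - (a : ℂ) * (b / a.gcd b : ℕ)

/-- The Euler operator is a grading, and `∂₁ ^ (b / d)` and `∂₂ ^ (a / d)` are homogeneous of the
same weight because `a (b / d) = b (a / d)`; passing them across it shifts the parameter by this
weight. -/
theorem eulerAt_mul_toricOp (a b : ℕ) (β : ℂ) (p : ℂ × ℂ) :
    eulerAt a b (shiftParam a b β) p * toricOp a b = toricOp a b * eulerAt a b β p := by
  have hab : (b : ℂ) * (a / a.gcd b : ℕ) = (a : ℂ) * (b / a.gcd b : ℕ) := by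
    have : b * (a / a.gcd b) = a * (b / a.gcd b) := by
      rw [← Nat.mul_div_assoc _ (Nat.gcd_dvd_left a b), ← Nat.mul_div_assoc _ (Nat.gcd_dvd_right a b),
        mul_comm]
    exact_mod_cast this
  set n := b / a.gcd b
  set m := a / a.gcd b
  have h1 := mulLeft_fst_d1 p n
  have h2 := mulLeft_snd_d2 p m
  have h3 := (mulLeft_fst_d1_d2 p m).eq
  have h4 := (mulLeft_snd_d2_d1 p n).eq
  simp only [eulerAt, toricOp, shiftParam, Algebra.algebraMap_eq_smul_one]
  set A := LinearMap.mulLeft ℂ (taylor Prod.fst p) * d1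
  set B := LinearMap.mulLeft ℂ (taylor Prod.snd p) * d2
  simp only [sub_mul, mul_sub, add_mul, mul_add, smul_mul_assoc, mul_smul_comm, one_mul, mul_one]
  rw [h1, h2, h3, h4]
  simp only [smul_sub, smul_smul, hab, sub_smul]
  abel

theorem opE_mul_opP (a b : ℕ) (β : ℂ) (U : Opens X) :
    opE a b (shiftParam a b β) U * opP a b U = opP a b U * opE a b β U :=
  Subtype.ext (funext fun p => eulerAt_mul_toricOp a b β p.1)

/-- The relation equates each coefficient with one whose exponent of `∂₁` is larger by `n`, or with
zero; repeating this leaves the finite support. -/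
theorem mul_toricOp_eq_zero {V : Opens X} {a b : ℕ} (ha : 0 < a) (hab : a < b)
    (F : ℕ × ℕ →₀ hol V) (p : V) (h : ofCoeff V F p * toricOp a b = 0) (k l : ℕ) :
    sym k l (ofCoeff V F p) = 0 := by
  obtain ⟨N, hN⟩ := exists_bound_support F
  have hg : 0 < a.gcd b := Nat.gcd_pos_of_pos_left _ ha
  have hn : 0 < b / a.gcd b := Nat.div_pos (Nat.le_of_dvd (by omega) (Nat.gcd_dvd_right a b)) hg
  set n := b / a.gcd b
  set m := a / a.gcd b
  have key : ∀ k l, sym k l (ofCoeff V F p) =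
      if m ≤ l then sym (k + n) (l - m) (ofCoeff V F p) else 0 := by
    intro k l
    have := congrArg (sym (k + n) l) h
    rw [toricOp, mul_sub, map_sub, map_zero, sym_mul_d1_pow, sym_mul_d2_pow,
      if_pos (by omega : n ≤ k + n), Nat.add_sub_cancel, sub_eq_zero] at this
    exact this
  have h1 : ∀ r k l, N ≤ k + r → sym k l (ofCoeff V F p) = 0 := by
    intro r
    induction r with
    | zero =>
      intro k l hr
      rw [sym_ofCoeff, hN k l (Or.inl hr)]; rfl
    | succ r ih =>
      intro k l hr
      rw [key, ih (k + n) (l - m) (by omega), ite_self]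
  exact h1 N k l (by omega)

theorem ofCoeff_eq_zero {V : Opens X} (F : ℕ × ℕ →₀ hol V)
    (h : ∀ (p : V) k l, sym k l (ofCoeff V F p) = 0) : ofCoeff V F = 0 := by
  funext p
  have h1 : ∀ n, (monOp V n (F n)) p = 0 := by
    intro n
    have h2 : Set.EqOn (F n).1 (fun _ => (0 : ℂ) * 0) V := fun x hx => by
      rw [← sym_ofCoeff F ⟨x, hx⟩, h, zero_mul]
    have h3 : taylor (F n).1 p.1 = 0 := by
      rw [taylor_congr V.2 h2 p.2, taylor_const_mul, zero_smul]
    simp only [monOp, LinearMap.coe_mk, AddHom.coe_mk, h3]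
    ext x : 1
    simp
  rw [ofCoeff, Finsupp.lsum_apply, Finsupp.sum, Finset.sum_apply]
  exact Finset.sum_eq_zero fun n _ => h1 n

theorem mul_opP_injective {a b : ℕ} (ha : 0 < a) (hab : a < b) {U : Opens X} {T : DOp U}
    (h : T * opP a b U = 0) : T = 0 := by
  refine DOp_eq_of_local fun x hx => ?_
  obtain ⟨V, i, hV, F, hF⟩ := exists_ofCoeff_of_DOp T hx
  refine ⟨V, i, hV, ?_⟩
  rw [map_zero]
  refine Subtype.ext ?_
  rw [hF]
  refine ofCoeff_eq_zero F fun p => mul_toricOp_eq_zero ha hab F p ?_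
  rw [← hF]
  exact congrFun (congrArg Subtype.val h) ⟨p.1, i p.2⟩

/-- The symbol argument needs the coefficient `b x₂` of `ξ₂` to be nonzero; continuity carries its
conclusion across `Y`. -/
theorem dense_snd_ne_zero {V : Opens X} {f : ℂ × ℂ → ℂ} (hf : ContinuousOn f V)
    (h : ∀ x ∈ V, x.2 ≠ 0 → f x = 0) {x : ℂ × ℂ} (hx : x ∈ V) : f x = 0 := by
  by_cases h0 : x.2 = 0
  · have hc : ContinuousAt f x := hf.continuousAt (V.2.mem_nhds hx)
    have hl : Filter.Tendsto (fun w : ℂ => (x.1, w)) (nhdsWithin 0 {0}ᶜ) (nhds x) := by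
      have : Filter.Tendsto (fun w : ℂ => (x.1, w)) (nhds 0) (nhds (x.1, 0)) :=
        (Continuous.prodMk_right x.1).tendsto 0
      have hx' : x = (x.1, 0) := Prod.ext rfl h0
      rw [hx']
      exact this.mono_left nhdsWithin_le_nhds
    have h1 := hc.tendsto.comp hl
    refine tendsto_nhds_unique h1 (tendsto_const_nhds.congr' ?_)
    filter_upwards [hl.eventually (V.2.mem_nhds hx), self_mem_nhdsWithin] with w hw hw0
    exact (h _ hw hw0).symm
  · exact h x hx h0

/-- The syzygies of the toric and the Euler operator are generated by the obvious one. -/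
theorem exists_local_syzygy {a b : ℕ} (ha : 0 < a) (hab : a < b) {β : ℂ} {U : Opens X}
    {S T : DOp U} (h : T * opP a b U + S * opE a b β U = 0) {x : X} (hx : x ∈ U) :
    ∃ (V : Opens X) (i : V ≤ U), x ∈ V ∧ ∃ R : DOp V, DOpRes i S = R * opP a b V ∧
      DOpRes i T + R * opE a b (shiftParam a b β) V = 0 := by
  have hg : 0 < a.gcd b := Nat.gcd_pos_of_pos_left _ ha
  have hm : 0 < a / a.gcd b := Nat.div_pos (Nat.le_of_dvd ha (Nat.gcd_dvd_left a b)) hg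
  have hmn : a / a.gcd b < b / a.gcd b :=
    Nat.div_lt_div_of_lt_of_dvd (Nat.gcd_dvd_right a b) hab
  obtain ⟨V, i, hV, F, hF⟩ := exists_ofCoeff_of_DOp S hx
  obtain ⟨W, j, hW, F', hF'⟩ := exists_ofCoeff_of_DOp (DOpRes i T) hV
  -- Divide `S` by `P`. The task is to show that the remainder `G` vanishes, which is then a
  -- statement about its coefficients.
  obtain ⟨R, G, hG, hRG⟩ := exists_division (a / a.gcd b) (b / a.gcd b) (by omega) F
  let R' : DOp V := ⟨ofCoeff V R, DOp_of_adjoin (ofCoeff_mem V R)⟩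
  have hEadj : (fun p : W => eulerAt a b (shiftParam a b β) p.1) ∈ Algebra.adjoin ℂ (gens W) := by
    have h1 : (fun _ => d1 : W → Module.End ℂ Ger) ∈ Algebra.adjoin ℂ (gens W) :=
      Algebra.subset_adjoin (Or.inr (Or.inl rfl))
    have h2 : (fun _ => d2 : W → Module.End ℂ Ger) ∈ Algebra.adjoin ℂ (gens W) :=
      Algebra.subset_adjoin (Or.inr (Or.inr rfl))
    have h3 : (fun p => LinearMap.mulLeft ℂ (taylor Prod.fst p.1) : W → Module.End ℂ Ger) ∈
        Algebra.adjoin ℂ (gens W) :=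
      Algebra.subset_adjoin (Or.inl ⟨Prod.fst, fun _ _ => analyticAt_fst, rfl⟩)
    have h4 : (fun p => LinearMap.mulLeft ℂ (taylor Prod.snd p.1) : W → Module.End ℂ Ger) ∈
        Algebra.adjoin ℂ (gens W) :=
      Algebra.subset_adjoin (Or.inl ⟨Prod.snd, fun _ _ => analyticAt_snd, rfl⟩)
    exact sub_mem (add_mem (Subalgebra.smul_mem _ (mul_mem h3 h1) (a : ℂ))
      (Subalgebra.smul_mem _ (mul_mem h4 h2) (b : ℂ))) (Subalgebra.algebraMap_mem _ _)
  -- With `H = T + R E'`, the syzygy reads `H P + G E = 0` because `R P E = R E' P`. Taking symbols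
  -- at a point puts this in the form of `eq_zero_of_symbol_eq`.
  obtain ⟨H, hH⟩ := exists_ofCoeff (add_mem (ofCoeff_mem W F')
    (mul_mem (resAlg_adjoin j (ofCoeff_mem V R)) hEadj))
  have hG0 : ∀ k l, ∀ p ∈ W, (G (k, l)).1 p = 0 := by
    intro k l p hp
    refine dense_snd_ne_zero (V := W) ((G (k, l)).2.continuousOn.mono j) (fun q hq hq0 => ?_) hp
    obtain ⟨N, hN⟩ := exists_bound_support G
    obtain ⟨N', hN'⟩ := exists_bound_support H
    have hb : (b : ℂ) * q.2 ≠ 0 := mul_ne_zero (by exact_mod_cast (by omega : b ≠ 0)) hq0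
    have key : ofCoeff W H ⟨q, hq⟩ * toricOp a b + ofCoeff V G ⟨q, j hq⟩ * eulerAt a b β q = 0 := by
      have h1 : (T.1 ⟨q, i (j hq)⟩) * toricOp a b + S.1 ⟨q, i (j hq)⟩ * eulerAt a b β q = 0 :=
        congrFun (congrArg Subtype.val h) ⟨q, i (j hq)⟩
      have h2 : S.1 ⟨q, i (j hq)⟩ = ofCoeff V R ⟨q, j hq⟩ * toricOp a b + ofCoeff V G ⟨q, j hq⟩ :=
        congrFun (hF.trans hRG) ⟨q, j hq⟩
      have h3 : T.1 ⟨q, i (j hq)⟩ = ofCoeff W F' ⟨q, hq⟩ := congrFun hF' ⟨q, hq⟩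
      have h4 : ofCoeff W H ⟨q, hq⟩ = ofCoeff W F' ⟨q, hq⟩ +
          ofCoeff V R ⟨q, j hq⟩ * eulerAt a b (shiftParam a b β) q :=
        (congrFun hH ⟨q, hq⟩).symm
      rw [h4, ← h1, h2, h3, add_mul, add_mul, mul_assoc, mul_assoc, eulerAt_mul_toricOp]
      abel
    have := eq_zero_of_symbol_eq (N := max N N') hm hmn (x := (a : ℂ) * q.1) hb
      (fun k l => (a : ℂ) * k + (b : ℂ) * l - β) (fun k l => sym k l (ofCoeff V G ⟨q, j hq⟩))
      (fun k l => sym k l (ofCoeff W H ⟨q, hq⟩))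
      (fun k l hkl => by
        rw [sym_ofCoeff, hN k l (by omega)]; rfl)
      (fun k l hkl => by
        rw [sym_ofCoeff, hN' k l (by omega)]; rfl)
      (fun k l hk => by rw [sym_ofCoeff, hG k l hk]; rfl)
      (fun k l => by
        have h1 := congrArg (sym k l) key
        rw [toricOp, eulerAt, mul_sub, mul_sub, mul_add, mul_smul_comm, mul_smul_comm, map_add,
          map_sub, map_sub, map_add, map_smul, map_smul, sym_mul_x1_d1, sym_mul_x2_d2,
          sym_mul_d1_pow, sym_mul_d2_pow, Algebra.algebraMap_eq_smul_one, mul_smul_comm, mul_one,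
          map_smul, map_zero] at h1
        simp only [smul_eq_mul] at h1
        linear_combination h1) k l
    rwa [sym_ofCoeff] at this
  have hS : DOpRes (j.trans i) S = DOpRes j R' * opP a b W := by
    refine Subtype.ext (funext fun p => ?_)
    have h1 : ofCoeff V G ⟨p.1, j p.2⟩ = 0 := by
      have h2 : ∀ n, (monOp V n (G n)) ⟨p.1, j p.2⟩ = 0 := by
        intro n
        have h2 : Set.EqOn (G n).1 (fun _ => (0 : ℂ) * 0) W := fun x hx => by
          rw [zero_mul]; exact hG0 n.1 n.2 x hx
        have h3 : taylor (G n).1 p.1 = 0 := by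
          rw [taylor_congr W.2 h2 p.2, taylor_const_mul, zero_smul]
        simp only [monOp, LinearMap.coe_mk, AddHom.coe_mk, h3]
        ext x : 1
        simp
      rw [ofCoeff, Finsupp.lsum_apply, Finsupp.sum, Finset.sum_apply]
      exact Finset.sum_eq_zero fun n _ => h2 n
    have h2 := congrFun (hF.trans hRG) ⟨p.1, j p.2⟩
    rw [Pi.add_apply, h1, add_zero] at h2
    exact h2
  refine ⟨W, j.trans i, hW, DOpRes j R', hS, ?_⟩
  -- Now `S = R P`, so the syzygy is `(T + R E') P = 0` and `P` can be cancelled.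
  apply mul_opP_injective ha hab
  have h1 := congrArg (DOpRes (j.trans i)) h
  rw [map_add, map_mul, map_mul, opP_res, opE_res, hS, map_zero, mul_assoc, ← opE_mul_opP,
    ← mul_assoc, ← add_mul] at h1
  exact h1

/-! ### Homomorphisms from the hypergeometric module -/

/-- A differential operator as a section of `𝒟_X`. -/
def unitSec {U : Opens X} (T : DOp U) : Sec (SheafOfModules.unit DX) U := T

theorem rightMul_unitSec (S : ∀ U : Opens X, DOp U)
    (hS : ∀ (U V : Opens X) (h : V ≤ U), DOpRes h (S U) = S V) {V : Opens X} (T : DOp V) :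
    Sec.map (rightMul S hS) V (unitSec T) = unitSec (T * S V) := rfl

theorem smul_unitSec {V : Opens X} (T S : DOp V) : T • unitSec S = unitSec (T * S) := rfl

theorem res_unitSec {U V : Opens X} (h : V ≤ U) (T : DOp U) :
    Sec.res _ h (unitSec T) = unitSec (DOpRes h T) := rfl

theorem Sec.res_self {F : SheafOfModules.{0} DX} {U : Opens X} (u : Sec F U) :
    Sec.res F le_rfl u = u := by
  have := F.val.presheaf.map_id (op U)
  exact congrArg (fun f => f.hom u) this

section

variable (a b : ℕ) (β : ℂ)

/-- The projection from `𝒟_X` to the hypergeometric module. -/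
noncomputable def hgProj : SheafOfModules.unit DX ⟶ hypergeometric a b β := cokernel.π _

theorem hgProj_condition : biprod.desc (rightMul (opP a b) (opP_res a b))
    (rightMul (opE a b β) (opE_res a b β)) ≫ hgProj a b β = 0 :=
  cokernel.condition _

instance : Epi (hgProj a b β) := inferInstanceAs (Epi (cokernel.π _))

/-- The class of `1` in the hypergeometric module. -/
noncomputable def hgOne (U : Opens X) : Sec (hypergeometric a b β) U :=
  Sec.map (hgProj a b β) U (unitSec 1)

variable {a b β}

theorem smul_hgOne {U : Opens X} (T : DOp U) :
    T • hgOne a b β U = Sec.map (hgProj a b β) U (unitSec T) := by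
  rw [hgOne, ← map_smul, smul_unitSec, mul_one]

theorem res_hgOne {U V : Opens X} (h : V ≤ U) :
    Sec.res _ h (hgOne a b β U) = hgOne a b β V := by
  rw [hgOne, ← Sec.map_res, res_unitSec, map_one]; rfl

theorem opP_smul_hgOne (U : Opens X) : opP a b U • hgOne a b β U = 0 := by
  have h : (biprod.inl ≫ biprod.desc (rightMul (opP a b) (opP_res a b))
      (rightMul (opE a b β) (opE_res a b β))) ≫ hgProj a b β = 0 := by
    rw [Category.assoc, hgProj_condition, comp_zero]
  rw [biprod.inl_desc] at h
  have h2 : Sec.map (rightMul (opP a b) (opP_res a b) ≫ hgProj a b β) U (unitSec 1) = 0 := by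
    rw [h, Sec.map_zero]
  rw [Sec.map_comp, rightMul_unitSec, one_mul] at h2
  rw [smul_hgOne, h2]

theorem opE_smul_hgOne (U : Opens X) : opE a b β U • hgOne a b β U = 0 := by
  have h : (biprod.inr ≫ biprod.desc (rightMul (opP a b) (opP_res a b))
      (rightMul (opE a b β) (opE_res a b β))) ≫ hgProj a b β = 0 := by
    rw [Category.assoc, hgProj_condition, comp_zero]
  rw [biprod.inr_desc] at h
  have h2 : Sec.map (rightMul (opE a b β) (opE_res a b β) ≫ hgProj a b β) U (unitSec 1) = 0 := by
    rw [h, Sec.map_zero]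
  rw [Sec.map_comp, rightMul_unitSec, one_mul] at h2
  rw [smul_hgOne, h2]

theorem exists_local_smul_hgOne {U : Opens X} (m : Sec (hypergeometric a b β) U) {x : X}
    (hx : x ∈ U) : ∃ (V : Opens X) (h : V ≤ U), x ∈ V ∧ ∃ T : DOp V,
      T • hgOne a b β V = Sec.res _ h m := by
  obtain ⟨V, h, hV, s, hs⟩ := Sec.exists_local_of_epi (hgProj a b β) m hx
  exact ⟨V, h, hV, (s : DOp V), (smul_hgOne (s : DOp V)).trans hs⟩

theorem exists_local_of_smul_hgOne_eq {U : Opens X} {T T' : DOp U}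
    (hT : T • hgOne a b β U = T' • hgOne a b β U) {x : X} (hx : x ∈ U) :
    ∃ (V : Opens X) (h : V ≤ U), x ∈ V ∧ ∃ R S : DOp V,
      DOpRes h T = R * opP a b V + S * opE a b β V + DOpRes h T' := by
  rw [smul_hgOne, smul_hgOne, ← sub_eq_zero, ← map_sub] at hT
  obtain ⟨V, h, hV, s, hs⟩ := Sec.exists_local_of_exact
    (ShortComplex.exact_cokernel (biprod.desc (rightMul (opP a b) (opP_res a b))
      (rightMul (opE a b β) (opE_res a b β)))) (unitSec T - unitSec T') hT hx
  refine ⟨V, h, hV, (Sec.map biprod.fst V s : Sec (SheafOfModules.unit DX) V),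
    (Sec.map biprod.snd V s : Sec (SheafOfModules.unit DX) V), ?_⟩
  rw [biprod.desc_eq, Sec.map_add, Sec.map_comp, Sec.map_comp, map_sub, eq_sub_iff_add_eq] at hs
  exact hs.symm

variable {F : SheafOfModules.{0} DX}

/-- Well-definedness of `T • 1 ↦ T • u`: two representatives differ locally by an element of the
left ideal of `P` and `E`, which kills `u`. -/
theorem smul_eq_smul_of_smul_hgOne_eq {U : Opens X} {T T' : DOp U} {u : Sec F U}
    (hP : opP a b U • u = 0) (hE : opE a b β U • u = 0)
    (hT : T • hgOne a b β U = T' • hgOne a b β U) : T • u = T' • u := by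
  choose V h hV R S hRS using fun x : U => exists_local_of_smul_hgOne_eq hT x.2
  refine Sec.eq_of_local F U V h (fun x hx => Opens.mem_iSup.2 ⟨⟨x, hx⟩, hV _⟩) fun i => ?_
  rw [Sec.res_smul, hRS, add_smul, add_smul, mul_smul, mul_smul, ← opP_res a b U (V i) (h i),
    ← opE_res a b β U (V i) (h i), ← Sec.res_smul, ← Sec.res_smul, hP, hE, Sec.res_smul]
  simp

/-- The value at `m` of the homomorphism that maps the class of `1` to `u` is `t`. -/
def IsValue {V : Opens X} (u : Sec F V) (m : Sec (hypergeometric a b β) V) (t : Sec F V) : Prop :=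
  ∀ x ∈ V, ∃ (W : Opens X) (h : W ≤ V), x ∈ W ∧ ∃ T : DOp W,
    T • hgOne a b β W = Sec.res _ h m ∧ Sec.res F h t = T • Sec.res F h u

theorem res_killed {U V : Opens X} (h : V ≤ U) {T : ∀ U : Opens X, DOp U}
    (hT : ∀ (U V : Opens X) (h : V ≤ U), DOpRes h (T U) = T V) {u : Sec F U} (hu : T U • u = 0) :
    T V • Sec.res F h u = 0 := by
  rw [← hT U V h, ← Sec.res_smul, hu, map_zero]

theorem IsValue.unique {V : Opens X} {u : Sec F V} (hP : opP a b V • u = 0)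
    (hE : opE a b β V • u = 0) {m : Sec (hypergeometric a b β) V} {t t' : Sec F V}
    (h : IsValue u m t) (h' : IsValue u m t') : t = t' := by
  choose W k hW T hT ht using fun x : V => h x.1 x.2
  choose W' k' hW' T' hT' ht' using fun x : V => h' x.1 x.2
  refine Sec.eq_of_local F V (fun x => W x ⊓ W' x) (fun x => inf_le_left.trans (k x))
    (fun x hx => Opens.mem_iSup.2 ⟨⟨x, hx⟩, hW _, hW' _⟩) fun x => ?_
  have h1 : Sec.res F (inf_le_left.trans (k x) : W x ⊓ W' x ≤ V) t =
      DOpRes (inf_le_left : W x ⊓ W' x ≤ W x) (T x) • Sec.res F (inf_le_left.trans (k x)) u := by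
    rw [← Sec.res_res F (k x), ht, Sec.res_smul, Sec.res_res]
  have h2 : Sec.res F (inf_le_left.trans (k x) : W x ⊓ W' x ≤ V) t' =
      DOpRes (inf_le_right : W x ⊓ W' x ≤ W' x) (T' x) • Sec.res F (inf_le_left.trans (k x)) u := by
    rw [← Sec.res_res F (k' x) inf_le_right, ht', Sec.res_smul, Sec.res_res]
  rw [h1, h2]
  refine smul_eq_smul_of_smul_hgOne_eq (a := a) (b := b) (β := β)
    (res_killed _ (opP_res a b) hP) (res_killed _ (opE_res a b β) hE) ?_
  rw [← res_hgOne inf_le_left, ← Sec.res_smul, hT, res_hgOne,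
    ← res_hgOne inf_le_right, ← Sec.res_smul, hT', Sec.res_res, Sec.res_res]

/-- A section `m` is only locally of the form `T • 1`; the local values `T • u` agree on overlaps by
well-definedness and glue. -/
theorem exists_isValue {V : Opens X} {u : Sec F V} (hP : opP a b V • u = 0)
    (hE : opE a b β V • u = 0) (m : Sec (hypergeometric a b β) V) : ∃ t, IsValue u m t := by
  choose W k hW T hT using fun x : V => exists_local_smul_hgOne m x.2
  obtain ⟨t, ht, -⟩ := Sec.glue F V W k (fun x hx => Opens.mem_iSup.2 ⟨⟨x, hx⟩, hW _⟩)
    (fun x => T x • Sec.res F (k x) u) fun x y => by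
      rw [Sec.res_smul, Sec.res_smul, Sec.res_res, Sec.res_res]
      refine smul_eq_smul_of_smul_hgOne_eq (a := a) (b := b) (β := β)
        (res_killed _ (opP_res a b) hP) (res_killed _ (opE_res a b β) hE) ?_
      rw [← res_hgOne inf_le_left, ← Sec.res_smul, hT, res_hgOne,
        ← res_hgOne inf_le_right, ← Sec.res_smul, hT, Sec.res_res, Sec.res_res]
  exact ⟨t, fun x hx => ⟨W ⟨x, hx⟩, k _, hW _, T _, hT _, ht _⟩⟩

theorem IsValue.res {V W : Opens X} (k : W ≤ V) {u : Sec F V}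
    {m : Sec (hypergeometric a b β) V} {t : Sec F V} (h : IsValue u m t) :
    IsValue (Sec.res F k u) (Sec.res _ k m) (Sec.res F k t) := by
  intro x hx
  obtain ⟨W', k', hW', T, hT, ht⟩ := h x (k hx)
  refine ⟨W' ⊓ W, inf_le_right, ⟨hW', hx⟩, DOpRes inf_le_left T, ?_, ?_⟩
  · rw [← res_hgOne inf_le_left, ← Sec.res_smul, hT, Sec.res_res, Sec.res_res]
  · rw [Sec.res_res, Sec.res_res, ← Sec.res_res F k' inf_le_left, ht, Sec.res_smul, Sec.res_res]

theorem IsValue.add {V : Opens X} {u : Sec F V} {m m' : Sec (hypergeometric a b β) V}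
    {t t' : Sec F V} (h : IsValue u m t) (h' : IsValue u m' t') :
    IsValue u (m + m') (t + t') := by
  intro x hx
  obtain ⟨W, k, hW, T, hT, ht⟩ := h x hx
  obtain ⟨W', k', hW', T', hT', ht'⟩ := h' x hx
  refine ⟨W ⊓ W', inf_le_left.trans k, ⟨hW, hW'⟩, DOpRes inf_le_left T + DOpRes inf_le_right T',
    ?_, ?_⟩
  · rw [add_smul, ← res_hgOne inf_le_left, ← Sec.res_smul, hT, res_hgOne,
      ← res_hgOne inf_le_right, ← Sec.res_smul, hT', Sec.res_res, Sec.res_res, map_add]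
  · rw [add_smul, map_add, ← Sec.res_res F k inf_le_left, ht, ← Sec.res_res F k' inf_le_right, ht',
      Sec.res_smul, Sec.res_smul, Sec.res_res, Sec.res_res]

theorem IsValue.smul {V : Opens X} {u : Sec F V} {m : Sec (hypergeometric a b β) V}
    {t : Sec F V} (h : IsValue u m t) (S : DOp V) : IsValue u (S • m) (S • t) := by
  intro x hx
  obtain ⟨W, k, hW, T, hT, ht⟩ := h x hx
  refine ⟨W, k, hW, DOpRes k S * T, ?_, ?_⟩
  · rw [mul_smul, hT, Sec.res_smul]
  · rw [mul_smul, Sec.res_smul, ht]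

theorem isValue_hgOne {V : Opens X} (u : Sec F V) : IsValue u (hgOne a b β V) u :=
  fun x hx => ⟨V, le_rfl, hx, 1, by rw [one_smul, res_hgOne], by rw [one_smul]⟩

/-- The value of a homomorphism at the class of `1`. -/
noncomputable def HomOn.gen {U : Opens X} (ξ : HomOn (hypergeometric a b β) F U) : Sec F U :=
  ξ.1 ⟨U, Set.mem_Iic.2 le_rfl⟩ (hgOne a b β U)

theorem HomOn.res_gen {U V : Opens X} (ξ : HomOn (hypergeometric a b β) F U) (h : V ≤ U) :
    Sec.res F h (HomOn.gen ξ) = ξ.1 ⟨V, Set.mem_Iic.2 h⟩ (hgOne a b β V) :=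
  (ξ.2.2.2 ⟨U, Set.mem_Iic.2 le_rfl⟩ ⟨V, Set.mem_Iic.2 h⟩ h (hgOne a b β U)).symm.trans
    (congrArg (ξ.1 ⟨V, Set.mem_Iic.2 h⟩) (res_hgOne h))

/-- The module is locally generated by the class of `1`, and sections of `F` are determined locally.
-/
theorem HomOn.gen_ext {U : Opens X} {ξ η : HomOn (hypergeometric a b β) F U}
    (h : HomOn.gen ξ = HomOn.gen η) : ξ = η := by
  have h1 : ∀ (V : Opens X) (k : V ≤ U), ξ.1 ⟨V, Set.mem_Iic.2 k⟩ (hgOne a b β V) =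
      η.1 ⟨V, Set.mem_Iic.2 k⟩ (hgOne a b β V) := fun V k => by
    rw [← HomOn.res_gen ξ k, ← HomOn.res_gen η k, h]
  refine Subtype.ext (funext fun V => funext fun m => ?_)
  choose W hW hxW T hT using fun x : V.1 => exists_local_smul_hgOne m x.2
  refine Sec.eq_of_local F V.1 W hW (fun x hx => Opens.mem_iSup.2 ⟨⟨x, hx⟩, hxW _⟩) fun i => ?_
  have hWU : W i ≤ U := (hW i).trans V.2
  have h2 := ξ.2.2.2 V ⟨W i, hWU⟩ (hW i) m
  have h3 := η.2.2.2 V ⟨W i, hWU⟩ (hW i) m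
  rw [← h2, ← h3, ← hT i]
  exact (ξ.2.2.1 ⟨W i, hWU⟩ (T i) _).trans
    ((congrArg _ (h1 (W i) hWU)).trans (η.2.2.1 ⟨W i, hWU⟩ (T i) _).symm)

theorem HomOn.smul_gen_eq_zero {U : Opens X} (ξ : HomOn (hypergeometric a b β) F U) {T : DOp U}
    (hT : T • hgOne a b β U = 0) : T • HomOn.gen ξ = 0 := by
  have h := ξ.2.1 ⟨U, Set.mem_Iic.2 le_rfl⟩ 0 0
  have h2 := ξ.2.2.1 ⟨U, Set.mem_Iic.2 le_rfl⟩ T (hgOne a b β U)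
  rw [add_zero] at h
  exact h2.symm.trans ((congrArg _ hT).trans (left_eq_add.1 h))

theorem HomOn.opP_smul_gen {U : Opens X} (ξ : HomOn (hypergeometric a b β) F U) :
    opP a b U • HomOn.gen ξ = 0 := HomOn.smul_gen_eq_zero ξ (opP_smul_hgOne U)

theorem HomOn.opE_smul_gen {U : Opens X} (ξ : HomOn (hypergeometric a b β) F U) :
    opE a b β U • HomOn.gen ξ = 0 := HomOn.smul_gen_eq_zero ξ (opE_smul_hgOne U)

/-- Together with `HomOn.gen_ext` this identifies homomorphisms with solutions of the system.
Uniqueness of values turns additivity, linearity and compatibility with restriction into closure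
properties of `IsValue`. -/
theorem exists_gen_eq {U : Opens X} {u : Sec F U} (hP : opP a b U • u = 0)
    (hE : opE a b β U • u = 0) : ∃ ξ : HomOn (hypergeometric a b β) F U, HomOn.gen ξ = u := by
  choose ξ hξ using fun (V : Opens X) (h : V ≤ U) => exists_isValue (a := a) (b := b) (β := β)
    (res_killed h (opP_res a b) hP) (res_killed h (opE_res a b β) hE)
  have hu : ∀ (V : Opens X) (h : V ≤ U) (m : Sec (hypergeometric a b β) V) (t : Sec F V),
      IsValue (Sec.res F h u) m t → ξ V h m = t := fun V h m t ht =>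
    (hξ V h m).unique (res_killed h (opP_res a b) hP) (res_killed h (opE_res a b β) hE) ht
  refine ⟨⟨fun V => ξ V.1 V.2, fun V m n => hu _ _ _ _ ((hξ _ _ m).add (hξ _ _ n)),
    fun V T m => hu _ _ _ _ ((hξ _ _ m).smul T), fun V W h m => hu _ _ _ _ ?_⟩, ?_⟩
  · have h1 := (hξ V.1 V.2 m).res h
    have h2 : Sec.res F h (Sec.res F (Set.mem_Iic.1 V.2) u) =
        Sec.res F (Set.mem_Iic.1 W.2) u :=
      Sec.res_res F (Set.mem_Iic.1 V.2) h u
    exact h2 ▸ h1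
  · refine (hu U le_rfl _ _ (isValue_hgOne _)).trans ?_
    exact Sec.res_self u

theorem HomOn.gen_map {G : SheafOfModules.{0} DX} (f : F ⟶ G) {U : Opens X}
    (ξ : HomOn (hypergeometric a b β) F U) :
    HomOn.gen (HomOn.map (hypergeometric a b β) f U ξ) = Sec.map f U (HomOn.gen ξ) := rfl

theorem HomOn.gen_res {U V : Opens X} (h : V ≤ U) (ξ : HomOn (hypergeometric a b β) F U) :
    HomOn.gen (HomOn.res (hypergeometric a b β) F h ξ) = Sec.res F h (HomOn.gen ξ) :=
  (HomOn.res_gen ξ h).symm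

theorem HomOn.gen_zero {U : Opens X} : HomOn.gen (0 : HomOn (hypergeometric a b β) F U) = 0 := rfl

end

/-! ### The Koszul complex -/

section

variable (a b : ℕ) (β : ℂ)

/-- Exactness in degree one of the Koszul complex of the toric and the Euler operator with values
in `F`, as a complex of sheaves. -/
def KoszulExactOne (F : SheafOfModules.{0} DX) : Prop :=
  ∀ (U : Opens X) (u v : Sec F U), opE a b (shiftParam a b β) U • u = opP a b U • v →
    ∀ x ∈ U, ∃ (V : Opens X) (h : V ≤ U), x ∈ V ∧ ∃ w : Sec F V,
      opP a b V • w = Sec.res F h u ∧ opE a b β V • w = Sec.res F h v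

/-- Exactness in degree two of the Koszul complex of the toric and the Euler operator with values
in `F`, as a complex of sheaves. -/
def KoszulExactTwo (F : SheafOfModules.{0} DX) : Prop :=
  ∀ (U : Opens X) (u : Sec F U), ∀ x ∈ U, ∃ (V : Opens X) (h : V ≤ U), x ∈ V ∧
    ∃ v w : Sec F V, opE a b (shiftParam a b β) V • v - opP a b V • w = Sec.res F h u

end

/-! ### Free presheaves of modules and Koszul exactness for injective sheaves. -/

section

variable {C : Type} [SmallCategory C] {R : Cᵒᵖ ⥤ RingCat.{0}}

/-- A morphism that kills the kernel of `f` is defined on the image of `f`, and injectivity extends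
it to `B`. The hypothesis is sectionwise, so no sheafified extension by zero is needed. -/
theorem exists_factor_of_injective {A B J : PresheafOfModules.{0} R} [Injective J] (f : A ⟶ B)
    (g : A ⟶ J) (h : ∀ (V : Cᵒᵖ) (x : A.obj V), f.app V x = 0 → g.app V x = 0) :
    ∃ w : B ⟶ J, f ≫ w = g := by
  have h0 : kernel.ι f ≫ g = 0 := by
    ext V x
    refine h V _ ?_
    have : (kernel.ι f ≫ f).app V x = 0 := by rw [kernel.condition]; rfl
    exact this
  exact ⟨(ShortComplex.exact_kernel f).descToInjective g h0,
    (ShortComplex.exact_kernel f).comp_descToInjective g h0⟩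

/-- The generators of a free presheaf of modules. -/
noncomputable def freeGen {U V : C} (i : V ⟶ U) :
    ((PresheafOfModules.free R).obj (yoneda.obj U)).obj (op V) := ModuleCat.freeMk i

theorem freeYonedaEquiv_symm_freeGen {M : PresheafOfModules.{0} R} {U V : C}
    (s : M.obj (op U)) (i : V ⟶ U) :
    (PresheafOfModules.freeYonedaEquiv.symm s).app (op V) (freeGen i) = M.map i.op s := by
  obtain ⟨f, rfl⟩ := PresheafOfModules.freeYonedaEquiv.surjective s
  rw [Equiv.symm_apply_apply]
  have h := PresheafOfModules.naturality_apply f i.op (freeGen (𝟙 U))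
  have h2 : ((PresheafOfModules.free R).obj (yoneda.obj U)).map i.op (freeGen (𝟙 U)) =
      freeGen i :=
    (ModuleCat.freeDesc_apply _ _).trans (congrArg ModuleCat.freeMk (Category.comp_id i))
  rw [h2] at h
  exact h

end

/-- The opens form a poset: the free presheaf on `U` has rank one over `V ≤ U` and is zero
elsewhere, so it is the presheaf extension by zero of `𝒟_U`. -/
theorem freeYoneda_eq_zero_or {U V : Opens X}
    (x : ((PresheafOfModules.free DX.obj).obj (yoneda.obj U)).obj (op V)) :
    x = 0 ∨ ∃ (i : V ⟶ U) (r : DX.obj.obj (op V)), x = r • freeGen i := by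
  by_cases h : Nonempty (V ⟶ U)
  · obtain ⟨i⟩ := h
    let y : (V ⟶ U) →₀ DX.obj.obj (op V) := x
    refine Or.inr ⟨i, y i, ?_⟩
    have h1 : y = y i • Finsupp.single i 1 := by
      ext j
      obtain rfl : i = j := Subsingleton.elim _ _
      simp
    exact h1
  · refine Or.inl ?_
    let y : (V ⟶ U) →₀ DX.obj.obj (op V) := x
    have h1 : y = 0 := by
      ext j
      exact (h ⟨j⟩).elim
    exact h1

theorem smul_freeGen_eq_zero {U V : Opens X} (i : V ⟶ U) (r : DX.obj.obj (op V))
    (h : r • (freeGen i : ((PresheafOfModules.free DX.obj).obj (yoneda.obj U)).obj (op V)) = 0) :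
    r = 0 := by
  have h1 : (r • Finsupp.single i 1 : (V ⟶ U) →₀ DX.obj.obj (op V)) = 0 := h
  have := DFunLike.congr_fun h1 i
  simpa using this

/-- A right adjoint of an exact functor, here sheafification, preserves injectives. -/
instance (I : SheafOfModules.{0} DX) [Injective I] : Injective I.val :=
  (PresheafOfModules.sheafificationAdjunction (𝟙 DX.obj)).map_injective I inferInstance

section

variable {a b : ℕ} {β : ℂ}

/-- The endomorphism of the extension by zero of `𝒟_U` given by right multiplication. -/
noncomputable def freeMul {U : Opens X} (S : DX.obj.obj (op U)) :
    (PresheafOfModules.free DX.obj).obj (yoneda.obj U) ⟶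
      (PresheafOfModules.free DX.obj).obj (yoneda.obj U) :=
  PresheafOfModules.freeYonedaEquiv.symm (S • freeGen (𝟙 U))

theorem freeMul_freeGen {U V : Opens X} (S : DX.obj.obj (op U)) (i : V ⟶ U) :
    (freeMul S).app (op V) (freeGen i) = DX.obj.map i.op S • freeGen i := by
  refine (freeYonedaEquiv_symm_freeGen _ i).trans ?_
  refine (PresheafOfModules.map_smul _ i.op _ _).trans ?_
  exact congrArg (fun t => DX.obj.map i.op S • t)
    ((ModuleCat.freeDesc_apply _ _).trans (congrArg ModuleCat.freeMk (Category.comp_id i)))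

theorem freeMul_comp {U : Opens X} {M : PresheafOfModules.{0} DX.obj} (S : DX.obj.obj (op U))
    (w : (PresheafOfModules.free DX.obj).obj (yoneda.obj U) ⟶ M) :
    PresheafOfModules.freeYonedaEquiv (freeMul S ≫ w) =
      S • PresheafOfModules.freeYonedaEquiv w := by
  rw [PresheafOfModules.freeYonedaEquiv_comp, freeMul, Equiv.apply_symm_apply]
  exact (w.app (op U)).hom.map_smul _ _

/-- The morphism from the extension by zero of `𝒟_U` given by a section over `U`. -/
noncomputable def ofSec (F : SheafOfModules.{0} DX) {U : Opens X} (u : Sec F U) :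
    (PresheafOfModules.free DX.obj).obj (yoneda.obj U) ⟶ F.val :=
  PresheafOfModules.freeYonedaEquiv.symm u

/-- The section over `U` given by a morphism from the extension by zero of `𝒟_U`. -/
noncomputable def toSec {F : SheafOfModules.{0} DX} {U : Opens X}
    (w : (PresheafOfModules.free DX.obj).obj (yoneda.obj U) ⟶ F.val) : Sec F U :=
  PresheafOfModules.freeYonedaEquiv w

theorem toSec_ofSec (F : SheafOfModules.{0} DX) {U : Opens X} (u : Sec F U) :
    toSec (ofSec F u) = u := Equiv.apply_symm_apply PresheafOfModules.freeYonedaEquiv _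

theorem toSec_freeMul_comp {F : SheafOfModules.{0} DX} {U : Opens X}
    (w : (PresheafOfModules.free DX.obj).obj (yoneda.obj U) ⟶ F.val) (S : DOp U) :
    toSec (freeMul S ≫ w) = S • toSec w := freeMul_comp _ w

theorem freeMul_smul_freeGen {U V : Opens X} (h : V ≤ U) (S : DOp U) (r : DOp V) :
    (freeMul S).app (op V) ((show DX.obj.obj (op V) from r) • freeGen (homOfLE h)) =
      (show DX.obj.obj (op V) from (r * DOpRes h S : DOp V)) • freeGen (homOfLE h) :=
  (((freeMul S).app (op V)).hom.map_smul (show DX.obj.obj (op V) from r) _).trans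
    ((congrArg ((show DX.obj.obj (op V) from r) • ·) (freeMul_freeGen _ (homOfLE h))).trans
      (smul_smul _ _ _))

theorem ofSec_smul_freeGen (F : SheafOfModules.{0} DX) {U V : Opens X} (h : V ≤ U)
    (u : Sec F U) (r : DOp V) :
    (ofSec F u).app (op V) ((show DX.obj.obj (op V) from r) • freeGen (homOfLE h)) =
      r • Sec.res F h u :=
  (((ofSec F u).app (op V)).hom.map_smul (show DX.obj.obj (op V) from r) _).trans
    (congrArg ((show DX.obj.obj (op V) from r) • ·) (freeYonedaEquiv_symm_freeGen _ (homOfLE h)))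

/-- Right multiplication by `P` is injective, so `u`, seen as a morphism from the extension by zero
of `𝒟_U`, extends along it; the extension is a section `w` with `P w = u`. Thus `P` alone is
surjective on sections. -/
theorem koszulExactTwo_of_injective (ha : 0 < a) (hab : a < b) (I : SheafOfModules.{0} DX)
    [Injective I] : KoszulExactTwo a b β I := by
  intro U u x hx
  obtain ⟨w, hw⟩ := exists_factor_of_injective (J := I.val) (freeMul (opP a b U))
    (ofSec I u) (by
      rintro ⟨V⟩ x hx
      rcases freeYoneda_eq_zero_or x with rfl | ⟨i, r, rfl⟩
      · exact map_zero _
      · have h1 := freeMul_smul_freeGen i.le (opP a b U) r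
        have h2 := smul_freeGen_eq_zero _ _ (h1.symm.trans hx)
        have h3 : r = 0 := mul_opP_injective ha hab (T := r) h2
        rw [h3, zero_smul, map_zero])
  have h := toSec_freeMul_comp w (opP a b U)
  rw [hw, toSec_ofSec] at h
  refine ⟨U, le_rfl, hx, 0, -toSec w, ?_⟩
  rw [smul_zero, smul_neg, zero_sub, neg_neg, Sec.res_self]
  exact h.symm

theorem res_opP_smul {F : SheafOfModules.{0} DX} {U V : Opens X} (h : V ≤ U) (u : Sec F U) :
    Sec.res F h (opP a b U • u) = opP a b V • Sec.res F h u := Sec.res_smul F h _ u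

theorem res_opE_smul {F : SheafOfModules.{0} DX} {U V : Opens X} (h : V ≤ U) (u : Sec F U) :
    Sec.res F h (opE a b β U • u) = opE a b β V • Sec.res F h u := Sec.res_smul F h _ u

/-- Locally the syzygy is `(T, S) = R (-E', P)`, and the cocycle condition says precisely that
`(-E', P)` kills `(u, v)`. -/
theorem smul_add_smul_eq_zero_of_syzygy (ha : 0 < a) (hab : a < b) {F : SheafOfModules.{0} DX}
    {U : Opens X} {u v : Sec F U} (huv : opE a b (shiftParam a b β) U • u = opP a b U • v)
    {T S : DOp U} (h : T * opP a b U + S * opE a b β U = 0) : T • u + S • v = 0 := by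
  choose V k hV R hR hR' using fun x : U => exists_local_syzygy ha hab h x.2
  refine Sec.eq_of_local F U V (fun x => (k x)) (fun x hx => Opens.mem_iSup.2 ⟨⟨x, hx⟩, hV _⟩)
    fun x => ?_
  have h1 : R x • Sec.res F (k x) (opE a b (shiftParam a b β) U • u) =
      R x • Sec.res F (k x) (opP a b U • v) := by rw [huv]
  rw [res_opE_smul, res_opP_smul] at h1
  rw [← mul_smul, ← mul_smul, ← hR] at h1
  rw [map_add, Sec.res_smul, Sec.res_smul, ← h1, ← add_smul, hR', zero_smul, map_zero]

/-- The pair `(u, v)` is a morphism from two copies of the extension by zero of `𝒟_U`. It kills the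
kernel of `(P, E)`, so it extends along `(P, E)` to a morphism from one copy, that is, to a section
`w`. -/
theorem koszulExactOne_of_injective (ha : 0 < a) (hab : a < b) (I : SheafOfModules.{0} DX)
    [Injective I] : KoszulExactOne a b β I := by
  intro U u v huv x hx
  obtain ⟨w, hw⟩ := exists_factor_of_injective (J := I.val)
    (biprod.desc (freeMul (opP a b U)) (freeMul (opE a b β U)))
    (biprod.desc (ofSec I u) (ofSec I v)) (by
      rintro ⟨V⟩ x hx
      rw [biprod.desc_eq] at hx ⊢
      let q₁ : (PresheafOfModules.free DX.obj).obj (yoneda.obj U) ⊞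
        (PresheafOfModules.free DX.obj).obj (yoneda.obj U) ⟶ _ := biprod.fst
      let q₂ : (PresheafOfModules.free DX.obj).obj (yoneda.obj U) ⊞
        (PresheafOfModules.free DX.obj).obj (yoneda.obj U) ⟶ _ := biprod.snd
      have hx' : (freeMul (opP a b U)).app (op V) (q₁.app (op V) x) +
        (freeMul (opE a b β U)).app (op V) (q₂.app (op V) x) = 0 := hx
      change (ofSec I u).app (op V) (q₁.app (op V) x) +
        (ofSec I v).app (op V) (q₂.app (op V) x) = 0
      generalize q₁.app (op V) x = y at *
      generalize q₂.app (op V) x = z at *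
      by_cases hVU : V ≤ U
      swap
      · rcases freeYoneda_eq_zero_or y with rfl | ⟨i, -⟩
        · rcases freeYoneda_eq_zero_or z with rfl | ⟨i, -⟩
          · rw [map_zero, map_zero, add_zero]
          · exact (hVU i.le).elim
        · exact (hVU i.le).elim
      have hrep : ∀ y : ((PresheafOfModules.free DX.obj).obj (yoneda.obj U)).obj (op V),
          ∃ r : DOp V, y = (show DX.obj.obj (op V) from r) • freeGen (homOfLE hVU) := by
        intro y
        rcases freeYoneda_eq_zero_or y with rfl | ⟨i, r, rfl⟩
        · exact ⟨0, (zero_smul (DX.obj.obj (op V)) (freeGen (homOfLE hVU) :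
            ((PresheafOfModules.free DX.obj).obj (yoneda.obj U)).obj (op V))).symm⟩
        · exact ⟨r, rfl⟩
      obtain ⟨r, rfl⟩ := hrep y
      obtain ⟨r', rfl⟩ := hrep z
      rw [freeMul_smul_freeGen, freeMul_smul_freeGen, ← add_smul] at hx'
      have h2 : r * opP a b V + r' * opE a b β V = 0 := smul_freeGen_eq_zero _ _ hx'
      rw [ofSec_smul_freeGen, ofSec_smul_freeGen]
      refine smul_add_smul_eq_zero_of_syzygy ha hab ?_ h2
      rw [← res_opE_smul, ← res_opP_smul, huv])
  have h1 := congrArg (biprod.inl ≫ ·) hw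
  have h2 := congrArg (biprod.inr ≫ ·) hw
  simp only [biprod.inl_desc_assoc, biprod.inr_desc_assoc, biprod.inl_desc, biprod.inr_desc]
    at h1 h2
  have h3 := toSec_freeMul_comp w (opP a b U)
  have h4 := toSec_freeMul_comp w (opE a b β U)
  rw [h1, toSec_ofSec] at h3
  rw [h2, toSec_ofSec] at h4
  exact ⟨U, le_rfl, hx, toSec w, h3.symm.trans (Sec.res_self u).symm,
    h4.symm.trans (Sec.res_self v).symm⟩

end

/-! ### Acyclic objects for a left exact functor -/

section

variable {C D : Type*} [Category* C] [Category* D] [Abelian C] [Abelian D]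

theorem epi_toCycles_of_exactAt (L : CochainComplex C ℤ) {m n : ℤ} (hn : m + 1 = n)
    (h : L.ExactAt n) : Epi (L.toCycles m n) := by
  have hp : (ComplexShape.up ℤ).prev n = m := by simp; lia
  have hs : (ComplexShape.up ℤ).next n = n + 1 := by simp
  have h1 : Epi (L.toCycles m n ≫ (L.cyclesIsoSc' m n (n + 1) hp hs).hom) := by
    rw [L.toCycles_cyclesIsoSc'_hom m n (n + 1) hp hs]
    exact ((L.exactAt_iff' m n (n + 1) hp hs).1 h).epi_toCycles
  have h2 := epi_comp (L.toCycles m n ≫ (L.cyclesIsoSc' m n (n + 1) hp hs).hom)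
    (L.cyclesIsoSc' m n (n + 1) hp hs).inv
  rwa [Category.assoc, Iso.hom_inv_id, Category.comp_id] at h2

/-- This is the sequence `0 → Zᵐ → Lᵐ → Zⁿ → 0` on which dimension shifting is performed. -/
theorem shortExact_cycles (L : CochainComplex C ℤ) {m n : ℤ} (hn : m + 1 = n)
    (h : L.ExactAt n) : (ShortComplex.mk (L.iCycles m) (L.toCycles m n)
      (by rw [← cancel_mono (L.iCycles n)]; simp)).ShortExact := by
  have := epi_toCycles_of_exactAt L hn h
  have hs : (ComplexShape.up ℤ).next m = n := by simp [hn]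
  refine ⟨?_⟩
  let T := ShortComplex.mk (L.iCycles m) (L.d m n) (by simp)
  have hT : T.Exact := ShortComplex.exact_of_f_is_kernel _ (L.cyclesIsKernel m n hs)
  let γ : ShortComplex.mk (L.iCycles m) (L.toCycles m n)
      (by rw [← cancel_mono (L.iCycles n)]; simp) ⟶ T :=
    { τ₁ := 𝟙 _, τ₂ := 𝟙 _, τ₃ := L.iCycles n }
  have : Epi γ.τ₁ := inferInstanceAs (Epi (𝟙 _))
  have : IsIso γ.τ₂ := inferInstanceAs (IsIso (𝟙 _))
  have : Mono γ.τ₃ := inferInstanceAs (Mono (L.iCycles n))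
  exact (ShortComplex.exact_iff_of_epi_of_isIso_of_mono γ).2 hT

theorem map_exact_and_mono (G : C ⥤ D) [G.Additive] [PreservesFiniteLimits G]
    (S : ShortComplex C) (hS : S.Exact) (hm : Mono S.f) : (S.map G).Exact ∧ Mono (G.map S.f) := by
  have h : PreservesFiniteLimits G ↔ ∀ S : ShortComplex C, S.Exact ∧ Mono S.f →
      (S.map G).Exact ∧ Mono (G.map S.f) := (Functor.preservesFiniteLimits_tfae G).out 3 1
  exact h.1 inferInstance S ⟨hS, hm⟩

/-- A left exact functor preserves the cycles, so only the surjectivity of `Lᵐ → Zⁿ` has to survive.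
-/
theorem exactAt_map_of_epi (G : C ⥤ D) [G.Additive] [PreservesFiniteLimits G]
    (L : CochainComplex C ℤ) {m n : ℤ} (hn : m + 1 = n) [Epi (G.map (L.toCycles m n))] :
    ((G.mapHomologicalComplex _).obj L).ExactAt n := by
  have hp : (ComplexShape.up ℤ).prev n = m := by simp; lia
  have hs : (ComplexShape.up ℤ).next n = n + 1 := by simp
  rw [HomologicalComplex.exactAt_iff' _ m n (n + 1) hp hs]
  let T := ShortComplex.mk (L.iCycles n) (L.d n (n + 1)) (by simp)
  have hT : T.Exact := ShortComplex.exact_of_f_is_kernel _ (L.cyclesIsKernel n (n + 1) hs)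
  have hm : Mono T.f := inferInstanceAs (Mono (L.iCycles n))
  have hGT := (map_exact_and_mono G T hT hm).1
  let γ : ((G.mapHomologicalComplex _).obj L).sc' m n (n + 1) ⟶ T.map G :=
    { τ₁ := G.map (L.toCycles m n)
      τ₂ := 𝟙 _
      τ₃ := 𝟙 _
      comm₁₂ := by
        refine (G.map_comp _ _).symm.trans ?_
        rw [L.toCycles_i]
        exact (Category.comp_id _).symm
      comm₂₃ := (Category.id_comp _).trans (Category.comp_id _).symm }
  have : Epi γ.τ₁ := inferInstanceAs (Epi (G.map (L.toCycles m n)))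
  have : IsIso γ.τ₂ := inferInstanceAs (IsIso (𝟙 _))
  have : Mono γ.τ₃ := inferInstanceAs (Mono (𝟙 _))
  exact (ShortComplex.exact_iff_of_epi_of_isIso_of_mono γ).2 hGT

theorem quasiIsoAt_zero_iff {K L : CochainComplex C ℤ} (i : K ⟶ L) (h1 : IsZero (K.X 1))
    (hK : IsZero (K.X (-1))) (hL : IsZero (L.X (-1))) : QuasiIsoAt i 0 ↔
      (ShortComplex.mk (i.f 0) (L.d 0 1) (by rw [i.comm]; simp [h1.eq_of_tgt (K.d 0 1) 0])).Exact ∧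
        Mono (i.f 0) := by
  have hp : (ComplexShape.up ℤ).prev 0 = -1 := by simp
  have hs : (ComplexShape.up ℤ).next 0 = 1 := by simp
  rw [quasiIsoAt_iff' i (-1) 0 1 hp hs]
  exact ShortComplex.quasiIso_iff_of_zeros
    ((HomologicalComplex.shortComplexFunctor' C (.up ℤ) (-1) 0 1).map i)
    (hK.eq_of_src _ _) (h1.eq_of_tgt _ _) (hL.eq_of_src _ _)

/-- Dimension shifting: each `Zⁿ⁺¹` is the cokernel of `Zⁿ` in the injective `Lⁿ`, so `P` climbs
through the cycles of an injective resolution. -/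
theorem prop_cycles {P : ObjectProperty C} {G : C ⥤ D}
    (hP : ∀ S : ShortComplex C, S.ShortExact → P S.X₁ → Injective S.X₂ →
      P S.X₃ ∧ Epi (G.map S.g))
    (L : CochainComplex C ℤ) [∀ n, Injective (L.X n)] (h0 : P (L.cycles 0))
    (hL : ∀ n : ℤ, 0 < n → L.ExactAt n) (n : ℕ) : P (L.cycles n) := by
  induction n with
  | zero => exact h0
  | succ n ih =>
    exact (hP _ (shortExact_cycles L (m := n) (n := (n + 1 : ℕ)) (by simp)
      (hL _ (by positivity))) ih (inferInstanceAs (Injective (L.X n)))).1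

variable {P : ObjectProperty C} [P.IsClosedUnderIsomorphisms] {G : C ⥤ D} [G.Additive]
  [PreservesFiniteLimits G]

/-- `G` preserves the exactness of an injective resolution of an object of `P`, because all its
cycles have property `P` and `G` is therefore exact on the short exact sequences into which it
splits. -/
theorem quasiIso_map (hP : ∀ S : ShortComplex C, S.ShortExact → P S.X₁ → Injective S.X₂ →
      P S.X₃ ∧ Epi (G.map S.g))
    {K L : CochainComplex C ℤ} (hK : ∀ n ≠ 0, IsZero (K.X n)) (hK0 : P (K.X 0))
    [L.IsStrictlyGE 0] [∀ n, Injective (L.X n)] (i : K ⟶ L) [QuasiIso i] :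
    QuasiIso ((G.mapHomologicalComplex _).map i) := by
  have hL : ∀ n : ℤ, n < 0 → IsZero (L.X n) := fun n hn => L.isZero_of_isStrictlyGE 0 n hn
  have hex : ∀ n : ℤ, 0 < n → L.ExactAt n := fun n hn =>
    (quasiIsoAt_iff_exactAt i n (ShortComplex.exact_of_isZero_X₂ _ (hK n hn.ne'))).1 inferInstance
  obtain ⟨he, hm⟩ :=
    (quasiIsoAt_zero_iff i (hK 1 one_ne_zero) (hK _ (by simp)) (hL _ (by simp))).1 inferInstance
  -- The augmentation identifies `K⁰` with the kernel of `L⁰ → L¹`, which starts the induction.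
  have hc : P (L.cycles 0) := by
    refine P.prop_of_iso (IsLimit.conePointUniqueUpToIso (he.fIsKernel)
      (L.cyclesIsKernel 0 1 (by simp))) hK0
  have hGK : ∀ n ≠ 0, ((G.mapHomologicalComplex _).obj K).ExactAt n := fun n hn =>
    ShortComplex.exact_of_isZero_X₂ _ (G.map_isZero (hK n hn))
  rw [quasiIso_iff]
  intro n
  rcases lt_trichotomy n 0 with hn | rfl | hn
  · rw [quasiIsoAt_iff_exactAt _ _ (hGK n hn.ne)]
    exact ShortComplex.exact_of_isZero_X₂ _ (G.map_isZero (hL n hn))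
  · rw [quasiIsoAt_zero_iff _ (G.map_isZero (hK 1 one_ne_zero)) (G.map_isZero (hK _ (by simp)))
      (G.map_isZero (hL _ (by simp)))]
    exact map_exact_and_mono G _ he hm
  · rw [quasiIsoAt_iff_exactAt _ _ (hGK n hn.ne')]
    obtain ⟨m, rfl⟩ : ∃ m : ℕ, n = m + 1 := ⟨(n - 1).toNat, by lia⟩
    have := (hP _ (shortExact_cycles L (m := m) rfl (hex _ hn)) (prop_cycles hP L hc hex m)
      (inferInstanceAs (Injective (L.X m)))).2
    exact exactAt_map_of_epi G L (m := m) rfl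

variable [HasDerivedCategory C] [HasDerivedCategory D] [EnoughInjectives C]

/-- Naturality of the unit along an injective resolution: the unit is an isomorphism at the
resolution, and the resolution map is inverted both before and after applying `G`. -/
theorem isIso_rightDerivedFunctorPlusUnit (hP : ∀ S : ShortComplex C, S.ShortExact → P S.X₁ →
      Injective S.X₂ → P S.X₃ ∧ Epi (G.map S.g)) {F : C} (hF : P F) :
    IsIso (G.rightDerivedFunctorPlusUnit.app ((HomotopyCategory.Plus.singleFunctor C 0).obj F)) := by
  let K : CochainComplex.Plus C := ⟨(HomologicalComplex.single C (.up ℤ) 0).obj F, 0, inferInstance⟩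
  have : K.obj.IsStrictlyGE 0 := inferInstanceAs
    (CochainComplex.IsStrictlyGE ((HomologicalComplex.single C (.up ℤ) 0).obj F) 0)
  obtain ⟨L, hL, i, hi⟩ := CochainComplex.Plus.exists_quasiIso_injective K 0
  let L' : CochainComplex C ℤ := ((InjectiveObject.ι C).mapCochainComplexPlus.obj L).obj
  have hL' : L'.IsStrictlyGE 0 := inferInstanceAs
    (CochainComplex.IsStrictlyGE (((InjectiveObject.ι C).mapHomologicalComplex _).obj L.obj) 0)
  have hinj : ∀ n, Injective (L'.X n) := fun n => (L.obj.X n).property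
  let i' : K.obj ⟶ L' := i.hom
  have hi' : QuasiIso i' := hi
  have hGi : QuasiIso ((G.mapHomologicalComplex _).map i') := by
    refine quasiIso_map hP (fun n hn => ?_) ?_ i'
    · exact HomologicalComplex.isZero_single_obj_X _ _ _ _ hn
    · exact P.prop_of_iso (HomologicalComplex.singleObjXSelf (.up ℤ) 0 F).symm hF
  let j := (HomotopyCategory.Plus.quotient C).map i
  have hj : IsIso (DerivedCategory.Plus.Qh.map j) := by
    refine Localization.inverts _ (HomotopyCategory.Plus.quasiIso C) j ?_
    rw [HomotopyCategory.Plus.quasiIso_iff]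
    exact (HomotopyCategory.quotient_map_mem_quasiIso_iff i').2 hi'
  have hj' : IsIso (DerivedCategory.Plus.Qh.map (G.mapHomotopyCategoryPlus.map j)) := by
    refine Localization.inverts _ (HomotopyCategory.Plus.quasiIso D) _ ?_
    rw [HomotopyCategory.Plus.quasiIso_iff]
    exact (HomotopyCategory.quotient_map_mem_quasiIso_iff
      ((G.mapHomologicalComplex _).map i')).2 hGi
  have hnat := G.rightDerivedFunctorPlusUnit.naturality j
  have h1 : IsIso (G.rightDerivedFunctorPlusUnit.app ((HomotopyCategory.Plus.quotient C).obj K) ≫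
      (DerivedCategory.Plus.Qh ⋙ G.rightDerivedFunctorPlus).map j) := by
    rw [← hnat]
    have : IsIso ((G.mapHomotopyCategoryPlus ⋙ DerivedCategory.Plus.Qh).map j) := hj'
    have : IsIso (G.rightDerivedFunctorPlusUnit.app
      ((HomotopyCategory.Plus.quotient C).obj
        ((InjectiveObject.ι C).mapCochainComplexPlus.obj L))) := by
      infer_instance
    infer_instance
  have h2 : IsIso ((DerivedCategory.Plus.Qh ⋙ G.rightDerivedFunctorPlus).map j) :=
    inferInstanceAs (IsIso (G.rightDerivedFunctorPlus.map (DerivedCategory.Plus.Qh.map j)))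
  exact @IsIso.of_isIso_comp_right _ _ _ _ _ _ _ h2 h1

variable (G) in
/-- An additive functor commutes with the formation of complexes concentrated in degree zero. -/
noncomputable def singleMapIso : HomotopyCategory.Plus.singleFunctor C 0 ⋙
    G.mapHomotopyCategoryPlus ≅ G ⋙ HomotopyCategory.Plus.singleFunctor D 0 :=
  ((HomotopyCategory.plus D).fullyFaithfulι.whiskeringRight _).preimageIso
    (Functor.isoWhiskerRight (HomologicalComplex.singleMapHomologicalComplex G (.up ℤ) 0)
      (HomotopyCategory.quotient _ _))

variable (G) in
/-- The comparison between a functor and its right derived functor. -/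
noncomputable def singleToDerived : G ⋙ DerivedCategory.Plus.singleFunctor D 0 ⟶
    DerivedCategory.Plus.singleFunctor C 0 ⋙ G.rightDerivedFunctorPlus :=
  Functor.whiskerRight (singleMapIso G).inv DerivedCategory.Plus.Qh ≫
    Functor.whiskerLeft (HomotopyCategory.Plus.singleFunctor C 0) G.rightDerivedFunctorPlusUnit

theorem isIso_singleToDerived_app (hP : ∀ S : ShortComplex C, S.ShortExact → P S.X₁ →
      Injective S.X₂ → P S.X₃ ∧ Epi (G.map S.g)) {F : C} (hF : P F) :
    IsIso ((singleToDerived G).app F) := by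
  have h1 := isIso_rightDerivedFunctorPlusUnit hP hF
  have h2 : IsIso (DerivedCategory.Plus.Qh.map ((singleMapIso G).inv.app F)) := inferInstance
  exact @IsIso.comp_isIso _ _ _ _ _ _ _ h2 h1

theorem isZero_homology_single (F : D) {n : ℤ} (hn : n ≠ 0) :
    IsZero ((DerivedCategory.Plus.homologyFunctor D n).obj
      ((DerivedCategory.Plus.singleFunctor D 0).obj F)) := by
  rcases lt_or_gt_of_ne hn with h | h
  · exact DerivedCategory.Plus.isZero_homology_of_isGE _ 0 n h
  · exact DerivedCategory.Plus.isZero_homology_of_isLE _ 0 n h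

/-- Nonvanishing can be tested in `D` itself because `D` embeds faithfully in its derived category.
-/
theorem isZero_single_iff (F : D) :
    IsZero ((DerivedCategory.Plus.singleFunctor D 0).obj F) ↔ IsZero F := by
  refine ⟨fun h => ?_, fun h => Functor.map_isZero _ h⟩
  have h1 : IsZero ((DerivedCategory.singleFunctor D 0).obj F) :=
    Functor.map_isZero (DerivedCategory.Plus.ι (C := D)) h
  rw [IsZero.iff_id_eq_zero] at h1 ⊢
  apply (DerivedCategory.singleFunctor D 0).map_injective
  exact ((DerivedCategory.singleFunctor D 0).map_id F).trans
    (h1.trans (Functor.map_zero _ _ _).symm)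

theorem isIso_single_map_iff {F F' : D} (f : F ⟶ F') :
    IsIso ((DerivedCategory.Plus.singleFunctor D 0).map f) ↔ IsIso f := by
  refine ⟨fun h => ?_, fun h => inferInstance⟩
  have h1 : IsIso ((DerivedCategory.singleFunctor D 0).map f) :=
    inferInstanceAs (IsIso ((DerivedCategory.Plus.ι (C := D)).map
      ((DerivedCategory.Plus.singleFunctor D 0).map f)))
  exact isIso_of_fully_faithful (DerivedCategory.singleFunctor D 0) f

theorem isZero_derived_iff (hP : ∀ S : ShortComplex C, S.ShortExact → P S.X₁ →
      Injective S.X₂ → P S.X₃ ∧ Epi (G.map S.g)) {F : C} (hF : P F) :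
    IsZero (G.rightDerivedFunctorPlus.obj ((DerivedCategory.Plus.singleFunctor C 0).obj F)) ↔
      IsZero (G.obj F) := by
  have := isIso_singleToDerived_app hP hF
  rw [← isZero_single_iff (G.obj F)]
  exact (asIso ((singleToDerived G).app F)).symm.isZero_iff

theorem isZero_homology_derived (hP : ∀ S : ShortComplex C, S.ShortExact → P S.X₁ →
      Injective S.X₂ → P S.X₃ ∧ Epi (G.map S.g)) {F : C} (hF : P F) {n : ℤ} (hn : n ≠ 0) :
    IsZero ((DerivedCategory.Plus.homologyFunctor D n).obj
      (G.rightDerivedFunctorPlus.obj ((DerivedCategory.Plus.singleFunctor C 0).obj F))) := by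
  have := isIso_singleToDerived_app hP hF
  exact (isZero_homology_single (G.obj F) hn).of_iso
    ((DerivedCategory.Plus.homologyFunctor D n).mapIso (asIso ((singleToDerived G).app F)).symm)

theorem isIso_derived_map_iff (hP : ∀ S : ShortComplex C, S.ShortExact → P S.X₁ →
      Injective S.X₂ → P S.X₃ ∧ Epi (G.map S.g)) {F F' : C} (hF : P F) (hF' : P F') (f : F ⟶ F') :
    IsIso (G.rightDerivedFunctorPlus.map ((DerivedCategory.Plus.singleFunctor C 0).map f)) ↔
      IsIso (G.map f) := by
  have h1 := isIso_singleToDerived_app hP hF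
  have h2 := isIso_singleToDerived_app hP hF'
  rw [← isIso_single_map_iff (G.map f)]
  have hnat := (singleToDerived G).naturality f
  constructor
  · intro h
    have h3 : IsIso ((DerivedCategory.Plus.singleFunctor C 0 ⋙ G.rightDerivedFunctorPlus).map f) := h
    have h4 : IsIso ((G ⋙ DerivedCategory.Plus.singleFunctor D 0).map f ≫
        (singleToDerived G).app F') := by rw [hnat]; infer_instance
    exact @IsIso.of_isIso_comp_right _ _ _ _ _ _ _ h2 h4
  · intro h
    have h3 : IsIso ((G ⋙ DerivedCategory.Plus.singleFunctor D 0).map f) := h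
    have h4 : IsIso ((singleToDerived G).app F ≫
        (DerivedCategory.Plus.singleFunctor C 0 ⋙ G.rightDerivedFunctorPlus).map f) := by
      rw [← hnat]; infer_instance
    exact @IsIso.of_isIso_comp_left _ _ _ _ _ _ _ h1 h4

end

/-! ### Koszul-exact sheaves compute `RHom` from the hypergeometric module. -/

section

variable (a b : ℕ) (β : ℂ)

/-- The sheaves with values in which the Koszul complex is exact in positive degrees. -/
def koszulExact : ObjectProperty (SheafOfModules.{0} DX) :=
  fun F => KoszulExactOne a b β F ∧ KoszulExactTwo a b β F

variable {a b β}

/-- The second cohomology is a cokernel, hence right exact. -/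
theorem KoszulExactTwo.of_epi {F G : SheafOfModules.{0} DX} (f : F ⟶ G) [Epi f]
    (hF : KoszulExactTwo a b β F) : KoszulExactTwo a b β G := by
  intro U u x hx
  obtain ⟨V, h, hV, s, hs⟩ := Sec.exists_local_of_epi f u hx
  obtain ⟨W, k, hW, v, w, hvw⟩ := hF V s x hV
  refine ⟨W, k.trans h, hW, Sec.map f W v, Sec.map f W w, ?_⟩
  rw [← map_smul, ← map_smul, ← map_sub, hvw, Sec.map_res, hs, Sec.res_res]

/-- The piece `H¹(X₂) → H¹(X₃) → H²(X₁)` of the long exact sequence. The defect of a lifted cocycle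
lies in `X₁`, is removed by exactness in degree two there, and the corrected cocycle is a coboundary
in `X₂`. -/
theorem KoszulExactOne.of_shortExact {S : ShortComplex (SheafOfModules.{0} DX)} (hS : S.ShortExact)
    (h1 : KoszulExactTwo a b β S.X₁) (h2 : KoszulExactOne a b β S.X₂) :
    KoszulExactOne a b β S.X₃ := by
  have := hS.mono_f
  have := hS.epi_g
  intro U u v huv x hx
  obtain ⟨V, h, hV, s, hs⟩ := Sec.exists_local_of_epi S.g u hx
  obtain ⟨V', h', hV', t, ht⟩ := Sec.exists_local_of_epi S.g (Sec.res _ h v) hV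
  rw [Sec.res_res] at ht
  have hst : Sec.map S.g V' (opE a b (shiftParam a b β) V' • Sec.res _ h' s - opP a b V' • t) = 0 := by
    rw [map_sub, map_smul, map_smul, Sec.map_res, hs, ht, Sec.res_res, ← res_opE_smul,
      ← res_opP_smul, huv, sub_self]
  obtain ⟨e, he⟩ := Sec.exists_of_exact (f := S.f) (g := S.g) (w := S.zero) hS.exact _ hst
  obtain ⟨W, k, hW, v', w', hvw⟩ := h1 V' e x hV'
  obtain ⟨W', k', hW', w, hw1, hw2⟩ := h2 W (Sec.res _ (k.trans h') s - Sec.map S.f W v')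
    (Sec.res _ k t - Sec.map S.f W w') (by
      rw [smul_sub, smul_sub, sub_eq_sub_iff_sub_eq_sub, ← (Sec.map S.f W).map_smul,
        ← (Sec.map S.f W).map_smul, ← map_sub, hvw,
        Sec.map_res, he, map_sub, res_opE_smul, res_opP_smul, Sec.res_res]) x hW
  refine ⟨W', k'.trans (k.trans (h'.trans h)), hW', Sec.map S.g W' w, ?_, ?_⟩
  · rw [← map_smul, hw1, Sec.map_res, map_sub, Sec.map_res, hs, ← Sec.map_comp, S.zero,
      Sec.map_zero, sub_zero, Sec.res_res, Sec.res_res]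
  · rw [← map_smul, hw2, Sec.map_res, map_sub, Sec.map_res, ht, ← Sec.map_comp, S.zero,
      Sec.map_zero, sub_zero, Sec.res_res, Sec.res_res]

instance : (koszulExact a b β).IsClosedUnderIsomorphisms where
  of_iso {F G} e h := by
    refine ⟨fun U u v huv x hx => ?_, h.2.of_epi e.hom⟩
    obtain ⟨V, k, hV, w, hw1, hw2⟩ := h.1 U (Sec.map e.inv U u) (Sec.map e.inv U v)
      (by rw [← map_smul, huv, map_smul]) x hx
    refine ⟨V, k, hV, Sec.map e.hom V w, ?_, ?_⟩
    · rw [← map_smul, hw1, Sec.map_res, ← Sec.map_comp, e.inv_hom_id, Sec.map_id]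
    · rw [← map_smul, hw2, Sec.map_res, ← Sec.map_comp, e.inv_hom_id, Sec.map_id]

/-- For a lift `s` of a solution, `(P s, E s)` is a Koszul cocycle of `X₁`: the obstruction to
lifting the solution. Writing it locally as `(P w, E w)` makes `s - w` the wanted solution. -/
theorem epi_sheafHom_map {S : ShortComplex (SheafOfModules.{0} DX)} (hS : S.ShortExact)
    (h1 : KoszulExactOne a b β S.X₁) : Epi ((sheafHom (hypergeometric a b β)).map S.g) := by
  have := hS.mono_f
  have := hS.epi_g
  refine VSheaf.epi_of_local _ fun U ξ x hx => ?_
  let η : HomOn (hypergeometric a b β) S.X₃ U := ξ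
  obtain ⟨V, h, hV, s, hs⟩ := Sec.exists_local_of_epi S.g (HomOn.gen η) hx
  obtain ⟨α, hα⟩ := Sec.exists_of_exact (f := S.f) (g := S.g) (w := S.zero) hS.exact
    (opP a b V • s) (by rw [map_smul, hs, ← res_opP_smul, HomOn.opP_smul_gen, map_zero])
  obtain ⟨γ, hγ⟩ := Sec.exists_of_exact (f := S.f) (g := S.g) (w := S.zero) hS.exact
    (opE a b β V • s) (by rw [map_smul, hs, ← res_opE_smul, HomOn.opE_smul_gen, map_zero])
  obtain ⟨W, k, hW, w, hw1, hw2⟩ := h1 V α γ (by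
    apply Sec.map_injective S.f V
    rw [map_smul, map_smul, hα, hγ, ← mul_smul, ← mul_smul, opE_mul_opP]) x hV
  obtain ⟨ζ, hζ⟩ := exists_gen_eq (a := a) (b := b) (β := β)
    (u := Sec.res _ k s - Sec.map S.f W w)
    (by rw [smul_sub, ← (Sec.map S.f W).map_smul, hw1, Sec.map_res, hα, res_opP_smul, sub_self])
    (by rw [smul_sub, ← (Sec.map S.f W).map_smul, hw2, Sec.map_res, hγ, res_opE_smul, sub_self])
  refine ⟨W, homOfLE (k.trans h), hW, ζ, ?_⟩
  refine HomOn.gen_ext (ξ := HomOn.map _ S.g W ζ) (η := HomOn.res _ _ (k.trans h) η) ?_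
  rw [HomOn.gen_map, HomOn.gen_res, hζ, map_sub, Sec.map_res, hs, ← Sec.map_comp, S.zero,
      Sec.map_zero, sub_zero, Sec.res_res]

theorem sheafHom_exact_and_mono {S : ShortComplex (SheafOfModules.{0} DX)} (hS : S.ShortExact) :
    (S.map (sheafHom (hypergeometric a b β))).Exact ∧
      Mono ((sheafHom (hypergeometric a b β)).map S.f) := by
  have := hS.mono_f
  constructor
  · refine VSheaf.exact_of_local _ fun U ξ hξ x hx => ?_
    let η : HomOn (hypergeometric a b β) S.X₂ U := ξ
    have h0 : HomOn.map _ S.g U η = 0 := hξ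
    have h1 : Sec.map S.g U (HomOn.gen η) = 0 := by
      rw [← HomOn.gen_map, h0, HomOn.gen_zero]
    obtain ⟨α, hα⟩ := Sec.exists_of_exact (f := S.f) (g := S.g) (w := S.zero) hS.exact _ h1
    obtain ⟨ζ, hζ⟩ := exists_gen_eq (a := a) (b := b) (β := β) (u := α)
      (Sec.map_injective S.f U (by rw [map_smul, hα, HomOn.opP_smul_gen, map_zero]))
      (Sec.map_injective S.f U (by rw [map_smul, hα, HomOn.opE_smul_gen, map_zero]))
    refine ⟨U, 𝟙 U, hx, ζ, ?_⟩
    refine HomOn.gen_ext (ξ := HomOn.map _ S.f U ζ) (η := HomOn.res _ _ le_rfl η) ?_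
    rw [HomOn.gen_map, HomOn.gen_res, hζ, hα, Sec.res_self]
  · refine VSheaf.mono_of_injective _ fun U ξ η h => ?_
    have h1 : HomOn.map _ S.f U ξ = HomOn.map _ S.f U η := h
    exact HomOn.gen_ext (Sec.map_injective S.f U (congrArg HomOn.gen h1))

instance : PreservesFiniteLimits (sheafHom (hypergeometric a b β)) := by
  have h : (∀ S : ShortComplex (SheafOfModules.{0} DX), S.ShortExact →
      (S.map (sheafHom (hypergeometric a b β))).Exact ∧
        Mono ((sheafHom (hypergeometric a b β)).map S.f)) ↔
      PreservesFiniteLimits (sheafHom (hypergeometric a b β)) :=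
    (Functor.preservesFiniteLimits_tfae _).out 0 3
  exact h.1 fun S hS => sheafHom_exact_and_mono hS

/-- The hypothesis `hP` of the acyclicity lemmas; it applies to the first syzygy of an injective
embedding of any Koszul-exact sheaf. -/
theorem koszulExact_and_epi (ha : 0 < a) (hab : a < b) (S : ShortComplex (SheafOfModules.{0} DX))
    (hS : S.ShortExact) (h1 : koszulExact a b β S.X₁) (h2 : Injective S.X₂) :
    koszulExact a b β S.X₃ ∧ Epi ((sheafHom (hypergeometric a b β)).map S.g) := by
  have := hS.epi_g
  exact ⟨⟨.of_shortExact hS h1.2 (koszulExactOne_of_injective ha hab _),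
    .of_epi S.g (koszulExactTwo_of_injective ha hab _)⟩, epi_sheafHom_map hS h1.1⟩

theorem isZero_RHom_iff (ha : 0 < a) (hab : a < b) {F : SheafOfModules.{0} DX}
    (hF : koszulExact a b β F) : IsZero ((RHom (hypergeometric a b β)).obj F) ↔
      ∀ (U : Opens X) (u : Sec F U), opP a b U • u = 0 → opE a b β U • u = 0 → u = 0 := by
  refine (isZero_derived_iff (koszulExact_and_epi ha hab) hF).trans ⟨fun h U u hP hE => ?_,
    fun h => ?_⟩
  · obtain ⟨ζ, hζ⟩ := exists_gen_eq hP hE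
    have h1 : ζ = 0 := VSheaf.section_eq_zero_of_isZero h U ζ
    rw [← hζ, h1, HomOn.gen_zero]
  · refine VSheaf.isZero_of_sections fun U ξ => ?_
    refine HomOn.gen_ext (ξ := ξ) (η := 0) ?_
    rw [HomOn.gen_zero]
    exact h U _ (HomOn.opP_smul_gen ξ) (HomOn.opE_smul_gen ξ)

theorem isZero_homology_RHom (ha : 0 < a) (hab : a < b) {F : SheafOfModules.{0} DX}
    (hF : koszulExact a b β F) {n : ℤ} (hn : n ≠ 0) :
    IsZero ((DerivedCategory.Plus.homologyFunctor _ n).obj ((RHom (hypergeometric a b β)).obj F)) :=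
  isZero_homology_derived (koszulExact_and_epi ha hab) hF hn

theorem isIso_RHom_map_iff (ha : 0 < a) (hab : a < b) {F G : SheafOfModules.{0} DX}
    (hF : koszulExact a b β F) (hG : koszulExact a b β G) (f : F ⟶ G) :
    IsIso ((RHom (hypergeometric a b β)).map f) ↔
      IsIso ((sheafHom (hypergeometric a b β)).map f) :=
  isIso_derived_map_iff (koszulExact_and_epi ha hab) hF hG f

/-- Only solutions in `G` have to lift. Injectivity of `f` makes the lifts solutions automatically.
-/
theorem isIso_sheafHom_map {F G : SheafOfModules.{0} DX} (f : F ⟶ G)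
    (hf : ∀ U, Function.Injective (Sec.map f U))
    (h : ∀ (U : Opens X) (u : Sec G U), opP a b U • u = 0 → opE a b β U • u = 0 → ∀ x ∈ U,
      ∃ (V : Opens X) (k : V ≤ U), x ∈ V ∧ ∃ v : Sec F V, Sec.map f V v = Sec.res _ k u) :
    IsIso ((sheafHom (hypergeometric a b β)).map f) := by
  have h1 : Mono ((sheafHom (hypergeometric a b β)).map f) := by
    refine VSheaf.mono_of_injective _ fun U ξ η h => ?_
    have h1 : HomOn.map _ f U ξ = HomOn.map _ f U η := h
    exact HomOn.gen_ext (hf U (congrArg HomOn.gen h1))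
  have h2 : Epi ((sheafHom (hypergeometric a b β)).map f) := by
    refine VSheaf.epi_of_local _ fun U ξ x hx => ?_
    let η : HomOn (hypergeometric a b β) G U := ξ
    obtain ⟨V, k, hV, v, hv⟩ := h U _ (HomOn.opP_smul_gen η) (HomOn.opE_smul_gen η) x hx
    obtain ⟨ζ, hζ⟩ := exists_gen_eq (a := a) (b := b) (β := β) (u := v)
      (hf V (by
        rw [map_smul, hv, ← res_opP_smul, HomOn.opP_smul_gen, map_zero, map_zero]))
      (hf V (by
        rw [map_smul, hv, ← res_opE_smul, HomOn.opE_smul_gen, map_zero, map_zero]))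
    refine ⟨V, homOfLE k, hV, ζ, ?_⟩
    refine HomOn.gen_ext (ξ := HomOn.map _ f V ζ) (η := HomOn.res _ _ k η) ?_
    rw [HomOn.gen_map, HomOn.gen_res, hζ, hv]
  exact isIso_of_mono_of_epi _

end

/-! ### Quotients of sheaves of families of power series -/

/-- The action of a differential operator on families of power series. -/
def act {U : Opens X} (T : DOp U) (s : U → Ger) : U → Ger := fun p => T.1 p (s p)

namespace DFam

variable {A B : DFam} (h : ∀ U s, A.pred U s → B.pred U s)

theorem act_pred (F : DFam) {U : Opens X} (T : DOp U) {s : U → Ger} (hs : F.pred U s) :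
    F.pred U (act T s) := F.DOp_apply T.2 hs

/-- The class of a family of power series in a quotient sheaf. -/
noncomputable def quot {U : Opens X} (s : U → Ger) (hs : B.pred U s) :
    Sec (cokernel (incl h)) U :=
  Sec.map (F := B.sheaf) (cokernel.π (incl h)) U (⟨s, hs⟩ : B.sec U)

variable {h}

theorem smul_quot {U : Opens X} (T : DOp U) {s : U → Ger} (hs : B.pred U s) :
    T • quot h s hs = quot h (act T s) (B.act_pred T hs) :=
  ((Sec.map (F := B.sheaf) (cokernel.π (incl h)) U).map_smul T (⟨s, hs⟩ : B.sec U)).symm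

theorem sub_pred {U : Opens X} (F : DFam) {s t : U → Ger} (hs : F.pred U s) (ht : F.pred U t) :
    F.pred U (s - t) := (F.sec U).sub_mem hs ht

theorem quot_sub {U : Opens X} {s t : U → Ger} (hs : B.pred U s) (ht : B.pred U t) :
    quot h s hs - quot h t ht = quot h (s - t) (B.sub_pred hs ht) :=
  ((Sec.map (F := B.sheaf) (cokernel.π (incl h)) U).map_sub (⟨s, hs⟩ : B.sec U)
    (⟨t, ht⟩ : B.sec U)).symm

theorem res_quot {U V : Opens X} (k : V ≤ U) {s : U → Ger} (hs : B.pred U s) :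
    Sec.res _ k (quot h s hs) = quot h (GevreyIrr.res k s) (B.res k s hs) :=
  (Sec.map_res (F := B.sheaf) (cokernel.π (incl h)) k (⟨s, hs⟩ : B.sec U)).symm

/-- A class that vanishes comes locally from `A`, and membership in `A` is of local nature. -/
theorem quot_eq_zero_iff {U : Opens X} {s : U → Ger} (hs : B.pred U s) :
    quot h s hs = 0 ↔ A.pred U s := by
  constructor
  · intro h0
    refine A.loc s fun p => ?_
    obtain ⟨V, k, hV, t, ht⟩ := Sec.exists_local_of_exact (ShortComplex.exact_cokernel (incl h))
      (⟨s, hs⟩ : B.sec U) h0 p.2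
    refine ⟨V, k, hV, ?_⟩
    have h1 : GevreyIrr.res k s = (t : A.sec V).1 := (congrArg Subtype.val ht).symm
    rw [h1]
    exact (t : A.sec V).2
  · intro hA
    exact congrArg (fun f => Sec.map (F := A.sheaf) f U (⟨s, hA⟩ : A.sec U))
      (cokernel.condition (incl h))

theorem quot_eq_iff {U : Opens X} {s t : U → Ger} (hs : B.pred U s) (ht : B.pred U t) :
    quot h s hs = quot h t ht ↔ A.pred U (s - t) := by
  rw [← sub_eq_zero, quot_sub, quot_eq_zero_iff]

theorem exists_local_quot {U : Opens X} (m : Sec (cokernel (incl h)) U) {x : X} (hx : x ∈ U) :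
    ∃ (V : Opens X) (k : V ≤ U), x ∈ V ∧ ∃ (s : V → Ger) (hs : B.pred V s),
      quot h s hs = Sec.res _ k m := by
  obtain ⟨V, k, hV, s, hs⟩ := Sec.exists_local_of_epi (cokernel.π (incl h)) m hx
  exact ⟨V, k, hV, (s : B.sec V).1, (s : B.sec V).2, hs⟩

variable {a b : ℕ} {β : ℂ}

/-- Sections of a quotient sheaf are locally classes, so exactness in the quotient becomes
solvability in `B` modulo `A`; the next two results translate exactness in degree one and uniqueness
in the same way. -/
theorem koszulExactTwo_cokernel
    (h2 : ∀ (U : Opens X) (s : U → Ger), B.pred U s → ∀ p ∈ U, ∃ (V : Opens X) (k : V ≤ U),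
      p ∈ V ∧ ∃ u v : V → Ger, B.pred V u ∧ B.pred V v ∧
        A.pred V (act (opE a b (shiftParam a b β) V) u - act (opP a b V) v - GevreyIrr.res k s)) :
    KoszulExactTwo a b β (cokernel (incl h)) := by
  intro U m x hx
  obtain ⟨V, k, hV, s, hs, hs'⟩ := exists_local_quot m hx
  obtain ⟨W, l, hW, u, v, hu, hv, huv⟩ := h2 V s hs x hV
  refine ⟨W, l.trans k, hW, quot h u hu, quot h v hv, ?_⟩
  rw [smul_quot, smul_quot, quot_sub, ← Sec.res_res _ k l, ← hs', res_quot, quot_eq_iff]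
  exact huv

theorem koszulExactOne_cokernel
    (h1 : ∀ (U : Opens X) (u v : U → Ger), B.pred U u → B.pred U v →
      A.pred U (act (opE a b (shiftParam a b β) U) u - act (opP a b U) v) → ∀ p ∈ U,
      ∃ (V : Opens X) (k : V ≤ U), p ∈ V ∧ ∃ w : V → Ger, B.pred V w ∧
        A.pred V (act (opP a b V) w - GevreyIrr.res k u) ∧
        A.pred V (act (opE a b β V) w - GevreyIrr.res k v)) :
    KoszulExactOne a b β (cokernel (incl h)) := by
  intro U m n hmn x hx
  obtain ⟨V, k, hV, u, hu, hu'⟩ := exists_local_quot m hx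
  obtain ⟨W, l, hW, v, hv, hv'⟩ := exists_local_quot (Sec.res _ k n) hV
  have hu2 : Sec.res _ (l.trans k) m = quot h _ (B.res l u hu) := by
    rw [← Sec.res_res _ k l, ← hu', res_quot]
  have hv2 : Sec.res _ (l.trans k) n = quot h v hv := by rw [← Sec.res_res _ k l, ← hv']
  have h3 : opE a b (shiftParam a b β) W • Sec.res _ (l.trans k) m =
      opP a b W • Sec.res _ (l.trans k) n :=
    ((res_opE_smul _ _).symm.trans (congrArg _ hmn)).trans (res_opP_smul _ _)
  rw [hu2, hv2, smul_quot, smul_quot, quot_eq_iff] at h3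
  obtain ⟨W', l', hW', w, hw, hw1, hw2⟩ := h1 W _ v (B.res l u hu) hv h3 x hW
  refine ⟨W', l'.trans (l.trans k), hW', quot h w hw, ?_, ?_⟩
  · rw [smul_quot, ← Sec.res_res _ (l.trans k) l', hu2, res_quot, quot_eq_iff]
    exact hw1
  · rw [smul_quot, ← Sec.res_res _ (l.trans k) l', hv2, res_quot, quot_eq_iff]
    exact hw2

theorem eq_zero_of_smul_eq_zero
    (h0 : ∀ (U : Opens X) (u : U → Ger), B.pred U u → A.pred U (act (opP a b U) u) →
      A.pred U (act (opE a b β U) u) → A.pred U u)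
    (U : Opens X) (m : Sec (cokernel (incl h)) U) (hP : opP a b U • m = 0)
    (hE : opE a b β U • m = 0) : m = 0 := by
  choose V k hV s hs hs' using fun x : U => exists_local_quot m x.2
  refine Sec.eq_of_local _ U V k (fun x hx => Opens.mem_iSup.2 ⟨⟨x, hx⟩, hV _⟩) fun x => ?_
  have h1 : opP a b (V x) • Sec.res _ (k x) m = 0 := by rw [← res_opP_smul, hP, map_zero]
  have h2 : opE a b β (V x) • Sec.res _ (k x) m = 0 := by rw [← res_opE_smul, hE, map_zero]
  rw [← hs', smul_quot, quot_eq_zero_iff] at h1 h2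
  rw [map_zero, ← hs', quot_eq_zero_iff]
  exact h0 _ _ (hs x) h1 h2

theorem exists_smul_eq_zero_and_ne_zero {U : Opens X} {u : U → Ger} (hu : B.pred U u)
    (hP : A.pred U (act (opP a b U) u)) (hE : A.pred U (act (opE a b β U) u))
    (hA : ¬ A.pred U u) : ∃ m : Sec (cokernel (incl h)) U, opP a b U • m = 0 ∧
      opE a b β U • m = 0 ∧ m ≠ 0 := by
  refine ⟨quot h u hu, ?_, ?_, ?_⟩
  · rwa [smul_quot, quot_eq_zero_iff]
  · rwa [smul_quot, quot_eq_zero_iff]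
  · rwa [Ne, quot_eq_zero_iff]

section

variable {B' : DFam} {h' : ∀ U s, A.pred U s → B'.pred U s}
  (k : ∀ U s, B.pred U s → B'.pred U s) {f : cokernel (incl h) ⟶ cokernel (incl h')}

theorem map_quot (hf : cokernel.π (incl h) ≫ f = incl k ≫ cokernel.π (incl h'))
    (U : Opens X) (s : U → Ger) (hs : B.pred U s) :
    Sec.map f U (quot h s hs) = quot h' s (k U s hs) :=
  congrArg (fun g => Sec.map (F := B.sheaf) g U (⟨s, hs⟩ : B.sec U)) hf

theorem map_cokernel_injective (hf : cokernel.π (incl h) ≫ f = incl k ≫ cokernel.π (incl h'))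
    (U : Opens X) : Function.Injective (Sec.map f U) := by
  rw [injective_iff_map_eq_zero]
  intro m hm
  choose V l hV s hs hs' using fun x : U => exists_local_quot m x.2
  refine Sec.eq_of_local _ U V l (fun x hx => Opens.mem_iSup.2 ⟨⟨x, hx⟩, hV _⟩) fun x => ?_
  have h1 : Sec.map f (V x) (Sec.res _ (l x) m) = 0 := by rw [Sec.map_res, hm, map_zero]
  rw [← hs', map_quot k hf, quot_eq_zero_iff] at h1
  rw [map_zero, ← hs', quot_eq_zero_iff]
  exact h1

/-- A solution in `B' / A` is represented by `u` with `P u` and `E u` in `A`, so the regularity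
statement `h0` is what puts it in `B`. -/
theorem exists_local_map_eq (hf : cokernel.π (incl h) ≫ f = incl k ≫ cokernel.π (incl h'))
    (h0 : ∀ (U : Opens X) (u : U → Ger), B'.pred U u → A.pred U (act (opP a b U) u) →
      A.pred U (act (opE a b β U) u) → B.pred U u)
    (U : Opens X) (m : Sec (cokernel (incl h')) U) (hP : opP a b U • m = 0)
    (hE : opE a b β U • m = 0) (x : X) (hx : x ∈ U) :
    ∃ (V : Opens X) (l : V ≤ U), x ∈ V ∧ ∃ v, Sec.map f V v = Sec.res _ l m := by
  obtain ⟨V, l, hV, s, hs, hs'⟩ := exists_local_quot m hx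
  have h1 : opP a b V • Sec.res _ l m = 0 := by rw [← res_opP_smul, hP, map_zero]
  have h2 : opE a b β V • Sec.res _ l m = 0 := by rw [← res_opE_smul, hE, map_zero]
  rw [← hs', smul_quot, quot_eq_zero_iff] at h1 h2
  exact ⟨V, l, hV, quot h s (h0 _ _ hs h1 h2), by rw [map_quot k hf, ← hs']⟩

end

end DFam

/-! ### Sequences with factorial growth -/

/-- Sequences of growth `C * D ^ j * (j !) ^ σ`. -/
def FactGrowth (σ : ℝ) (x : ℕ → ℂ) : Prop :=
  ∃ C D : ℝ, 0 ≤ C ∧ 1 ≤ D ∧ ∀ j, ‖x j‖ ≤ C * D ^ j * (j ! : ℝ) ^ σ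

theorem one_le_factorial_rpow {σ : ℝ} (hσ : 0 ≤ σ) (j : ℕ) : 1 ≤ (j ! : ℝ) ^ σ :=
  Real.one_le_rpow (by exact_mod_cast j.factorial_pos) hσ

theorem FactGrowth.add {σ : ℝ} {x y : ℕ → ℂ} (hx : FactGrowth σ x) (hy : FactGrowth σ y) :
    FactGrowth σ fun j => x j + y j := by
  obtain ⟨C, D, hC, hD, h⟩ := hx
  obtain ⟨C', D', hC', hD', h'⟩ := hy
  refine ⟨C + C', max D D', by positivity, hD.trans (le_max_left _ _), fun j => ?_⟩
  have h0 : (0 : ℝ) ≤ (j ! : ℝ) ^ σ := by positivity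
  calc ‖x j + y j‖ ≤ C * D ^ j * (j ! : ℝ) ^ σ + C' * D' ^ j * (j ! : ℝ) ^ σ :=
        (norm_add_le _ _).trans (add_le_add (h j) (h' j))
    _ ≤ C * max D D' ^ j * (j ! : ℝ) ^ σ + C' * max D D' ^ j * (j ! : ℝ) ^ σ := by
        gcongr
        · exact le_max_left _ _
        · exact le_max_right _ _
    _ = _ := by ring

theorem FactGrowth.mono {σ ρ : ℝ} (h : σ ≤ ρ) {x : ℕ → ℂ} (hx : FactGrowth σ x) :
    FactGrowth ρ x := by
  obtain ⟨C, D, hC, hD, hx⟩ := hx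
  refine ⟨C, D, hC, hD, fun j => (hx j).trans ?_⟩
  have : (1 : ℝ) ≤ j ! := by exact_mod_cast j.factorial_pos
  gcongr

/-- The finitely many initial terms go into the constant; this needs `0 ≤ σ`, so that the factorial
weight is at least `1`. -/
theorem factGrowth_of_eventually_le {σ : ℝ} (hσ : 0 ≤ σ) {x : ℕ → ℂ} {C D : ℝ} (hC : 0 ≤ C)
    (hD : 1 ≤ D) {J : ℕ} (h : ∀ j, J ≤ j → ‖x j‖ ≤ C * D ^ j * (j ! : ℝ) ^ σ) :
    FactGrowth σ x := by
  refine ⟨C + ∑ j ∈ Finset.range J, ‖x j‖, D, by positivity, hD, fun j => ?_⟩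
  have h0 : (0 : ℝ) ≤ (j ! : ℝ) ^ σ := by positivity
  rcases lt_or_ge j J with hj | hj
  · have h1 : ‖x j‖ ≤ ∑ j ∈ Finset.range J, ‖x j‖ :=
      Finset.single_le_sum (f := fun j => ‖x j‖) (fun _ _ => norm_nonneg _) (Finset.mem_range.2 hj)
    have h2 : 1 ≤ D ^ j * (j ! : ℝ) ^ σ :=
      one_le_mul_of_one_le_of_one_le (one_le_pow₀ hD) (one_le_factorial_rpow hσ j)
    have h3 : 0 ≤ ∑ j ∈ Finset.range J, ‖x j‖ := by positivity
    rw [mul_assoc]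
    nlinarith
  · refine (h j hj).trans ?_
    have : 0 ≤ ∑ j ∈ Finset.range J, ‖x j‖ := by positivity
    gcongr
    linarith

theorem factGrowth_of_eventually_eq_zero {σ : ℝ} (hσ : 0 ≤ σ) {x : ℕ → ℂ} {J : ℕ}
    (h : ∀ j, J ≤ j → x j = 0) : FactGrowth σ x :=
  factGrowth_of_eventually_le hσ le_rfl le_rfl (J := J) fun j hj => by rw [h j hj]; simp

/-! ### A recurrence with coefficients of factorial growth -/

/-- `(j + p)! / j!`. -/
noncomputable def factRatio (p j : ℕ) : ℝ := ((j + p)! : ℝ) / (j ! : ℝ)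

theorem factorial_add_rpow (p j : ℕ) (σ : ℝ) :
    ((j + p)! : ℝ) ^ σ = factRatio p j ^ σ * (j ! : ℝ) ^ σ := by
  have hj : (j ! : ℝ) ≠ 0 := by exact_mod_cast j.factorial_ne_zero
  rw [← Real.mul_rpow (by unfold factRatio; positivity) (by positivity), factRatio,
    div_mul_cancel₀ _ hj]

theorem factRatio_eq (p j : ℕ) : factRatio p j = ((j + 1).ascFactorial p : ℝ) := by
  have hj : (j ! : ℝ) ≠ 0 := by exact_mod_cast j.factorial_ne_zero
  rw [factRatio, div_eq_iff hj, mul_comm]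
  exact_mod_cast (Nat.factorial_mul_ascFactorial j p).symm

theorem pow_le_factRatio (p j : ℕ) : ((j + 1 : ℕ) : ℝ) ^ p ≤ factRatio p j := by
  rw [factRatio_eq]
  exact_mod_cast Nat.pow_succ_le_ascFactorial (j + 1) p

theorem factRatio_le_pow (p j : ℕ) : factRatio p j ≤ ((j + p : ℕ) : ℝ) ^ p := by
  rw [factRatio_eq]
  exact_mod_cast Nat.ascFactorial_le_pow_add j p

theorem one_le_factRatio (p j : ℕ) : 1 ≤ factRatio p j :=
  (one_le_pow₀ (by exact_mod_cast Nat.succ_pos j)).trans (pow_le_factRatio p j)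

section

variable {p : ℕ} {A : ℕ → ℂ} {τ m M : ℝ} {J : ℕ}

theorem eventually_factRatio_small (hp : 0 < p) {δ ε : ℝ} (hδ : δ < 0) (hε : 0 < ε) :
    ∃ J : ℕ, ∀ j, J ≤ j → factRatio p j ^ δ ≤ ε := by
  have h1 : Filter.Tendsto (fun j : ℕ => factRatio p j ^ δ) Filter.atTop (nhds 0) := by
    have h2 : Filter.Tendsto (fun j : ℕ => factRatio p j) Filter.atTop Filter.atTop := by
      refine Filter.tendsto_atTop_mono (fun j => ?_) tendsto_natCast_atTop_atTop
      have h3 : ((j : ℕ) : ℝ) ≤ ((j + 1 : ℕ) : ℝ) ^ p := by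
        have : j ≤ (j + 1) ^ p := (Nat.le_succ j).trans (Nat.le_self_pow hp.ne' _)
        exact_mod_cast this
      exact h3.trans (pow_le_factRatio p j)
    have := (tendsto_rpow_neg_atTop (neg_pos.2 hδ)).comp h2
    simpa [Function.comp_def] using this
  obtain ⟨J, hJ⟩ := Filter.eventually_atTop.1 (h1.eventually (ge_mem_nhds hε))
  exact ⟨J, hJ⟩

/-- A step of the estimates of solutions of the recurrence. -/
theorem norm_step (hm : 0 < m) (hA : ∀ j, J ≤ j → m * factRatio p j ^ τ ≤ ‖A j‖) {σ D : ℝ}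
    (hD : 1 ≤ D) {j : ℕ} (hj : J ≤ j)
    (hsmall : factRatio p j ^ (σ + 1 - τ) ≤ m / (2 * D ^ p)) {y : ℂ} {C : ℝ} (hC : 0 ≤ C)
    (hy : ‖y‖ ≤ C * D ^ (j + p) * ((j + p)! : ℝ) ^ σ) :
    ‖(factRatio p j : ℂ) / A j * y‖ ≤ C / 2 * D ^ j * (j ! : ℝ) ^ σ := by
  have hB : 0 < factRatio p j := zero_lt_one.trans_le (one_le_factRatio p j)
  have hBτ : 0 < factRatio p j ^ τ := Real.rpow_pos_of_pos hB _
  have hA0 : 0 < ‖A j‖ := (mul_pos hm hBτ).trans_le (hA j hj)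
  have hD0 : 0 < D ^ p := by positivity
  have hj0 : (0 : ℝ) ≤ (j ! : ℝ) ^ σ := by positivity
  rw [norm_mul, norm_div, Complex.norm_real, Real.norm_of_nonneg hB.le]
  calc factRatio p j / ‖A j‖ * ‖y‖
      ≤ factRatio p j / (m * factRatio p j ^ τ) * (C * D ^ (j + p) * ((j + p)! : ℝ) ^ σ) := by
        gcongr
        exact hA j hj
    _ = factRatio p j ^ (σ + 1 - τ) * (D ^ p / m) * (C * D ^ j * (j ! : ℝ) ^ σ) := by
        rw [factorial_add_rpow, Real.rpow_sub hB, Real.rpow_add hB, Real.rpow_one, pow_add]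
        field_simp
    _ ≤ m / (2 * D ^ p) * (D ^ p / m) * (C * D ^ j * (j ! : ℝ) ^ σ) := by gcongr
    _ = _ := by field_simp

/-- Subcritical uniqueness. Solving for `y_j` in terms of `y_{j+p}` gains a factor `B_j ^ (σ + 1 -
τ)` with negative exponent, so each backward step eventually halves the constant in the bound, and
it can be halved indefinitely. -/
theorem eventually_eq_zero_of_recurrence (hp : 0 < p) (hm : 0 < m)
    (hA : ∀ j, J ≤ j → m * factRatio p j ^ τ ≤ ‖A j‖) {σ : ℝ} (hσ : σ < τ - 1) {y : ℕ → ℂ}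
    (hy : FactGrowth σ y) {J' : ℕ}
    (h : ∀ j, J' ≤ j → A j * y j - factRatio p j * y (j + p) = 0) :
    ∃ K, ∀ j, K ≤ j → y j = 0 := by
  obtain ⟨C, D, hC, hD, hy⟩ := hy
  obtain ⟨K, hK⟩ := eventually_factRatio_small (p := p) hp (δ := σ + 1 - τ) (by linarith)
    (ε := m / (2 * D ^ p)) (by positivity)
  refine ⟨max K (max J J'), fun j hj => ?_⟩
  have hb : ∀ n : ℕ, ∀ j, max K (max J J') ≤ j → ‖y j‖ ≤ C / 2 ^ n * D ^ j * (j ! : ℝ) ^ σ := by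
    intro n
    induction n with
    | zero => intro j _; simpa using hy j
    | succ n ih =>
      intro j hj
      have hJj : J ≤ j := (le_max_left _ _).trans ((le_max_right _ _).trans hj)
      have hJ'j : J' ≤ j := (le_max_right _ _).trans ((le_max_right _ _).trans hj)
      have hA0 : A j ≠ 0 := norm_pos_iff.1 ((mul_pos hm (Real.rpow_pos_of_pos
        (zero_lt_one.trans_le (one_le_factRatio p j)) _)).trans_le (hA j hJj))
      have e : y j = (factRatio p j : ℂ) / A j * y (j + p) := by
        have := h j hJ'j
        field_simp
        linear_combination this
      rw [e, pow_succ, ← div_div]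
      exact norm_step hm hA hD hJj (hK j ((le_max_left _ _).trans hj)) (by positivity)
        (ih (j + p) (hj.trans (Nat.le_add_right _ _)))
  by_contra hne
  have hpos : 0 < ‖y j‖ := norm_pos_iff.2 hne
  have hlim : Filter.Tendsto (fun n : ℕ => C * (1 / 2 : ℝ) ^ n * D ^ j * (j ! : ℝ) ^ σ)
      Filter.atTop (nhds (C * 0 * D ^ j * (j ! : ℝ) ^ σ)) :=
    (((tendsto_pow_atTop_nhds_zero_of_lt_one (by norm_num) (by norm_num)).const_mul C).mul_const
      _).mul_const _
  have := ge_of_tendsto' hlim fun n => by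
    have := hb n j hj
    rwa [one_div, inv_pow, ← div_eq_mul_inv]
  simp at this
  exact hne this

/-- Subcritical existence. Iterate `x_j = e_j / A_j + (B_j / A_j) x_{j+p}` towards infinity: the
resulting Neumann series is dominated by a geometric series of ratio `1 / 2` and stays in the same
growth class. -/
theorem exists_solution_of_lt (hp : 0 < p) (hm : 0 < m)
    (hA : ∀ j, J ≤ j → m * factRatio p j ^ τ ≤ ‖A j‖) (hτ : 0 ≤ τ) {σ : ℝ} (hσ0 : 0 ≤ σ)
    (hσ : σ < τ - 1) {e : ℕ → ℂ} (he : FactGrowth σ e) :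
    ∃ x, FactGrowth σ x ∧ ∃ K, ∀ j, K ≤ j → A j * x j - factRatio p j * x (j + p) = e j := by
  obtain ⟨C, D, hC, hD, he⟩ := he
  obtain ⟨K, hK⟩ := eventually_factRatio_small (p := p) hp (δ := σ + 1 - τ) (by linarith)
    (ε := m / (2 * D ^ p)) (by positivity)
  let w : ℕ → ℕ → ℂ := fun n => Nat.rec (fun j => e j / A j)
    (fun _ v j => (factRatio p j : ℂ) / A j * v (j + p)) n
  have hA1 : ∀ j, J ≤ j → m ≤ ‖A j‖ := fun j hj => by
    refine le_trans ?_ (hA j hj)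
    exact le_mul_of_one_le_right hm.le (Real.one_le_rpow (one_le_factRatio p j) hτ)
  have hw : ∀ n : ℕ, ∀ j, max K J ≤ j → ‖w n j‖ ≤ C / m / 2 ^ n * D ^ j * (j ! : ℝ) ^ σ := by
    intro n
    induction n with
    | zero =>
      intro j hj
      have h1 := hA1 j ((le_max_right _ _).trans hj)
      change ‖e j / A j‖ ≤ _
      rw [norm_div]
      calc ‖e j‖ / ‖A j‖ ≤ C * D ^ j * (j ! : ℝ) ^ σ / m := by
            gcongr
            exact he j
        _ = _ := by rw [pow_zero]; ring
    | succ n ih =>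
      intro j hj
      rw [pow_succ, ← div_div]
      exact norm_step hm hA hD ((le_max_right _ _).trans hj) (hK j ((le_max_left _ _).trans hj))
        (by positivity) (ih (j + p) (hj.trans (Nat.le_add_right _ _)))
  have hgeo : ∀ j, Summable fun n : ℕ => C / m / 2 ^ n * D ^ j * (j ! : ℝ) ^ σ := fun j => by
    have : (fun n : ℕ => C / m / 2 ^ n * D ^ j * (j ! : ℝ) ^ σ) =
        fun n : ℕ => (1 / 2 : ℝ) ^ n * (C / m * D ^ j * (j ! : ℝ) ^ σ) := by
      funext n
      rw [one_div, inv_pow]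
      ring
    rw [this]
    exact summable_geometric_two.mul_right _
  have hsum : ∀ j, max K J ≤ j → Summable fun n => w n j := fun j hj =>
    (hgeo j).of_norm_bounded fun n => hw n j hj
  refine ⟨fun j => ∑' n, w n j, factGrowth_of_eventually_le hσ0 (C := 2 * (C / m)) (by positivity)
    hD (J := max K J) fun j hj => ?_, max K J, fun j hj => ?_⟩
  · refine (tsum_of_norm_bounded (hgeo j).hasSum fun n => hw n j hj).trans (le_of_eq ?_)
    have : (fun n : ℕ => C / m / 2 ^ n * D ^ j * (j ! : ℝ) ^ σ) =
        fun n : ℕ => (1 / 2 : ℝ) ^ n * (C / m * D ^ j * (j ! : ℝ) ^ σ) := by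
      funext n
      rw [one_div, inv_pow]
      ring
    rw [this, tsum_mul_right, tsum_geometric_two]
    ring
  · have hA0 : A j ≠ 0 := norm_pos_iff.1 (hm.trans_le (hA1 j ((le_max_right _ _).trans hj)))
    have h1 : ∑' n, w n j = e j / A j + (factRatio p j : ℂ) / A j * ∑' n, w n (j + p) := by
      rw [(hsum j hj).tsum_eq_zero_add, ← tsum_mul_left]
      rfl
    simp only
    rw [h1]
    field_simp
    ring

/-- The Neumann solution for the same right-hand side has growth `ρ`. It differs from `x` by a
homogeneous solution of growth `σ < τ - 1`, which is eventually zero. -/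
theorem FactGrowth.of_recurrence_of_lt (hp : 0 < p) (hm : 0 < m)
    (hA : ∀ j, J ≤ j → m * factRatio p j ^ τ ≤ ‖A j‖) (hτ : 0 ≤ τ) {σ ρ : ℝ} (hρ0 : 0 ≤ ρ)
    (hρ : ρ ≤ σ) (hσ : σ < τ - 1) {x : ℕ → ℂ} (hx : FactGrowth σ x)
    (h : FactGrowth ρ fun j => A j * x j - factRatio p j * x (j + p)) : FactGrowth ρ x := by
  obtain ⟨x', hx', K, hK⟩ := exists_solution_of_lt hp hm hA hτ hρ0 (hρ.trans_lt hσ) h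
  have hy : FactGrowth σ fun j => x j + -1 * x' j := by
    refine hx.add ?_
    obtain ⟨C, D, hC, hD, h⟩ := hx'.mono hρ
    exact ⟨C, D, hC, hD, fun j => by simpa using h j⟩
  obtain ⟨L, hL⟩ := eventually_eq_zero_of_recurrence hp hm hA hσ hy (J' := K) fun j hj => by
    linear_combination -hK j hj
  have := hx'.add (factGrowth_of_eventually_eq_zero hρ0 hL)
  refine (funext fun j => ?_ : (fun j => x' j + (x j + -1 * x' j)) = x) ▸ this
  ring

/-- From the critical exponent on, the recurrence is solved forwards: a step multiplies by at most
`M B_j ^ (τ - 1) ≤ M B_j ^ σ`, and `B_j ^ σ` is the increase of `(j!) ^ σ` over the step. No growth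
has to be assumed for `x`. -/
theorem FactGrowth.of_recurrence_of_le (hp : 0 < p) (hM : ∀ j, ‖A j‖ ≤ M * factRatio p j ^ τ)
    {σ : ℝ} (hσ0 : 0 ≤ σ) (hσ : τ - 1 ≤ σ) {x : ℕ → ℂ}
    (h : FactGrowth σ fun j => A j * x j - factRatio p j * x (j + p)) : FactGrowth σ x := by
  obtain ⟨C, D, hC, hD, h⟩ := h
  have hM0 : 0 ≤ M := by
    have := (norm_nonneg _).trans (hM 0)
    exact nonneg_of_mul_nonneg_left this (Real.rpow_pos_of_pos
      (zero_lt_one.trans_le (one_le_factRatio p 0)) _)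
  -- In a step `M` accounts for the term `A_j x_j` and `1` for the right-hand side, so base `M + 1`
  -- suffices.
  set E := max D (M + 1) with hE
  have hE1 : 1 ≤ E := hD.trans (le_max_left _ _)
  set K := C + ∑ j ∈ Finset.range p, ‖x j‖ with hK
  have hs0 : 0 ≤ ∑ j ∈ Finset.range p, ‖x j‖ := by positivity
  have hK0 : 0 ≤ K := by positivity
  refine ⟨K, E, hK0, hE1, fun j => ?_⟩
  induction j using Nat.strong_induction_on with
  | _ j ih =>
    rcases lt_or_ge j p with hj | hj
    · have h1 : ‖x j‖ ≤ ∑ j ∈ Finset.range p, ‖x j‖ :=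
        Finset.single_le_sum (f := fun j => ‖x j‖) (fun _ _ => norm_nonneg _)
          (Finset.mem_range.2 hj)
      have h2 : 1 ≤ E ^ j * (j ! : ℝ) ^ σ :=
        one_le_mul_of_one_le_of_one_le (one_le_pow₀ hE1) (one_le_factorial_rpow hσ0 j)
      rw [mul_assoc]
      nlinarith
    · obtain ⟨i, rfl⟩ : ∃ i, j = i + p := ⟨j - p, by lia⟩
      have hB : 0 < factRatio p i := zero_lt_one.trans_le (one_le_factRatio p i)
      have hi := ih i (by lia)
      have hf : (0 : ℝ) ≤ (i ! : ℝ) ^ σ := by positivity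
      have e : x (i + p) = (A i * x i - (A i * x i - factRatio p i * x (i + p))) /
          (factRatio p i : ℂ) := by
        have : (factRatio p i : ℂ) ≠ 0 := by exact_mod_cast hB.ne'
        field_simp
        ring
      rw [e, norm_div, Complex.norm_real, Real.norm_of_nonneg hB.le, div_le_iff₀ hB]
      have hBσ : factRatio p i ^ τ ≤ factRatio p i ^ σ * factRatio p i := by
        rw [← Real.rpow_add_one hB.ne']
        exact Real.rpow_le_rpow_of_exponent_le (one_le_factRatio p i) (by linarith)
      have h1B : 1 ≤ factRatio p i ^ σ * factRatio p i :=
        one_le_mul_of_one_le_of_one_le (Real.one_le_rpow (one_le_factRatio p i) hσ0)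
          (one_le_factRatio p i)
      set Q := factRatio p i ^ σ * factRatio p i with hQ
      have hCK : C ≤ K := by linarith
      have hEp : E ≤ E ^ p := le_self_pow₀ hE1 hp.ne'
      calc ‖A i * x i - (A i * x i - factRatio p i * x (i + p))‖
          ≤ M * factRatio p i ^ τ * (K * E ^ i * (i ! : ℝ) ^ σ) + C * D ^ i * (i ! : ℝ) ^ σ := by
            refine (norm_sub_le _ _).trans (add_le_add ?_ (h i))
            rw [norm_mul]
            exact mul_le_mul (hM i) hi (norm_nonneg _) ((norm_nonneg _).trans (hM i))
        _ ≤ M * Q * (K * E ^ i * (i ! : ℝ) ^ σ) + K * E ^ i * (i ! : ℝ) ^ σ := by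
            gcongr
            exact le_max_left _ _
        _ ≤ M * Q * (K * E ^ i * (i ! : ℝ) ^ σ) + Q * (K * E ^ i * (i ! : ℝ) ^ σ) :=
          add_le_add le_rfl (le_mul_of_one_le_left (by positivity) h1B)
        _ = (M + 1) * (Q * (K * E ^ i * (i ! : ℝ) ^ σ)) := by ring
        _ ≤ E ^ p * (Q * (K * E ^ i * (i ! : ℝ) ^ σ)) := by
            gcongr
            exact (le_max_right _ _).trans hEp
        _ = K * E ^ (i + p) * ((i + p)! : ℝ) ^ σ * factRatio p i := by
            rw [factorial_add_rpow, pow_add, hQ]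
            ring

/-- The sequence with given initial values and a given recurrence of order `p`. -/
noncomputable def recSeq (p : ℕ) (x₀ : ℕ → ℂ) (g : ℕ → ℂ → ℂ) (j : ℕ) : ℂ :=
  if _h : p = 0 ∨ j < p then x₀ j else g (j - p) (recSeq p x₀ g (j - p))
termination_by j
decreasing_by lia

theorem recSeq_add (hp : 0 < p) (x₀ : ℕ → ℂ) (g : ℕ → ℂ → ℂ) (j : ℕ) :
    recSeq p x₀ g (j + p) = g j (recSeq p x₀ g j) := by
  rw [recSeq, dif_neg (by lia), Nat.add_sub_cancel]

theorem exists_solution (hp : 0 < p) (A e : ℕ → ℂ) :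
    ∃ x : ℕ → ℂ, ∀ j, A j * x j - factRatio p j * x (j + p) = e j := by
  refine ⟨recSeq p 0 fun j y => (A j * y - e j) / factRatio p j, fun j => ?_⟩
  have hB : (factRatio p j : ℂ) ≠ 0 := by
    exact_mod_cast (zero_lt_one.trans_le (one_le_factRatio p j)).ne'
  rw [recSeq_add hp]
  field_simp
  ring

/-- A homogeneous solution that never vanishes from some index on: forward recursion bounds its
growth by the critical one, and subcritical uniqueness excludes anything smaller. -/
theorem exists_solution_not_factGrowth (hp : 0 < p) (hm : 0 < m)
    (hA : ∀ j, J ≤ j → m * factRatio p j ^ τ ≤ ‖A j‖)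
    (hM : ∀ j, ‖A j‖ ≤ M * factRatio p j ^ τ) (hτ : 1 ≤ τ) :
    ∃ x, FactGrowth (τ - 1) x ∧ (∃ K, ∀ j, K ≤ j → A j * x j - factRatio p j * x (j + p) = 0) ∧
      ∀ ρ, ρ < τ - 1 → ¬ FactGrowth ρ x := by
  let z := recSeq p (fun _ => 1) fun j y => A (J + j) * y / factRatio p (J + j)
  have hB : ∀ j, (factRatio p j : ℂ) ≠ 0 := fun j => by
    exact_mod_cast (zero_lt_one.trans_le (one_le_factRatio p j)).ne'
  have hA0 : ∀ j, J ≤ j → A j ≠ 0 := fun j hj =>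
    norm_pos_iff.1 ((mul_pos hm (Real.rpow_pos_of_pos
      (zero_lt_one.trans_le (one_le_factRatio p j)) _)).trans_le (hA j hj))
  have hz : ∀ j, z (j + p) = A (J + j) * z j / factRatio p (J + j) := recSeq_add hp _ _
  have hz0 : ∀ j, z j ≠ 0 := by
    intro j
    induction j using Nat.strong_induction_on with
    | _ j ih =>
      rcases lt_or_ge j p with hj | hj
      · have : z j = 1 := by
          change recSeq _ _ _ _ = _
          rw [recSeq, dif_pos (Or.inr hj)]
        rw [this]
        exact one_ne_zero
      · obtain ⟨i, rfl⟩ : ∃ i, j = i + p := ⟨j - p, by lia⟩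
        rw [hz]
        exact div_ne_zero (mul_ne_zero (hA0 _ (Nat.le_add_right _ _)) (ih i (by lia))) (hB _)
  -- The recursion starts at `J`, beyond which no `A_j` vanishes; below `J` the recurrence may fail,
  -- which affects only finitely many terms.
  let x : ℕ → ℂ := fun j => if J ≤ j then z (j - J) else 0
  have hx : ∀ j, J ≤ j → A j * x j - factRatio p j * x (j + p) = 0 := by
    intro j hj
    obtain ⟨i, rfl⟩ : ∃ i, j = J + i := ⟨j - J, by lia⟩
    simp only [x]
    rw [if_pos hj, if_pos (by lia), show J + i + p - J = i + p by lia, hz,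
      show J + i - J = i by lia]
    have := hB (J + i)
    field_simp
    ring
  refine ⟨x, .of_recurrence_of_le hp hM (by linarith) le_rfl
    (factGrowth_of_eventually_eq_zero (by linarith) hx), ⟨J, hx⟩, fun ρ hρ h => ?_⟩
  obtain ⟨K, hK⟩ := eventually_eq_zero_of_recurrence hp hm hA hρ h hx
  have := hK (J + K) (by lia)
  simp only [x] at this
  rw [if_pos (by lia)] at this
  exact hz0 _ this

end

/-! ### The recurrence of the hypergeometric system -/

/-- The coefficient of the `j`-th term in the recurrence of the toric operator on the solutions
of the Euler operator near `(c, 0)`. -/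
noncomputable def hgCoeff (a b : ℕ) (γ c : ℂ) (j : ℕ) : ℂ :=
  c⁻¹ ^ (b / a.gcd b) * ∏ i ∈ Finset.range (b / a.gcd b), ((γ - b * j) / a - i)

section

variable {a b : ℕ} (γ : ℂ) {c : ℂ}

theorem mul_div_gcd (a b : ℕ) : b * (a / a.gcd b) = a * (b / a.gcd b) := by
  rw [← Nat.mul_div_assoc _ (a.gcd_dvd_left b), ← Nat.mul_div_assoc _ (a.gcd_dvd_right b), mul_comm]

theorem div_gcd_pos (ha : 0 < a) : 0 < a / a.gcd b :=
  Nat.div_pos (Nat.le_of_dvd ha (a.gcd_dvd_left b)) (Nat.gcd_pos_of_pos_left _ ha)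

theorem pow_rpow_slope (ha : 0 < a) {x : ℝ} (hx : 0 ≤ x) :
    (x ^ (a / a.gcd b)) ^ ((b : ℝ) / a) = x ^ (b / a.gcd b) := by
  have ha' : (a : ℝ) ≠ 0 := by exact_mod_cast ha.ne'
  rw [← Real.rpow_natCast, ← Real.rpow_natCast, ← Real.rpow_mul hx]
  congr 1
  rw [mul_div_assoc', div_eq_iff ha']
  have := mul_div_gcd a b
  have h2 : (b : ℝ) * (a / a.gcd b : ℕ) = a * (b / a.gcd b : ℕ) := by exact_mod_cast this
  linear_combination h2

/-- The origin of the slope: the coefficient is a product of `b / d` factors of size `j`, whereas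
`(j + p)! / j!` has `p = a / d` such factors, so the exponent relating them is `b / a`. -/
theorem hgCoeff_bounds (ha : 0 < a) (hab : a < b) (hc : c ≠ 0) : ∃ (m M : ℝ) (J : ℕ), 0 < m ∧
    (∀ j, J ≤ j → m * factRatio (a / a.gcd b) j ^ ((b : ℝ) / a) ≤ ‖hgCoeff a b γ c j‖) ∧
    ∀ j, ‖hgCoeff a b γ c j‖ ≤ M * factRatio (a / a.gcd b) j ^ ((b : ℝ) / a) := by
  set p := a / a.gcd b with hp
  set q := b / a.gcd b with hq
  have ha' : (0 : ℝ) < a := by exact_mod_cast ha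
  have hτ : 0 ≤ (b : ℝ) / a := by positivity
  have hτ1 : 1 ≤ (b : ℝ) / a := by
    rw [le_div_iff₀ ha', one_mul]
    exact_mod_cast hab.le
  set K : ℝ := ‖γ‖ / a + q with hK
  have hK0 : 0 ≤ K := by positivity
  set κ : ℝ := ‖c⁻¹ ^ q‖ with hκ
  have hκ0 : 0 < κ := norm_pos_iff.2 (pow_ne_zero _ (inv_ne_zero hc))
  have hnorm : ∀ j, ‖hgCoeff a b γ c j‖ =
      κ * ∏ i ∈ Finset.range q, ‖(γ - b * j) / a - i‖ := fun j => by
    rw [hgCoeff, norm_mul, norm_prod]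
  have hlin : ∀ j : ℕ, ‖(b * j : ℂ) / a‖ = (b : ℝ) / a * j := fun j => by
    rw [norm_div, norm_mul, Complex.norm_natCast, Complex.norm_natCast, Complex.norm_natCast]
    ring
  have hrest : ∀ i ∈ Finset.range q, ‖γ / a - i‖ ≤ K := fun i hi => by
    refine (norm_sub_le _ _).trans ?_
    rw [norm_div, Complex.norm_natCast, Complex.norm_natCast, hK]
    have : (i : ℝ) ≤ q := by exact_mod_cast (Finset.mem_range.1 hi).le
    linarith
  have hsplit : ∀ (j i : ℕ), (γ - b * j) / a - i = (γ / a - i) - (b * j : ℂ) / a := fun j i => by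
    ring
  -- For `j` past this threshold `j + p ≤ 2 j` and `K ≤ j / 2`, so every factor is at least `j - j /
  -- 2`; the constant `1 / 4` is the quotient of `j / 2` by `2 j`.
  refine ⟨κ * (1 / 4) ^ q, κ * ((b : ℝ) / a + K) ^ q, max p ⌈2 * K⌉₊, by positivity,
    fun j hj => ?_, fun j => ?_⟩
  · rw [hnorm, mul_assoc]
    refine mul_le_mul_of_nonneg_left ?_ hκ0.le
    have hjp : (p : ℝ) ≤ j := by exact_mod_cast (le_max_left _ _).trans hj
    have hjK : 2 * K ≤ j := (Nat.le_ceil _).trans (by exact_mod_cast (le_max_right _ _).trans hj)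
    have h1 : factRatio p j ^ ((b : ℝ) / a) ≤ (2 * j : ℝ) ^ q := by
      rw [← pow_rpow_slope (a := a) (b := b) ha (by positivity)]
      refine Real.rpow_le_rpow (zero_le_one.trans (one_le_factRatio p j))
        ((factRatio_le_pow p j).trans ?_) hτ
      rw [← hp]
      gcongr
      push_cast
      linarith
    calc (1 / 4 : ℝ) ^ q * factRatio p j ^ ((b : ℝ) / a) ≤ (1 / 4 : ℝ) ^ q * (2 * j : ℝ) ^ q := by
          gcongr
      _ = ∏ i ∈ Finset.range q, (j / 2 : ℝ) := by
          rw [← mul_pow, Finset.prod_const, Finset.card_range]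
          ring
      _ ≤ _ := by
          refine Finset.prod_le_prod (fun _ _ => by positivity) fun i hi => ?_
          have h2 : ‖(b * j : ℂ) / a‖ - ‖γ / a - i‖ ≤ ‖(γ - b * j) / a - i‖ := by
            rw [hsplit, norm_sub_rev (γ / a - i)]
            exact norm_sub_norm_le _ _
          refine le_trans ?_ h2
          rw [hlin]
          have h3 := hrest i hi
          have : (j : ℝ) ≤ (b : ℝ) / a * j := le_mul_of_one_le_left (by positivity) hτ1
          linarith
  · rw [hnorm, mul_assoc]
    refine mul_le_mul_of_nonneg_left ?_ hκ0.le
    have h1 : ((j + 1 : ℕ) : ℝ) ^ q ≤ factRatio p j ^ ((b : ℝ) / a) := by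
      rw [← pow_rpow_slope (a := a) (b := b) ha (by positivity)]
      exact Real.rpow_le_rpow (by positivity) (pow_le_factRatio p j) hτ
    calc ∏ i ∈ Finset.range q, ‖(γ - b * j) / a - i‖
        ≤ ∏ i ∈ Finset.range q, (((b : ℝ) / a + K) * ((j + 1 : ℕ) : ℝ)) := by
          refine Finset.prod_le_prod (fun _ _ => norm_nonneg _) fun i hi => ?_
          rw [hsplit]
          refine (norm_sub_le _ _).trans ?_
          rw [hlin]
          have h3 := hrest i hi
          push_cast
          nlinarith [mul_nonneg hK0 (Nat.cast_nonneg j : (0 : ℝ) ≤ j)]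
      _ = ((b : ℝ) / a + K) ^ q * ((j + 1 : ℕ) : ℝ) ^ q := by
          rw [Finset.prod_const, Finset.card_range, mul_pow]
      _ ≤ _ := by gcongr

/-- Sequences of Gevrey order `r`. -/
def SeqGevrey (r : ℝ≥0∞) (x : ℕ → ℂ) : Prop := r = ⊤ ∨ FactGrowth (r.toReal - 1) x

/-- The operator on sequences of the hypergeometric recurrence. -/
noncomputable def hgRec (a b : ℕ) (γ c : ℂ) (x : ℕ → ℂ) (j : ℕ) : ℂ :=
  hgCoeff a b γ c j * x j - factRatio (a / a.gcd b) j * x (j + a / a.gcd b)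

theorem slope_toReal : ((b : ℝ≥0∞) / a).toReal = (b : ℝ) / a := by
  rw [ENNReal.toReal_div]; simp

theorem slope_ne_top (ha : 0 < a) : (b : ℝ≥0∞) / a ≠ ⊤ :=
  ENNReal.div_ne_top (ENNReal.natCast_ne_top b) (by exact_mod_cast ha.ne')

theorem toReal_sub_one_nonneg {r : ℝ≥0∞} (hr : 1 ≤ r) (hr' : r ≠ ⊤) : 0 ≤ r.toReal - 1 := by
  have := ENNReal.toReal_mono hr' hr
  simp only [ENNReal.toReal_one] at this
  linarith

/-- Solvability holds on both sides of the slope, backwards below it and forwards from it on; it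
will give concentration in degree zero for every order. -/
theorem SeqGevrey.exists_hgRec_eq (ha : 0 < a) (hab : a < b) (hc : c ≠ 0) {r : ℝ≥0∞} (hr : 1 ≤ r) {e : ℕ → ℂ} (he : SeqGevrey r e) :
    ∃ x, SeqGevrey r x ∧ ∃ K, ∀ j, K ≤ j → hgRec a b γ c x j = e j := by
  obtain ⟨m, M, J, hm, hA, hM⟩ := hgCoeff_bounds γ ha hab hc
  have hp : 0 < a / a.gcd b := div_gcd_pos ha
  rcases he with rfl | he
  · obtain ⟨x, hx⟩ := exists_solution hp (hgCoeff a b γ c) e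
    exact ⟨x, Or.inl rfl, 0, fun j _ => hx j⟩
  · by_cases hr' : r = ⊤
    · obtain ⟨x, hx⟩ := exists_solution hp (hgCoeff a b γ c) e
      exact ⟨x, Or.inl hr', 0, fun j _ => hx j⟩
    have h0 := toReal_sub_one_nonneg hr hr'
    rcases lt_or_ge (r.toReal - 1) ((b : ℝ) / a - 1) with h | h
    · obtain ⟨x, hx, hK⟩ := exists_solution_of_lt hp hm hA (by positivity) h0 h he
      exact ⟨x, Or.inr hx, hK⟩
    · obtain ⟨x, hx⟩ := exists_solution hp (hgCoeff a b γ c) e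
      refine ⟨x, Or.inr (.of_recurrence_of_le hp hM h0 h ?_), 0, fun j _ => hx j⟩
      simpa only [hx] using he

/-- Regularity as long as the slope does not lie in the interval from `r` (excluded) to `s`
(included). This is the numerical source of the gap condition. -/
theorem SeqGevrey.of_hgRec (ha : 0 < a) (hab : a < b) (hc : c ≠ 0) {r s : ℝ≥0∞} (hr : 1 ≤ r) (hrs : r ≤ s)
    (h : s < (b : ℝ≥0∞) / a ∨ (b : ℝ≥0∞) / a ≤ r) {x : ℕ → ℂ} (hx : SeqGevrey s x)
    (hRx : SeqGevrey r (hgRec a b γ c x)) : SeqGevrey r x := by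
  obtain ⟨m, M, J, hm, hA, hM⟩ := hgCoeff_bounds γ ha hab hc
  have hp : 0 < a / a.gcd b := div_gcd_pos ha
  rcases hRx with hr' | hRx
  · exact Or.inl hr'
  by_cases hr' : r = ⊤
  · exact Or.inl hr'
  have h0 := toReal_sub_one_nonneg hr hr'
  rcases h with h | h
  · have hs : s ≠ ⊤ := ne_top_of_lt h
    rcases hx with hx | hx
    · exact absurd hx hs
    have h1 := (ENNReal.toReal_lt_toReal hs (slope_ne_top ha)).2 h
    rw [slope_toReal] at h1
    have h2 := ENNReal.toReal_mono hs hrs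
    exact Or.inr (.of_recurrence_of_lt hp hm hA (by positivity) h0 (by linarith) (by linarith) hx
      hRx)
  · have h1 := ENNReal.toReal_mono hr' h
    rw [slope_toReal] at h1
    exact Or.inr (.of_recurrence_of_le hp hM h0 (by linarith) hRx)

theorem exists_hgRec_eq_zero (ha : 0 < a) (hab : a < b) (hc : c ≠ 0) : ∃ x, SeqGevrey ((b : ℝ≥0∞) / a) x ∧
    (∃ K, ∀ j, K ≤ j → hgRec a b γ c x j = 0) ∧
    ∀ r, r < (b : ℝ≥0∞) / a → ¬ SeqGevrey r x := by
  obtain ⟨m, M, J, hm, hA, hM⟩ := hgCoeff_bounds γ ha hab hc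
  have hp : 0 < a / a.gcd b := div_gcd_pos ha
  have ha' : (0 : ℝ) < a := by exact_mod_cast ha
  have hτ1 : 1 ≤ (b : ℝ) / a := by
    rw [le_div_iff₀ ha', one_mul]
    exact_mod_cast hab.le
  obtain ⟨x, hx, hK, hx'⟩ := exists_solution_not_factGrowth hp hm hA hM hτ1
  refine ⟨x, Or.inr (by rwa [slope_toReal]), hK, fun r hr h => ?_⟩
  rcases h with h | h
  · exact (ne_top_of_lt hr) h
  · have h1 := (ENNReal.toReal_lt_toReal (ne_top_of_lt hr) (slope_ne_top ha)).2 hr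
    rw [slope_toReal] at h1
    exact hx' _ (by linarith) h

end

/-! ### Formal power series along `Y` and their coefficients -/

/-- The ball of radius `R` around `(c, 0)`. -/
def polydisc (c : ℂ) (R : ℝ) : Opens X := ⟨Metric.ball ((c, 0) : ℂ × ℂ) R, Metric.isOpen_ball⟩

theorem mem_polydisc {c z : ℂ} {R : ℝ} :
    ((z, 0) : ℂ × ℂ) ∈ polydisc c R ↔ z ∈ Metric.ball c R := by
  change ((z, 0) : ℂ × ℂ) ∈ Metric.ball ((c, 0) : ℂ × ℂ) R ↔ _
  rw [Metric.mem_ball, Metric.mem_ball, Prod.dist_eq, dist_self, max_eq_left dist_nonneg]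

theorem slice_polydisc (c : ℂ) (R : ℝ) :
    {z : ℂ | ((z, 0) : ℂ × ℂ) ∈ polydisc c R} = Metric.ball c R := Set.ext fun _ => mem_polydisc

theorem center_mem_polydisc {c : ℂ} {R : ℝ} (hR : 0 < R) : ((c, 0) : ℂ × ℂ) ∈ polydisc c R :=
  mem_polydisc.2 (Metric.mem_ball_self hR)

theorem polydisc_le {c : ℂ} {R R' : ℝ} (h : R ≤ R') : polydisc c R ≤ polydisc c R' :=
  Metric.ball_subset_ball h

theorem exists_polydisc_le {c : ℂ} {U : Opens X} (hc : ((c, 0) : ℂ × ℂ) ∈ U) :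
    ∃ R, 0 < R ∧ polydisc c R ≤ U := by
  obtain ⟨R, hR, h⟩ := Metric.isOpen_iff.1 U.2 _ hc
  exact ⟨R, hR, h⟩

open Classical in
/-- The family of Taylor series of `∑ f_j(x₁) x₂ ^ j` at the points of `V` on `Y`. -/
noncomputable def ofCoefs (V : Opens X) (f : ℕ → ℂ → ℂ) : V → Ger := fun p =>
  if p.1.2 = 0 then mkGer fun i j => iteratedDeriv i (f j) p.1.1 / i ! else 0

section

variable {V : Opens X} {f g : ℕ → ℂ → ℂ}

theorem cf_ofCoefs {z : ℂ} (hz : ((z, 0) : ℂ × ℂ) ∈ V) (i j : ℕ) :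
    cf i j (ofCoefs V f ⟨(z, 0), hz⟩) = iteratedDeriv i (f j) z / i ! := by
  simp [ofCoefs]

theorem cf_zero_ofCoefs {z : ℂ} (hz : ((z, 0) : ℂ × ℂ) ∈ V) (j : ℕ) :
    cf 0 j (ofCoefs V f ⟨(z, 0), hz⟩) = f j z :=
  (cf_ofCoefs hz 0 j).trans (by simp)

theorem isFormal_ofCoefs (hf : ∀ j, DifferentiableOn ℂ (f j) {z | ((z, 0) : ℂ × ℂ) ∈ V}) :
    IsFormal V (ofCoefs V f) := by
  refine ⟨fun p hp => if_neg hp, f, hf, ?_⟩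
  rintro ⟨⟨z, w⟩, hp⟩ hw i j
  obtain rfl : w = 0 := hw
  exact cf_ofCoefs hp i j

theorem IsFormal.exists_eq_ofCoefs {s : V → Ger} (hs : IsFormal V s) :
    ∃ f : ℕ → ℂ → ℂ, (∀ j, DifferentiableOn ℂ (f j) {z | ((z, 0) : ℂ × ℂ) ∈ V}) ∧
      s = ofCoefs V f := by
  obtain ⟨h0, f, hf, h⟩ := hs
  refine ⟨f, hf, funext fun p => ?_⟩
  by_cases hp : p.1.2 = 0
  · refine ger_ext fun i j => ?_
    rw [h p hp]
    simp [ofCoefs, hp]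
  · rw [h0 p hp, ofCoefs, if_neg hp]

theorem ofCoefs_congr (h : ∀ z, ((z, 0) : ℂ × ℂ) ∈ V → ∀ j, f j z = g j z) :
    ofCoefs V f = ofCoefs V g := by
  funext ⟨⟨z, w⟩, hp⟩
  by_cases hw : w = 0
  · subst hw
    refine ger_ext fun i j => ?_
    have : f j =ᶠ[nhds z] g j := by
      filter_upwards [(isOpen_slice V).mem_nhds hp] with w hw using h w hw j
    rw [cf_ofCoefs, cf_ofCoefs, this.iteratedDeriv_eq]
  · rw [ofCoefs, ofCoefs, if_neg hw, if_neg hw]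

/-- The coefficients with `i > 0` are derivatives of the functions `f_j`, so comparing the `f_j` is
enough. -/
theorem IsFormal.ext_cf_zero {s t : V → Ger} (hs : IsFormal V s) (ht : IsFormal V t)
    (h : ∀ (z : ℂ) (hz : ((z, 0) : ℂ × ℂ) ∈ V) (j : ℕ),
      cf 0 j (s ⟨(z, 0), hz⟩) = cf 0 j (t ⟨(z, 0), hz⟩)) : s = t := by
  obtain ⟨f, -, rfl⟩ := hs.exists_eq_ofCoefs
  obtain ⟨g, -, rfl⟩ := ht.exists_eq_ofCoefs
  refine ofCoefs_congr fun z hz j => ?_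
  exact (cf_zero_ofCoefs hz j).symm.trans ((h z hz j).trans (cf_zero_ofCoefs hz j))

/-- The sheaf of all formal power series along `Y`. -/
theorem gevrey_top_pred {U : Opens X} {s : U → Ger} :
    (gevrey ⟨⊤, Set.mem_Ici.2 le_top⟩).pred U s ↔ IsFormal U s :=
  ⟨fun h => h.1, fun h => ⟨h, fun _ => Or.inl rfl⟩⟩

theorem IsFormal.act {U : Opens X} {s : U → Ger} (hs : IsFormal U s) (T : DOp U) :
    IsFormal U (act T s) := ((gevrey ⟨⊤, Set.mem_Ici.2 le_top⟩).act_pred T (gevrey_top_pred.2 hs)).1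

theorem IsFormal.sub {U : Opens X} {s t : U → Ger} (hs : IsFormal U s) (ht : IsFormal U t) :
    IsFormal U (s - t) := by
  rw [sub_eq_add_neg]
  exact hs.add ht.neg

theorem ofCoefs_sub (hf : ∀ j, DifferentiableOn ℂ (f j) {z | ((z, 0) : ℂ × ℂ) ∈ V})
    (hg : ∀ j, DifferentiableOn ℂ (g j) {z | ((z, 0) : ℂ × ℂ) ∈ V}) :
    ofCoefs V f - ofCoefs V g = ofCoefs V fun j z => f j z - g j z := by
  refine ((isFormal_ofCoefs hf).sub (isFormal_ofCoefs hg)).ext_cf_zero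
    (isFormal_ofCoefs fun j => (hf j).sub (hg j)) fun z hz j => ?_
  rw [Pi.sub_apply, map_sub, cf_zero_ofCoefs, cf_zero_ofCoefs, cf_zero_ofCoefs]

theorem cf_d1_pow (g : Ger) (n j : ℕ) : cf 0 j ((d1 ^ n) g) = n ! * cf n j g := by
  have h : ∀ i, cf i j ((d1 ^ n) g) * i ! = (i + n)! * cf (i + n) j g := by
    induction n generalizing g with
    | zero => intro i; simp [mul_comm]
    | succ n ih =>
      intro i
      rw [pow_succ, Module.End.mul_apply, ih, cf_d1, ← add_assoc, Nat.factorial_succ]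
      push_cast
      ring
  simpa using h 0

theorem cf_d2_pow (g : Ger) (i n j : ℕ) :
    cf i j ((d2 ^ n) g) = factRatio n j * cf i (j + n) g := by
  have h : cf i j ((d2 ^ n) g) * j ! = (j + n)! * cf i (j + n) g := by
    induction n generalizing g with
    | zero => simp [mul_comm]
    | succ n ih =>
      rw [pow_succ, Module.End.mul_apply, ih, cf_d2, ← add_assoc, Nat.factorial_succ]
      push_cast
      ring
  have hj : (j ! : ℂ) ≠ 0 := by exact_mod_cast j.factorial_ne_zero
  rw [factRatio]
  push_cast
  field_simp
  linear_combination h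

theorem cf_eulerAt (a b : ℕ) (γ z : ℂ) (g : Ger) (i j : ℕ) :
    cf i j (eulerAt a b γ (z, 0) g) =
      a * z * ((i + 1) * cf (i + 1) j g) + (a * i + b * j - γ) * cf i j g := by
  simp only [eulerAt, LinearMap.sub_apply, LinearMap.add_apply, LinearMap.smul_apply,
    Module.End.mul_apply, LinearMap.mulLeft_apply, map_sub, map_add, map_smul, smul_eq_mul,
    Module.algebraMap_end_apply, cf_taylor_fst_mul, cf_taylor_snd_mul]
  rcases i with - | i <;> rcases j with - | j <;> simp <;> ring

/-- Along `Y` the operator `x₂ ∂₂` is multiplication by `j`: the Euler operator is diagonal in `j`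
and reduces to first-order equations in one variable. -/
theorem act_opE_ofCoefs (a b : ℕ) (γ : ℂ)
    (hf : ∀ j, DifferentiableOn ℂ (f j) {z | ((z, 0) : ℂ × ℂ) ∈ V}) :
    act (opE a b γ V) (ofCoefs V f) =
      ofCoefs V fun j z => a * z * deriv (f j) z + (b * j - γ) * f j z := by
  refine ((isFormal_ofCoefs hf).act _).ext_cf_zero (isFormal_ofCoefs fun j => ?_)
    fun z hz j => ?_
  · have := (hf j).deriv (isOpen_slice V)
    fun_prop
  · rw [cf_zero_ofCoefs]
    refine (cf_eulerAt a b γ z (ofCoefs V f ⟨(z, 0), hz⟩) 0 j).trans ?_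
    rw [cf_zero_ofCoefs, cf_ofCoefs]
    simp

theorem act_opP_ofCoefs (a b : ℕ)
    (hf : ∀ j, DifferentiableOn ℂ (f j) {z | ((z, 0) : ℂ × ℂ) ∈ V}) :
    act (opP a b V) (ofCoefs V f) = ofCoefs V fun j z =>
      iteratedDeriv (b / a.gcd b) (f j) z -
        factRatio (a / a.gcd b) j * f (j + a / a.gcd b) z := by
  refine ((isFormal_ofCoefs hf).act _).ext_cf_zero (isFormal_ofCoefs fun j => ?_)
    fun z hz j => ?_
  · have h1 : DifferentiableOn ℂ (iteratedDeriv (b / a.gcd b) (f j))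
        {z | ((z, 0) : ℂ × ℂ) ∈ V} := by
      rw [iteratedDeriv_eq_iterate]
      exact (((hf j).analyticOnNhd (isOpen_slice V)).iterated_deriv _).differentiableOn
    have h2 := hf (j + a / a.gcd b)
    fun_prop
  · rw [cf_zero_ofCoefs]
    change cf 0 j ((d1 ^ (b / a.gcd b) - d2 ^ (a / a.gcd b)) (ofCoefs V f ⟨(z, 0), hz⟩)) = _
    rw [LinearMap.sub_apply, map_sub, cf_d1_pow, cf_d2_pow, cf_zero_ofCoefs, cf_ofCoefs]
    have : ((b / a.gcd b)! : ℂ) ≠ 0 := by exact_mod_cast Nat.factorial_ne_zero _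
    field_simp

end

/-! ### Estimates -/

/-- Bounds of Gevrey order `r` on `S`. -/
def GevBound (r : ℝ≥0∞) (S : Set ℂ) (f : ℕ → ℂ → ℂ) : Prop :=
  r = ⊤ ∨ ∃ C D : ℝ, 0 ≤ C ∧ 1 ≤ D ∧
    ∀ j, ∀ z ∈ S, ‖f j z‖ ≤ C * D ^ j * (j ! : ℝ) ^ (r.toReal - 1)

theorem norm_iteratedDeriv_div_le {f : ℂ → ℂ} {c : ℂ} {R ρ M : ℝ} (hρ : 0 < ρ) (hR : ρ < R)
    (hf : DifferentiableOn ℂ f (Metric.ball c R)) (hM : ∀ z ∈ Metric.ball c R, ‖f z‖ ≤ M)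
    (n : ℕ) : ‖iteratedDeriv n f c / (n ! : ℂ)‖ ≤ M / ρ ^ n := by
  have h := Complex.norm_iteratedDeriv_le_of_forall_mem_sphere_norm_le (c := c) (f := f) n hρ
    ((hf.mono (Metric.closedBall_subset_ball hR)).diffContOnCl_ball le_rfl)
    fun z hz => hM z (Metric.sphere_subset_closedBall.trans (Metric.closedBall_subset_ball hR) hz)
  have hn : (0 : ℝ) < n ! := by exact_mod_cast n.factorial_pos
  rw [norm_div, Complex.norm_natCast, div_le_iff₀ hn]
  exact h.trans (le_of_eq (by ring))

/-- Cauchy's estimates turn bounds for the `f_j` on a disc into bounds for all Taylor coefficients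
at its points. -/
theorem gevrey_pred_ofCoefs {r : ℝ≥0∞} (hr : 1 ≤ r) {c : ℂ} {R : ℝ} {f : ℕ → ℂ → ℂ}
    (hf : ∀ j, DifferentiableOn ℂ (f j) (Metric.ball c R))
    (hb : GevBound r (Metric.ball c R) f) :
    (gevrey ⟨r, hr⟩).pred (polydisc c R) (ofCoefs _ f) := by
  refine ⟨isFormal_ofCoefs (by rwa [slice_polydisc]), ?_⟩
  rintro ⟨⟨z, w⟩, hp⟩
  by_cases hw : w = 0
  · subst hw
    rcases hb with hr' | ⟨C, D, hC, hD, hb⟩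
    · exact Or.inl hr'
    by_cases hr' : r = ⊤
    · exact Or.inl hr'
    have hz := mem_polydisc.1 hp
    obtain ⟨ρ', hρ', hsub⟩ := Metric.isOpen_iff.1 Metric.isOpen_ball z hz
    have hρ : 0 < ρ' / 2 := by positivity
    refine (isGevrey_iff hr').2 ⟨C, max D (ρ' / 2)⁻¹, hC, hD.trans (le_max_left _ _),
      fun i j => ?_⟩
    rw [cf_ofCoefs]
    refine (norm_iteratedDeriv_div_le hρ (half_lt_self hρ') ((hf j).mono hsub)
      (fun u hu => hb j u (hsub hu)) i).trans ?_
    rw [div_eq_mul_inv, ← inv_pow]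
    calc C * D ^ j * (j ! : ℝ) ^ (r.toReal - 1) * (ρ' / 2)⁻¹ ^ i
        ≤ C * max D (ρ' / 2)⁻¹ ^ j * (j ! : ℝ) ^ (r.toReal - 1) * max D (ρ' / 2)⁻¹ ^ i := by
          gcongr
          · exact le_max_left _ _
          · exact le_max_right _ _
      _ = _ := by rw [pow_add]; ring
  · have : ofCoefs (polydisc c R) f ⟨(z, w), hp⟩ = 0 := if_neg hw
    rw [this]
    exact .zero _

/-- Converse of the Cauchy estimates: the Gevrey condition at a single point already bounds the
`f_j` uniformly on a disc around it. -/
theorem exists_local_ofCoefs {U : Opens X} {s : U → Ger} (hs : IsFormal U s) {c : ℂ}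
    (hc : ((c, 0) : ℂ × ℂ) ∈ U) {r : ℝ≥0∞} (hg : IsGevrey r (s ⟨(c, 0), hc⟩)) {ε : ℝ}
    (hε : 0 < ε) : ∃ R, 0 < R ∧ R ≤ ε ∧ ∃ (k : polydisc c R ≤ U) (f : ℕ → ℂ → ℂ),
      (∀ j, DifferentiableOn ℂ (f j) (Metric.ball c R)) ∧ GevBound r (Metric.ball c R) f ∧
      res k s = ofCoefs _ f := by
  obtain ⟨R₀, hR₀, hk⟩ := exists_polydisc_le hc
  obtain ⟨f, hf, rfl⟩ := hs.exists_eq_ofCoefs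
  have hf' : ∀ j, DifferentiableOn ℂ (f j) (Metric.ball c R₀) := fun j =>
    (hf j).mono fun z hz => hk (mem_polydisc.2 hz)
  by_cases hr : r = ⊤
  · refine ⟨min R₀ ε, lt_min hR₀ hε, min_le_right _ _,
      (polydisc_le (min_le_left _ _)).trans hk, f,
      fun j => (hf' j).mono (Metric.ball_subset_ball (min_le_left _ _)), Or.inl hr, rfl⟩
  obtain ⟨C, D, hC, hD, hb⟩ := (isGevrey_iff hr).1 hg
  have hD0 : 0 < D := by linarith
  -- With `|z - c| ≤ 1 / (2 D)` the Taylor series of every `f_j` is dominated by a geometric series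
  -- of ratio `1 / 2`, whence the constant `2 C`.
  set R := min (min R₀ ε) (2 * D)⁻¹ with hR
  have hRR₀ : R ≤ R₀ := (min_le_left _ _).trans (min_le_left _ _)
  refine ⟨R, lt_min (lt_min hR₀ hε) (by positivity), (min_le_left _ _).trans (min_le_right _ _),
    (polydisc_le hRR₀).trans hk, f,
    fun j => (hf' j).mono (Metric.ball_subset_ball hRR₀), Or.inr ⟨2 * C, D, by positivity, hD,
    fun j z hz => ?_⟩, rfl⟩
  have hsum := Complex.hasSum_taylorSeries_on_ball (hf' j) (Metric.ball_subset_ball hRR₀ hz)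
  have hzD : ‖z - c‖ ≤ (2 * D)⁻¹ := by
    have := Metric.mem_ball.1 hz
    rw [dist_eq_norm] at this
    exact this.le.trans (min_le_right _ _)
  have hj : (0 : ℝ) ≤ (j ! : ℝ) ^ (r.toReal - 1) := by positivity
  have hgeo : HasSum (fun n : ℕ => C * D ^ j * (j ! : ℝ) ^ (r.toReal - 1) * (1 / 2 : ℝ) ^ n)
      (C * D ^ j * (j ! : ℝ) ^ (r.toReal - 1) * 2) := hasSum_geometric_two.mul_left _
  rw [← hsum.tsum_eq]
  refine (tsum_of_norm_bounded hgeo fun n => ?_).trans (le_of_eq (by ring))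
  have h1 := hb n j
  rw [cf_ofCoefs] at h1
  have e : ((n ! : ℂ)⁻¹ • (z - c) ^ n • iteratedDeriv n (f j) c) =
      iteratedDeriv n (f j) c / (n ! : ℂ) * (z - c) ^ n := by
    rw [smul_eq_mul, smul_eq_mul, div_eq_mul_inv]
    ring
  rw [e, norm_mul, norm_pow]
  calc ‖iteratedDeriv n (f j) c / (n ! : ℂ)‖ * ‖z - c‖ ^ n
      ≤ C * D ^ (n + j) * (j ! : ℝ) ^ (r.toReal - 1) * (2 * D)⁻¹ ^ n := by gcongr
    _ = C * D ^ j * (j ! : ℝ) ^ (r.toReal - 1) * (D * (2 * D)⁻¹) ^ n := by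
        rw [pow_add, mul_pow]; ring
    _ = _ := by congr 2; field_simp

/-- Families of power series of bounded degree in `t₂`. -/
def FinSupp {U : Opens X} (s : U → Ger) : Prop := ∃ J, ∀ p, ∀ i j, J ≤ j → cf i j (s p) = 0

theorem FinSupp.sub {U : Opens X} {s t : U → Ger} (hs : FinSupp s) (ht : FinSupp t) :
    FinSupp (s - t) := by
  obtain ⟨J, hJ⟩ := hs
  obtain ⟨K, hK⟩ := ht
  refine ⟨max J K, fun p i j hj => ?_⟩
  rw [Pi.sub_apply, map_sub, hJ p i j ((le_max_left _ _).trans hj),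
    hK p i j ((le_max_right _ _).trans hj), sub_zero]

theorem FinSupp.res {U V : Opens X} (k : V ≤ U) {s : U → Ger} (hs : FinSupp s) :
    FinSupp (res k s) := by
  obtain ⟨J, hJ⟩ := hs
  exact ⟨J, fun p => hJ _⟩

theorem finSupp_ofCoefs {V : Opens X} {f : ℕ → ℂ → ℂ} {J : ℕ}
    (h : ∀ j, J ≤ j → ∀ z, ((z, 0) : ℂ × ℂ) ∈ V → f j z = 0) : FinSupp (ofCoefs V f) := by
  refine ⟨J, ?_⟩
  rintro ⟨⟨z, w⟩, hp⟩ i j hj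
  by_cases hw : w = 0
  · subst hw
    have : f j =ᶠ[nhds z] fun _ => 0 := by
      filter_upwards [(isOpen_slice V).mem_nhds hp] with w hw using h j hj w hw
    rw [cf_ofCoefs, this.iteratedDeriv_eq]
    rcases i with - | i <;> simp
  · have : ofCoefs V f ⟨(z, w), hp⟩ = 0 := if_neg hw
    rw [this, map_zero]

/-- Only finitely many coefficients are nonzero, and each is bounded on a smaller disc. This is why
finitely supported errors are harmless at every order. -/
theorem IsFormal.gevrey_one_pred {U : Opens X} {s : U → Ger} (hs : IsFormal U s)
    (hf : FinSupp s) {r : ℝ≥0∞} (hr : 1 ≤ r) : (gevrey ⟨r, hr⟩).pred U s := by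
  refine ⟨hs, ?_⟩
  rintro ⟨⟨c, w⟩, hp⟩
  by_cases hw : w = 0
  · subst hw
    obtain ⟨R, hR, -, k, f, hd, -, h⟩ := exists_local_ofCoefs hs hp (r := ⊤) (Or.inl rfl) one_pos
    obtain ⟨J, hJ⟩ := hf
    have h0 : ∀ j, J ≤ j → ∀ z ∈ Metric.ball c R, f j z = 0 := fun j hj z hz => by
      rw [← cf_zero_ofCoefs (V := polydisc c R) (f := f) (mem_polydisc.2 hz) j, ← h]
      exact hJ _ 0 j hj
    have hR2 := half_lt_self hR
    have hM : ∀ j, ∃ M, ∀ z ∈ Metric.closedBall c (R / 2), ‖f j z‖ ≤ M := fun j =>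
      (isCompact_closedBall c (R / 2)).exists_bound_of_continuousOn
        ((hd j).continuousOn.mono (Metric.closedBall_subset_ball hR2))
    choose M hM using hM
    have hM0 : ∀ j, 0 ≤ M j := fun j =>
      (norm_nonneg _).trans (hM j c (Metric.mem_closedBall_self (by positivity)))
    by_cases hr' : r = ⊤
    · exact Or.inl hr'
    have hσ := toReal_sub_one_nonneg hr hr'
    have hb : GevBound r (Metric.ball c (R / 2)) f := by
      refine Or.inr ⟨∑ j ∈ Finset.range J, M j, 1, Finset.sum_nonneg fun j _ => hM0 j, le_rfl,
        fun j z hz => ?_⟩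
      have hs0 : 0 ≤ ∑ j ∈ Finset.range J, M j := Finset.sum_nonneg fun j _ => hM0 j
      rw [one_pow, mul_one]
      rcases lt_or_ge j J with hj | hj
      · refine ((hM j z (Metric.ball_subset_closedBall hz)).trans (Finset.single_le_sum
          (f := M) (fun j _ => hM0 j) (Finset.mem_range.2 hj))).trans ?_
        exact le_mul_of_one_le_right hs0 (one_le_factorial_rpow hσ j)
      · rw [h0 j hj z (Metric.ball_subset_ball hR2.le hz), norm_zero]
        positivity
    have h1 := (gevrey_pred_ofCoefs hr (fun j => (hd j).mono (Metric.ball_subset_ball hR2.le))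
      hb).2 ⟨(c, 0), center_mem_polydisc (by positivity)⟩
    have h2 : ofCoefs (polydisc c (R / 2)) f ⟨(c, 0), center_mem_polydisc (by positivity)⟩ =
        s ⟨(c, 0), hp⟩ :=
      (congrFun h ⟨(c, 0), center_mem_polydisc hR⟩).symm
    rwa [h2] at h1
  · rw [hs.1 ⟨(c, w), hp⟩ hw]
    exact .zero _

/-! ### Convergent power series in two variables -/

theorem prod_fin_ite (n i : ℕ) (hi : i ≤ n) (y z : ℂ) :
    (∏ k : Fin n, if (k : ℕ) < i then y else z) = y ^ i * z ^ (n - i) := by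
  have h1 : (Finset.univ.filter fun k : Fin n => (k : ℕ) < i).card = i := by
    simp [Fin.card_filter_val_lt, hi]
  have h2 := Finset.card_filter_add_card_filter_not (s := (Finset.univ : Finset (Fin n)))
    fun k => (k : ℕ) < i
  rw [h1, Finset.card_univ, Fintype.card_fin] at h2
  rw [Finset.prod_ite, Finset.prod_const, Finset.prod_const, h1]
  congr 2
  lia

/-- The multilinear map whose values on the diagonal are `x₁ ^ i * x₂ ^ (n - i)`. -/
noncomputable def monForm (n i : ℕ) : ContinuousMultilinearMap ℂ (fun _ : Fin n => ℂ × ℂ) ℂ :=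
  (ContinuousMultilinearMap.mkPiAlgebra ℂ (Fin n) ℂ).compContinuousLinearMap fun k =>
    if (k : ℕ) < i then ContinuousLinearMap.fst ℂ ℂ ℂ else ContinuousLinearMap.snd ℂ ℂ ℂ

theorem norm_monForm_le (n i : ℕ) : ‖monForm n i‖ ≤ 1 := by
  refine (ContinuousMultilinearMap.norm_compContinuousLinearMap_le _ _).trans ?_
  rw [ContinuousMultilinearMap.norm_mkPiAlgebra, one_mul]
  refine Finset.prod_le_one (fun _ _ => norm_nonneg _) fun k _ => ?_
  split_ifs
  · exact ContinuousLinearMap.norm_fst_le _ _ _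
  · exact ContinuousLinearMap.norm_snd_le _ _ _

theorem monForm_diag {n i : ℕ} (hi : i ≤ n) (y : ℂ × ℂ) :
    monForm n i (fun _ => y) = y.1 ^ i * y.2 ^ (n - i) := by
  rw [← prod_fin_ite n i hi]
  simp only [monForm, ContinuousMultilinearMap.compContinuousLinearMap_apply,
    ContinuousMultilinearMap.mkPiAlgebra_apply]
  refine Finset.prod_congr rfl fun k _ => ?_
  split_ifs <;> rfl

/-- The sum of a convergent power series. -/
noncomputable def gerSum (g : Ger) (y : ℂ × ℂ) : ℂ :=
  ∑' n : ℕ × ℕ, cf n.1 n.2 g * (y.1 ^ n.1 * y.2 ^ n.2)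

theorem summable_gerSum {g : Ger} {r : ℝ}
    (hs : Summable fun n : ℕ × ℕ => ‖cf n.1 n.2 g‖ * r ^ (n.1 + n.2)) {y : ℂ × ℂ}
    (hy : ‖y‖ ≤ r) : Summable fun n : ℕ × ℕ => cf n.1 n.2 g * (y.1 ^ n.1 * y.2 ^ n.2) := by
  refine hs.of_norm_bounded fun n => ?_
  rw [norm_mul, norm_mul, norm_pow, norm_pow, pow_add]
  have h1 : ‖y.1‖ ≤ r := (norm_fst_le y).trans hy
  have h2 : ‖y.2‖ ≤ r := (norm_snd_le y).trans hy
  have h0 : 0 ≤ r := (norm_nonneg _).trans hy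
  gcongr

/-- Grouping the double series by total degree gives a power series of multilinear maps; the forms
`monForm` have norm at most `1`, so absolute summability bounds the radius. -/
theorem analyticOnNhd_gerSum {g : Ger} {r : ℝ} (hr : 0 < r)
    (hs : Summable fun n : ℕ × ℕ => ‖cf n.1 n.2 g‖ * r ^ (n.1 + n.2)) :
    AnalyticOnNhd ℂ (gerSum g) (Metric.ball 0 r) := by
  let P : FormalMultilinearSeries ℂ (ℂ × ℂ) ℂ := fun n =>
    ∑ x ∈ Finset.HasAntidiagonal.antidiagonal n, cf x.1 x.2 g • monForm n x.1
  lift r to NNReal using hr.le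
  have hP : HasFPowerSeriesOnBall (gerSum g) P 0 r := by
    refine ⟨?_, by exact_mod_cast hr, fun {y} hy => ?_⟩
    · refine P.le_radius_of_bound (∑' n : ℕ × ℕ, ‖cf n.1 n.2 g‖ * (r : ℝ) ^ (n.1 + n.2))
        fun n => ?_
      calc ‖P n‖ * (r : ℝ) ^ n
          ≤ (∑ x ∈ Finset.HasAntidiagonal.antidiagonal n, ‖cf x.1 x.2 g‖) * (r : ℝ) ^ n := by
            refine mul_le_mul_of_nonneg_right ((norm_sum_le _ _).trans
              (Finset.sum_le_sum fun x _ => ?_)) (by positivity)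
            rw [norm_smul]
            exact mul_le_of_le_one_right (norm_nonneg _) (norm_monForm_le _ _)
        _ = ∑ x ∈ Finset.HasAntidiagonal.antidiagonal n,
              ‖cf x.1 x.2 g‖ * (r : ℝ) ^ (x.1 + x.2) := by
            rw [Finset.sum_mul]
            refine Finset.sum_congr rfl fun x hx => ?_
            rw [Finset.HasAntidiagonal.mem_antidiagonal.1 hx]
        _ ≤ _ := hs.sum_le_tsum _ fun _ _ => by positivity
    · rw [zero_add]
      have hy' : ‖y‖ ≤ r := by
        rw [Metric.eball_coe, mem_ball_zero_iff] at hy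
        exact hy.le
      have h := (summable_gerSum hs hy').hasSum
      refine (Finset.HasAntidiagonal.sigmaAntidiagonalEquivProd.hasSum_iff.2 h).sigma fun n => ?_
      have h1 : P n (fun _ => y) = ∑ x : Finset.HasAntidiagonal.antidiagonal n,
          cf x.1.1 x.1.2 g * (y.1 ^ x.1.1 * y.2 ^ x.1.2) := by
        rw [Finset.sum_coe_sort (Finset.HasAntidiagonal.antidiagonal n) fun x : ℕ × ℕ =>
          cf x.1 x.2 g * (y.1 ^ x.1 * y.2 ^ x.2)]
        simp only [P, _root_.sum_apply, _root_.smul_apply, smul_eq_mul]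
        refine Finset.sum_congr rfl fun x hx => ?_
        have hx' := Finset.HasAntidiagonal.mem_antidiagonal.1 hx
        rw [monForm_diag (by lia), show n - x.1 = x.2 by lia]
      rw [h1]
      exact hasSum_fintype _
  have := hP.analyticOnNhd
  rwa [Metric.eball_coe] at this

/-- The Taylor coefficients of the sum of a power series in one variable. -/
theorem iteratedDeriv_of_hasSum {a : ℕ → ℂ} {G : ℂ → ℂ} {c : ℂ} {r : ℝ} (hr : 0 < r)
    (h : ∀ w, ‖w‖ < r → HasSum (fun n => a n * w ^ n) (G (c + w))) (n : ℕ) :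
    iteratedDeriv n G c = n ! * a n := by
  have h1 : HasFPowerSeriesAt G (FormalMultilinearSeries.ofScalars ℂ a) c := by
    rw [hasFPowerSeriesAt_iff]
    filter_upwards [Metric.ball_mem_nhds (0 : ℂ) hr] with w hw
    simpa [mul_comm, FormalMultilinearSeries.coeff_ofScalars] using
      h w (mem_ball_zero_iff.1 hw)
  obtain ⟨R, hR⟩ := h1
  have := hR.factorial_smul 1 n
  rw [iteratedDeriv_eq_iteratedFDeriv, ← this]
  simp

/-- The Taylor coefficients are found one variable at a time: first in the second variable at the
points `(z, 0)`, then in the first. -/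
theorem taylor_gerSum {g : Ger} {r : ℝ} (hr : 0 < r)
    (hs : Summable fun n : ℕ × ℕ => ‖cf n.1 n.2 g‖ * r ^ (n.1 + n.2)) :
    taylor (gerSum g) 0 = g := by
  have ha := analyticOnNhd_gerSum hr hs
  have h2 : ∀ z : ℂ, ‖z‖ < r → ∀ j,
      ((pd (0, 1))^[j] (gerSum g)) (z, 0) = j ! * ∑' i, cf i j g * z ^ i := by
    intro z hz j
    rw [pd_two_iter_eq Metric.isOpen_ball ha j (by simp [Prod.norm_def, hz])]
    refine iteratedDeriv_of_hasSum (a := fun j => ∑' i, cf i j g * z ^ i) hr (fun w hw => ?_) j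
    have h := (summable_gerSum hs (y := (z, w)) (by simp [Prod.norm_def, hz.le, hw.le]))
    have h' := ((Equiv.prodComm ℕ ℕ).summable_iff.2 h)
    have h3 := h'.hasSum.prod_fiberwise fun j => (h'.prod_factor j).hasSum
    rw [zero_add]
    have e1 : (∑' n : ℕ × ℕ, cf n.2 n.1 g * (z ^ n.2 * w ^ n.1)) = gerSum g (z, w) :=
      (Equiv.prodComm ℕ ℕ).tsum_eq fun n : ℕ × ℕ => cf n.1 n.2 g * (z ^ n.1 * w ^ n.2)
    have e2 : ∀ j, (∑' i, cf i j g * (z ^ i * w ^ j)) = (∑' i, cf i j g * z ^ i) * w ^ j :=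
      fun j => by rw [← tsum_mul_right]; simp only [mul_assoc]
    rw [← e1]
    simp only [← e2]
    exact h3
  refine ger_ext fun i j => ?_
  have hi : (i ! : ℂ) ≠ 0 := by exact_mod_cast i.factorial_ne_zero
  have hj : (j ! : ℂ) ≠ 0 := by exact_mod_cast j.factorial_ne_zero
  rw [taylor, cf_mkGer, pd_one_iter_eq Metric.isOpen_ball (pd_iter_analytic ha j) i
    (Metric.mem_ball_self hr), iteratedDeriv_of_hasSum (a := fun i => j ! * cf i j g) hr]
  · field_simp
  · intro w hw
    have := h2 w hw j
    simp only [Prod.fst_zero, Prod.snd_zero, zero_add]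
    rw [this]
    -- Summability of the row of index `j` is read off at a point whose second coordinate is
    -- nonzero, and the factor `(r / 2) ^ j` is then cancelled.
    have h3 := (summable_gerSum hs (y := (w, ((r / 2 : ℝ) : ℂ)))
      (by simp [Prod.norm_def, hw.le, abs_of_pos hr, hr.le])).prod_symm.prod_factor j
    have h4 : (((r / 2 : ℝ) : ℂ)) ^ j ≠ 0 := pow_ne_zero _ (by exact_mod_cast (half_pos hr).ne')
    simp only [Prod.swap_prod_mk, ← mul_assoc] at h3
    simp only [mul_assoc]
    exact ((summable_mul_right_iff h4).1 h3).hasSum.mul_left _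

theorem pd_iter_comp_sub (v : ℂ × ℂ) (f : ℂ × ℂ → ℂ) (p : ℂ × ℂ) (n : ℕ) :
    (pd v)^[n] (fun x => f (x - p)) = fun x => (pd v)^[n] f (x - p) := by
  induction n generalizing f with
  | zero => rfl
  | succ n ih =>
    rw [Function.iterate_succ_apply, Function.iterate_succ_apply, ← ih]
    congr 1
    funext x
    exact congrArg (fun L : ℂ × ℂ →L[ℂ] ℂ => L v) (fderiv_comp_sub p)

theorem taylor_comp_sub (f : ℂ × ℂ → ℂ) (p : ℂ × ℂ) :
    taylor (fun x => f (x - p)) p = taylor f 0 := by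
  refine ger_ext fun i j => ?_
  simp only [taylor, cf_mkGer, pd_iter_comp_sub, sub_self]

theorem IsFormal.eq_of_germ_eq {c : ℂ} {R : ℝ} (hR : 0 < R) {s t : polydisc c R → Ger}
    (hs : IsFormal _ s) (ht : IsFormal _ t)
    (h : s ⟨(c, 0), center_mem_polydisc hR⟩ = t ⟨(c, 0), center_mem_polydisc hR⟩) : s = t := by
  obtain ⟨f, hf, rfl⟩ := hs.exists_eq_ofCoefs
  obtain ⟨g, hg, rfl⟩ := ht.exists_eq_ofCoefs
  simp only [slice_polydisc] at hf hg
  refine ofCoefs_congr fun z hz j => ?_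
  have hz := mem_polydisc.1 hz
  rw [← Complex.taylorSeries_eq_on_ball (hf j) hz, ← Complex.taylorSeries_eq_on_ball (hg j) hz]
  refine tsum_congr fun n => ?_
  have h1 := congrArg (cf n j) h
  rw [cf_ofCoefs, cf_ofCoefs] at h1
  have hn : (n ! : ℂ) ≠ 0 := by exact_mod_cast n.factorial_ne_zero
  rw [(div_left_inj' hn).1 h1]

/-- A germ of order `1` is a convergent power series; its sum is holomorphic and has that germ as
Taylor series. The identity theorem on a disc makes the two families agree at all nearby points of
`Y`. -/
theorem conv_pred_iff {U : Opens X} {s : U → Ger} :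
    conv.pred U s ↔ (gevrey ⟨1, Set.mem_Ici.2 le_rfl⟩).pred U s := by
  refine ⟨conv_le_gevrey _ U s, fun hs => ⟨hs.1.1, ?_⟩⟩
  rintro ⟨⟨c, w⟩, hp⟩ hw
  obtain rfl : w = 0 := hw
  set g := s ⟨(c, 0), hp⟩ with hg
  obtain ⟨r, hr, hsum⟩ : IsConvergent g := by
    have := (isGevrey_iff ENNReal.one_ne_top).1 (hs.2 ⟨(c, 0), hp⟩)
    rw [isConvergent_iff]
    simpa using this
  let F : ℂ × ℂ → ℂ := fun x => gerSum g (x - (c, 0))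
  obtain ⟨R', hR', hk'⟩ := exists_polydisc_le hp
  have hR : 0 < min R' r := lt_min hR' hr
  have hk : polydisc c (min R' r) ≤ U := (polydisc_le (min_le_left _ _)).trans hk'
  have hF : AnalyticOnNhd ℂ F (polydisc c (min R' r)) := by
    intro x hx
    have h1 : x - (c, 0) ∈ Metric.ball (0 : ℂ × ℂ) r := by
      rw [mem_ball_zero_iff, ← dist_eq_norm]
      exact (Metric.mem_ball.1 hx).trans_le (min_le_right _ _)
    exact (analyticOnNhd_gerSum hr hsum _ h1).comp
      (f := fun x : ℂ × ℂ => x - (c, 0)) (analyticAt_id.sub analyticAt_const)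
  classical
  let t : polydisc c (min R' r) → Ger := fun q => if q.1.2 = 0 then taylor F q.1 else 0
  have ht : conv.pred (polydisc c (min R' r)) t :=
    ⟨fun q hq => if_neg hq, fun q _ => ⟨_, F, q.2, hF, fun q' _ hq' => if_pos hq'⟩⟩
  have hst : res hk s = t := by
    refine (hs.1.res hk s).eq_of_germ_eq hR (conv_le_gevrey ⟨1, Set.mem_Ici.2 le_rfl⟩ _ t ht).1 ?_
    have h1 : t ⟨(c, 0), center_mem_polydisc hR⟩ = taylor F (c, 0) := if_pos rfl
    rw [h1, taylor_comp_sub, taylor_gerSum hr hsum]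
    rfl
  exact ⟨polydisc c (min R' r), F, center_mem_polydisc hR, hF,
    fun q hq hq0 => (congrFun hst ⟨q.1, hq⟩).trans (if_pos hq0)⟩

/-! ### The Euler operator on holomorphic functions of one variable -/

/-- The solution `(z / c) ^ ((γ - b * j) / a)` of the `j`-th coefficient of the Euler equation
near `c ≠ 0`. -/
noncomputable def eulerSol (a b : ℕ) (γ c : ℂ) (j : ℕ) (z : ℂ) : ℂ :=
  Complex.exp ((γ - b * j) / a * Complex.log (z / c))

section

variable {a b : ℕ} {γ c : ℂ}

theorem div_eq_one_add (hc : c ≠ 0) (z : ℂ) : z / c = 1 + (z - c) / c := by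
  field_simp
  ring

theorem norm_sub_div_le (hc : c ≠ 0) {z : ℂ} (hz : z ∈ Metric.ball c (‖c‖ / 2)) :
    ‖(z - c) / c‖ ≤ 1 / 2 := by
  have hc' : 0 < ‖c‖ := norm_pos_iff.2 hc
  rw [norm_div, div_le_iff₀ hc', ← dist_eq_norm]
  linarith [Metric.mem_ball.1 hz]

theorem half_norm_le {z : ℂ} (hz : z ∈ Metric.ball c (‖c‖ / 2)) :
    ‖c‖ / 2 ≤ ‖z‖ := by
  have h1 := Metric.mem_ball.1 hz
  rw [dist_eq_norm, norm_sub_rev] at h1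
  linarith [norm_sub_norm_le c z]

theorem ne_zero_of_mem_ball (hc : c ≠ 0) {z : ℂ} (hz : z ∈ Metric.ball c (‖c‖ / 2)) : z ≠ 0 :=
  norm_pos_iff.1 (lt_of_lt_of_le (half_pos (norm_pos_iff.2 hc)) (half_norm_le hz))

theorem norm_log_div_le (hc : c ≠ 0) {z : ℂ} (hz : z ∈ Metric.ball c (‖c‖ / 2)) :
    ‖Complex.log (z / c)‖ ≤ 1 := by
  rw [div_eq_one_add hc]
  have h := norm_sub_div_le hc hz
  linarith [Complex.norm_log_one_add_half_le_self h]

theorem div_mem_slitPlane (hc : c ≠ 0) {z : ℂ} (hz : z ∈ Metric.ball c (‖c‖ / 2)) :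
    z / c ∈ Complex.slitPlane := by
  rw [div_eq_one_add hc]
  exact Complex.mem_slitPlane_of_norm_lt_one ((norm_sub_div_le hc hz).trans_lt (by norm_num))

theorem eulerSol_ne_zero (j : ℕ) (z : ℂ) : eulerSol a b γ c j z ≠ 0 := Complex.exp_ne_zero _

theorem eulerSol_self (hc : c ≠ 0) (j : ℕ) : eulerSol a b γ c j c = 1 := by
  simp [eulerSol, div_self hc]

theorem hasDerivAt_eulerSol (hc : c ≠ 0) (j : ℕ) {z : ℂ} (hz : z ∈ Metric.ball c (‖c‖ / 2)) :
    HasDerivAt (eulerSol a b γ c j) ((γ - b * j) / a / z * eulerSol a b γ c j z) z := by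
  have hz0 := ne_zero_of_mem_ball hc hz
  have h1 : HasDerivAt (fun z => Complex.log (z / c)) (1 / c / (z / c)) z :=
    ((hasDerivAt_id z).div_const c).clog (div_mem_slitPlane hc hz)
  refine ((h1.const_mul ((γ - b * j) / a)).cexp).congr_deriv ?_
  rw [eulerSol]
  field_simp

/-- On this disc the logarithm is bounded by `1` and the exponent grows linearly in `j`, so the
powers grow only geometrically and do not affect Gevrey orders. -/
theorem norm_exp_mul_log_le (hc : c ≠ 0) (j : ℕ) {z ν : ℂ} (hν : ‖ν‖ ≤ ‖γ‖ + b * j)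
    (hz : z ∈ Metric.ball c (‖c‖ / 2)) : ‖Complex.exp (ν * Complex.log (z / c))‖ ≤
      Real.exp ‖γ‖ * Real.exp b ^ j := by
  rw [← Real.exp_nat_mul, ← Real.exp_add]
  refine (Complex.norm_exp_le_exp_norm _).trans (Real.exp_le_exp.2 ?_)
  rw [norm_mul]
  calc ‖ν‖ * ‖Complex.log (z / c)‖ ≤ (‖γ‖ + b * j) * 1 :=
        mul_le_mul hν (norm_log_div_le hc hz) (norm_nonneg _) (by positivity)
    _ = _ := by ring

theorem norm_eulerExponent_le (ha : 0 < a) (j : ℕ) : ‖(γ - b * j) / a‖ ≤ ‖γ‖ + b * j := by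
  have ha1 : (1 : ℝ) ≤ a := by exact_mod_cast ha
  rw [norm_div, Complex.norm_natCast]
  refine (div_le_self (norm_nonneg _) ha1).trans ((norm_sub_le _ _).trans ?_)
  rw [norm_mul, Complex.norm_natCast, Complex.norm_natCast]

theorem norm_eulerSol_le (ha : 0 < a) (hc : c ≠ 0) (j : ℕ) {z : ℂ}
    (hz : z ∈ Metric.ball c (‖c‖ / 2)) :
    ‖eulerSol a b γ c j z‖ ≤ Real.exp ‖γ‖ * Real.exp b ^ j :=
  norm_exp_mul_log_le hc j (norm_eulerExponent_le ha j) hz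

theorem norm_eulerSol_inv_le (ha : 0 < a) (hc : c ≠ 0) (j : ℕ) {z : ℂ}
    (hz : z ∈ Metric.ball c (‖c‖ / 2)) :
    ‖(eulerSol a b γ c j z)⁻¹‖ ≤ Real.exp ‖γ‖ * Real.exp b ^ j := by
  rw [eulerSol, ← Complex.exp_neg, ← neg_mul]
  exact norm_exp_mul_log_le hc j ((norm_neg _).le.trans (norm_eulerExponent_le ha j)) hz

/-- Variation of constants: `α = h G` with `h` the homogeneous solution and `G` the primitive of `f
/ (a z h)` vanishing at `c`. The bound is the product of the bounds for `h` and `1 / h`. -/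
theorem exists_euler_solution_of_ne_zero (ha : 0 < a) (hc : c ≠ 0) {R : ℝ} (hR : 0 < R)
    (hR' : R ≤ ‖c‖ / 2) (j : ℕ) {f : ℂ → ℂ} (hf : DifferentiableOn ℂ f (Metric.ball c R)) :
    ∃ α : ℂ → ℂ, DifferentiableOn ℂ α (Metric.ball c R) ∧
      (∀ z ∈ Metric.ball c R, a * z * deriv α z + (b * j - γ) * α z = f z) ∧
      ∀ M, (∀ z ∈ Metric.ball c R, ‖f z‖ ≤ M) → ∀ z ∈ Metric.ball c R,
        ‖α z‖ ≤ (Real.exp ‖γ‖) ^ 2 * (Real.exp b ^ 2) ^ j * M := by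
  have hsub := Metric.ball_subset_ball (x := c) hR'
  have ha0 : (a : ℂ) ≠ 0 := by exact_mod_cast ha.ne'
  have ha1 : (1 : ℝ) ≤ a := by exact_mod_cast ha
  have hc' : 0 < ‖c‖ := norm_pos_iff.2 hc
  set h := eulerSol a b γ c j with hh
  have hd : ∀ z ∈ Metric.ball c R, HasDerivAt h ((γ - b * j) / a / z * h z) z := fun z hz =>
    hasDerivAt_eulerSol hc j (hsub hz)
  have hz0 : ∀ z ∈ Metric.ball c R, z ≠ 0 := fun z hz => ne_zero_of_mem_ball hc (hsub hz)
  have hh0 : ∀ z, h z ≠ 0 := fun z => eulerSol_ne_zero j z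
  have hg : DifferentiableOn ℂ (fun z => f z * ((a * z)⁻¹ * (h z)⁻¹)) (Metric.ball c R) := by
    intro z hz
    have h1 : DifferentiableWithinAt ℂ f (Metric.ball c R) z := hf z hz
    have h2 : DifferentiableWithinAt ℂ h (Metric.ball c R) z :=
      (hd z hz).differentiableAt.differentiableWithinAt
    have h3 : (a : ℂ) * z ≠ 0 := mul_ne_zero ha0 (hz0 z hz)
    have h4 := hh0 z
    fun_prop (disch := assumption)
  obtain ⟨G₀, hG₀⟩ := hg.isExactOn_ball
  let G : ℂ → ℂ := fun z => G₀ z - G₀ c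
  have hG : ∀ z ∈ Metric.ball c R, HasDerivAt G (f z * ((a * z)⁻¹ * (h z)⁻¹)) z :=
    fun z hz => (hG₀ z hz).sub_const _
  have hα : ∀ z ∈ Metric.ball c R, HasDerivAt (fun z => h z * G z)
      ((γ - b * j) / a / z * h z * G z + h z * (f z * ((a * z)⁻¹ * (h z)⁻¹))) z :=
    fun z hz => (hd z hz).mul (hG z hz)
  refine ⟨fun z => h z * G z, fun z hz => (hα z hz).differentiableAt.differentiableWithinAt,
    fun z hz => ?_, fun M hM z hz => ?_⟩
  · rw [(hα z hz).deriv]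
    have h3 := hz0 z hz
    have h4 := hh0 z
    field_simp
    ring
  · have hcR := Metric.mem_ball_self (x := c) hR
    set B := Real.exp ‖γ‖ * Real.exp b ^ j with hB
    have hM0 : 0 ≤ M := (norm_nonneg _).trans (hM c hcR)
    have h1 : ∀ w ∈ Metric.ball c R, ‖f w * ((a * w)⁻¹ * (h w)⁻¹)‖ ≤ M * ((‖c‖ / 2)⁻¹ * B) := by
      intro w hw
      rw [norm_mul, norm_mul, norm_inv, norm_mul, Complex.norm_natCast]
      refine mul_le_mul (hM w hw) ?_ (by positivity) hM0
      refine mul_le_mul ?_ (norm_eulerSol_inv_le ha hc j (hsub hw)) (norm_nonneg _) (by positivity)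
      refine inv_anti₀ (by positivity) ((half_norm_le (hsub hw)).trans ?_)
      exact le_mul_of_one_le_left (norm_nonneg _) ha1
    have h2 := (convex_ball c R).norm_image_sub_le_of_norm_hasDerivWithin_le
      (fun w hw => (hG w hw).hasDerivWithinAt) h1 hcR hz
    have h3 : ‖z - c‖ ≤ ‖c‖ / 2 := by
      rw [← dist_eq_norm]
      exact (Metric.mem_ball.1 (hsub hz)).le
    have h4 : ‖G z‖ ≤ M * B := by
      have e : G z = G z - G c := by simp [G]
      rw [e]
      refine h2.trans ?_
      calc M * ((‖c‖ / 2)⁻¹ * B) * ‖z - c‖ ≤ M * ((‖c‖ / 2)⁻¹ * B) * (‖c‖ / 2) := by gcongr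
        _ = M * B := by field_simp
    rw [norm_mul]
    calc ‖h z‖ * ‖G z‖ ≤ B * (M * B) :=
          mul_le_mul (norm_eulerSol_le ha hc j (hsub hz)) h4 (norm_nonneg _) (by positivity)
      _ = _ := by rw [hB]; ring

/-- At the origin the equation is solved on Taylor coefficients, dividing by `a n + b j - γ`; for
such `j` this has modulus at least `1` for every `n`, so there are no resonances or small divisors.
-/
theorem exists_euler_solution_zero (hb : 0 < b) {j : ℕ} (hj : ‖γ‖ + 1 ≤ j) {R : ℝ}
    (hR : 0 < R) {f : ℂ → ℂ} (hf : DifferentiableOn ℂ f (Metric.ball 0 R)) :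
    ∃ α : ℂ → ℂ, DifferentiableOn ℂ α (Metric.ball 0 R) ∧
      (∀ z ∈ Metric.ball 0 R, a * z * deriv α z + (b * j - γ) * α z = f z) ∧
      ∀ M, (∀ z ∈ Metric.ball 0 R, ‖f z‖ ≤ M) → ∀ z ∈ Metric.ball 0 (R / 2), ‖α z‖ ≤ 3 * M := by
  let k : ℕ → ℂ := fun n => iteratedDeriv n f 0 / (n ! : ℂ)
  let m : ℕ → ℂ := fun n => a * n + b * j - γ
  have hm : ∀ n, 1 ≤ ‖m n‖ := fun n => by
    have h1 : ‖((a * n + b * j : ℕ) : ℂ)‖ - ‖γ‖ ≤ ‖m n‖ := by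
      refine (norm_sub_norm_le _ _).trans (le_of_eq ?_)
      simp [m]
    rw [Complex.norm_natCast] at h1
    have h2 : (j : ℝ) ≤ ((a * n + b * j : ℕ) : ℝ) := by
      exact_mod_cast (Nat.le_mul_of_pos_left j hb).trans (Nat.le_add_left _ _)
    linarith
  have hm0 : ∀ n, m n ≠ 0 := fun n => norm_pos_iff.1 (zero_lt_one.trans_le (hm n))
  let F : ℕ → ℂ → ℂ := fun n z => k n / m n * z ^ n
  have hk : ∀ z ∈ Metric.ball (0 : ℂ) R, HasSum (fun n => k n * z ^ n) (f z) := fun z hz => by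
    refine (congrArg (fun u : ℕ → ℂ => HasSum u (f z)) (funext fun n => ?_)).mp (Complex.hasSum_taylorSeries_on_ball hf hz)
    simp only [k, smul_eq_mul, sub_zero]
    ring
  have hF : ∀ r : ℝ, 0 ≤ r → ∀ n, ∀ z ∈ Metric.ball (0 : ℂ) r, ‖F n z‖ ≤ ‖k n‖ * r ^ n :=
    fun r hr n z hz => by
      rw [norm_mul, norm_div, norm_pow]
      have h1 := (mem_ball_zero_iff.1 hz).le
      have h2 := div_le_self (norm_nonneg (k n)) (hm n)
      gcongr
  have hsum : ∀ r : ℝ, 0 ≤ r → r < R → Summable fun n => ‖k n‖ * r ^ n := fun r hr hrR => by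
    have := (hk (r : ℂ) (by simpa [abs_of_nonneg hr] using hrR)).summable.norm
    simpa [abs_of_nonneg hr] using this
  have hFd : ∀ n, Differentiable ℂ (F n) := fun n => by fun_prop
  have hα : ∀ z ∈ Metric.ball (0 : ℂ) R, DifferentiableAt ℂ (fun z => ∑' n, F n z) z ∧
      HasSum (fun n => deriv (F n) z) (deriv (fun z => ∑' n, F n z) z) ∧
      HasSum (fun n => F n z) (∑' n, F n z) := fun z hz => by
    obtain ⟨r, hzr, hrR⟩ := exists_between (mem_ball_zero_iff.1 hz)
    have hr : 0 ≤ r := (norm_nonneg _).trans hzr.le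
    have hz' : z ∈ Metric.ball (0 : ℂ) r := mem_ball_zero_iff.2 hzr
    refine ⟨(Complex.differentiableOn_tsum_of_summable_norm (hsum r hr hrR)
      (fun n => (hFd n).differentiableOn) Metric.isOpen_ball (hF r hr)).differentiableAt
      (Metric.isOpen_ball.mem_nhds hz'), Complex.hasSum_deriv_of_summable_norm (hsum r hr hrR)
      (fun n => (hFd n).differentiableOn) Metric.isOpen_ball (hF r hr) hz', ?_⟩
    exact ((hsum r hr hrR).of_norm_bounded fun n => hF r hr n z hz').hasSum
  refine ⟨fun z => ∑' n, F n z, fun z hz => (hα z hz).1.differentiableWithinAt, fun z hz => ?_,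
    fun M hM z hz => ?_⟩
  · obtain ⟨-, h1, h2⟩ := hα z hz
    refine ((h1.mul_left (a * z)).add (h2.mul_left (b * j - γ))).unique ?_
    refine (congrArg (fun u : ℕ → ℂ => HasSum u (f z)) (funext fun n => ?_)).mp (hk z hz)
    have h3 : deriv (F n) z = k n / m n * (n * z ^ (n - 1)) := by
      simp only [F]
      rw [deriv_const_mul _ (by fun_prop), deriv_pow_field]
    have h4 : z * (n * z ^ (n - 1)) = n * z ^ n := by
      rcases n with - | n
      · simp
      · rw [Nat.add_sub_cancel, pow_succ]; ring
    rw [h3]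
    have h5 := hm0 n
    calc k n * z ^ n = k n / m n * (m n * z ^ n) := by field_simp
      _ = k n / m n * (a * (z * (n * z ^ (n - 1))) + (b * j - γ) * z ^ n) := by
        rw [h4]; simp only [m]; ring
      _ = _ := by simp only [F]; ring
  · have h1 : ∀ n, ‖F n z‖ ≤ M * (2 / 3) ^ n := fun n => by
      refine (hF (R / 2) (by positivity) n z hz).trans ?_
      -- A radius between `R / 2` and `R`: the quotient `2 / 3` of the radii gives a geometric
      -- series of sum `3`.
      have := norm_iteratedDeriv_div_le (ρ := 3 / 4 * R) (by positivity) (by linarith) hf hM n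
      calc ‖k n‖ * (R / 2) ^ n ≤ M / (3 / 4 * R) ^ n * (R / 2) ^ n := by gcongr
        _ = M * ((R / 2) / (3 / 4 * R)) ^ n := by
            rw [div_pow (R / 2) (3 / 4 * R), mul_div_assoc', div_mul_eq_mul_div]
        _ = _ := by rw [show R / 2 / (3 / 4 * R) = 2 / 3 by field_simp; norm_num]
    have h2 := (hasSum_geometric_of_lt_one (r := (2 / 3 : ℝ)) (by norm_num) (by norm_num)).mul_left M
    refine (tsum_of_norm_bounded h2 h1).trans (le_of_eq ?_)
    norm_num
    ring

/-- The constants are uniform in `j` and the radius is halved only once, so all coefficients can be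
solved for simultaneously on one disc. -/
theorem exists_euler_solution (ha : 0 < a) (hb : 0 < b) (γ c : ℂ) : ∃ (ε K D : ℝ) (J : ℕ),
    0 < ε ∧ 0 ≤ K ∧ 1 ≤ D ∧ ∀ R, 0 < R → R ≤ ε → ∀ j, J ≤ j → ∀ f : ℂ → ℂ,
      DifferentiableOn ℂ f (Metric.ball c R) → ∃ α : ℂ → ℂ,
        DifferentiableOn ℂ α (Metric.ball c R) ∧
        (∀ z ∈ Metric.ball c R, a * z * deriv α z + (b * j - γ) * α z = f z) ∧
        ∀ M, (∀ z ∈ Metric.ball c R, ‖f z‖ ≤ M) → ∀ z ∈ Metric.ball c (R / 2),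
          ‖α z‖ ≤ K * D ^ j * M := by
  by_cases hc : c = 0
  · subst hc
    refine ⟨1, 3, 1, ⌈‖γ‖ + 1⌉₊, one_pos, by norm_num, le_rfl, fun R hR _ j hj f hf => ?_⟩
    simpa using exists_euler_solution_zero hb (Nat.ceil_le.1 hj) hR hf
  · refine ⟨‖c‖ / 2, Real.exp ‖γ‖ ^ 2, Real.exp b ^ 2, 0, half_pos (norm_pos_iff.2 hc),
      by positivity, one_le_pow₀ (Real.one_le_exp (by positivity)), fun R hR hR' j _ f hf => ?_⟩
    obtain ⟨α, h1, h2, h3⟩ := exists_euler_solution_of_ne_zero (b := b) (γ := γ) ha hc hR hR' j hf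
    exact ⟨α, h1, h2, fun M hM z hz => h3 M hM z (Metric.ball_subset_ball (half_le_self hR.le) hz)⟩

end

/-! ### The Euler operator on formal power series along `Y` -/

section

variable {a b : ℕ} {γ c : ℂ}

theorem act_sub {U : Opens X} (T : DOp U) (s t : U → Ger) : act T (s - t) = act T s - act T t :=
  funext fun p => map_sub (T.1 p) (s p) (t p)

/-- The Euler operator is surjective modulo finitely many terms at every Gevrey order, the inverse
costing only geometric factors; the coefficients below `J`, where a resonance may occur, are left
out. -/
theorem exists_local_opE_solution (ha : 0 < a) (hb : 0 < b) (γ : ℂ) {U : Opens X} {s : U → Ger}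
    (hs : IsFormal U s) (hc : ((c, 0) : ℂ × ℂ) ∈ U) {r : ℝ≥0∞} (hr : 1 ≤ r)
    (hg : IsGevrey r (s ⟨(c, 0), hc⟩)) :
    ∃ (V : Opens X) (k : V ≤ U), ((c, 0) : ℂ × ℂ) ∈ V ∧ ∃ w : V → Ger,
      (gevrey ⟨r, hr⟩).pred V w ∧ FinSupp (act (opE a b γ V) w - res k s) := by
  obtain ⟨ε, K, D, J, hε, hK, hD, hE⟩ := exists_euler_solution ha hb γ c
  obtain ⟨R, hR, hRε, k, f, hf, hbd, hsf⟩ := exists_local_ofCoefs hs hc hg hε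
  choose! α hα hα' hα'' using fun j (hj : J ≤ j) => hE R hR hRε j hj (f j) (hf j)
  let w : ℕ → ℂ → ℂ := fun j => if J ≤ j then α j else 0
  have hsub : Metric.ball c (R / 2) ⊆ Metric.ball c R := Metric.ball_subset_ball (half_le_self hR.le)
  have hw : ∀ j, DifferentiableOn ℂ (w j) (Metric.ball c (R / 2)) := fun j => by
    by_cases hj : J ≤ j
    · simp only [w, if_pos hj]
      exact (hα j hj).mono hsub
    · simp only [w, if_neg hj]
      exact differentiableOn_const 0
  have hwb : GevBound r (Metric.ball c (R / 2)) w := by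
    rcases hbd with hr' | ⟨C, D', hC, hD', hbd⟩
    · exact Or.inl hr'
    refine Or.inr ⟨K * C, D * D', by positivity, one_le_mul_of_one_le_of_one_le hD hD',
      fun j z hz => ?_⟩
    by_cases hj : J ≤ j
    · simp only [w, if_pos hj]
      refine (hα'' j hj _ (hbd j) z hz).trans (le_of_eq ?_)
      rw [mul_pow]
      ring
    · simp only [w, if_neg hj, Pi.zero_apply, norm_zero]
      positivity
  have hk : polydisc c (R / 2) ≤ polydisc c R := polydisc_le (half_le_self hR.le)
  refine ⟨polydisc c (R / 2), hk.trans k, center_mem_polydisc (half_pos hR), ofCoefs _ w,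
    gevrey_pred_ofCoefs hr hw hwb, ?_⟩
  have h1 : res (hk.trans k) s = ofCoefs _ f := congrArg (res hk) hsf
  rw [h1, act_opE_ofCoefs a b γ (by rwa [slice_polydisc]), ofCoefs_sub]
  · refine finSupp_ofCoefs (J := J) fun j hj z hz => ?_
    simp only [w, if_pos hj]
    rw [hα' j hj z (hsub (mem_polydisc.1 hz)), sub_self]
  · intro j
    rw [slice_polydisc]
    have := (hw j).deriv Metric.isOpen_ball
    have := hw j
    fun_prop
  · intro j
    rw [slice_polydisc]
    exact (hf j).mono hsub

/-- The family of power series with coefficients `x_j (x₁ / c) ^ ((γ - b * j) / a)`. -/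
noncomputable def solFam (a b : ℕ) (γ c : ℂ) (R : ℝ) (x : ℕ → ℂ) : polydisc c R → Ger :=
  ofCoefs _ fun j z => x j * eulerSol a b γ c j z

theorem differentiableOn_solFam (hc : c ≠ 0) {R : ℝ} (hR : R ≤ ‖c‖ / 2) (x : ℕ → ℂ) (j : ℕ) :
    DifferentiableOn ℂ (fun z => x j * eulerSol a b γ c j z) (Metric.ball c R) := fun _ hz =>
  ((hasDerivAt_eulerSol hc j (Metric.ball_subset_ball hR hz)).const_mul _).differentiableAt
    |>.differentiableWithinAt

theorem isFormal_solFam (hc : c ≠ 0) {R : ℝ} (hR : R ≤ ‖c‖ / 2) (x : ℕ → ℂ) :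
    IsFormal _ (solFam a b γ c R x) :=
  isFormal_ofCoefs fun j => by
    rw [slice_polydisc]
    exact differentiableOn_solFam hc hR x j

theorem solFam_pred (ha : 0 < a) (hc : c ≠ 0) {R : ℝ} (hR : R ≤ ‖c‖ / 2) {x : ℕ → ℂ} {r : ℝ≥0∞}
    (hr : 1 ≤ r) (hx : SeqGevrey r x) : (gevrey ⟨r, hr⟩).pred _ (solFam a b γ c R x) := by
  refine gevrey_pred_ofCoefs hr (differentiableOn_solFam hc hR x) ?_
  rcases hx with hr' | ⟨C, D, hC, hD, hx⟩
  · exact Or.inl hr'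
  refine Or.inr ⟨C * Real.exp ‖γ‖, D * Real.exp b, by positivity,
    one_le_mul_of_one_le_of_one_le hD (Real.one_le_exp (by positivity)), fun j z hz => ?_⟩
  rw [norm_mul]
  calc ‖x j‖ * ‖eulerSol a b γ c j z‖
      ≤ C * D ^ j * (j ! : ℝ) ^ (r.toReal - 1) * (Real.exp ‖γ‖ * Real.exp b ^ j) :=
        mul_le_mul (hx j) (norm_eulerSol_le ha hc j (Metric.ball_subset_ball hR hz))
          (norm_nonneg _) (by positivity)
    _ = _ := by rw [mul_pow]; ring

theorem seqGevrey_of_solFam (hc : c ≠ 0) {R : ℝ} (hR : 0 < R) {x : ℕ → ℂ} {r : ℝ≥0∞}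
    (h : IsGevrey r (solFam a b γ c R x ⟨(c, 0), center_mem_polydisc hR⟩)) : SeqGevrey r x := by
  by_cases hr : r = ⊤
  · exact Or.inl hr
  obtain ⟨C, D, hC, hD, hx⟩ := (isGevrey_iff hr).1 h
  refine Or.inr ⟨C, D, hC, hD, fun j => ?_⟩
  have h1 := hx 0 j
  rwa [solFam, cf_zero_ofCoefs, eulerSol_self hc, mul_one, zero_add] at h1

theorem act_opE_solFam (ha : 0 < a) (hc : c ≠ 0) {R : ℝ} (hR : R ≤ ‖c‖ / 2) (x : ℕ → ℂ) :
    act (opE a b γ _) (solFam a b γ c R x) = 0 := by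
  have ha0 : (a : ℂ) ≠ 0 := by exact_mod_cast ha.ne'
  rw [solFam, act_opE_ofCoefs a b γ (by
    rw [slice_polydisc]; exact differentiableOn_solFam hc hR x)]
  refine (ofCoefs_congr (g := 0) fun z hz j => ?_).trans ?_
  · have hz' := Metric.ball_subset_ball hR (mem_polydisc.1 hz)
    have hz0 := ne_zero_of_mem_ball hc hz'
    rw [((hasDerivAt_eulerSol hc j hz').const_mul _).deriv]
    simp only [Pi.zero_apply]
    field_simp
    ring
  · refine (isFormal_ofCoefs fun j => differentiableOn_const 0).ext_cf_zero (.zero _)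
      fun z hz j => ?_
    rw [cf_zero_ofCoefs]
    simp

theorem iteratedDeriv_eulerSol (hc : c ≠ 0) (x : ℂ) (j n : ℕ) {z : ℂ}
    (hz : z ∈ Metric.ball c (‖c‖ / 2)) :
    iteratedDeriv n (fun z => x * eulerSol a b γ c j z) z =
      x * ((∏ i ∈ Finset.range n, ((γ - b * j) / a - i)) * z⁻¹ ^ n * eulerSol a b γ c j z) := by
  induction n generalizing z with
  | zero => simp
  | succ n ih =>
    have hz0 := ne_zero_of_mem_ball hc hz
    have h1 : iteratedDeriv n (fun z => x * eulerSol a b γ c j z) =ᶠ[nhds z] fun z =>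
        x * ((∏ i ∈ Finset.range n, ((γ - b * j) / a - i)) * z⁻¹ ^ n * eulerSol a b γ c j z) := by
      filter_upwards [Metric.isOpen_ball.mem_nhds hz] with w hw using ih hw
    have hp : HasDerivAt (fun y : ℂ => y⁻¹ ^ n) (-(n * z⁻¹ ^ n * z⁻¹)) z := by
      refine ((hasDerivAt_inv hz0).fun_pow n).congr_deriv ?_
      rcases n with - | n
      · simp
      · rw [Nat.add_sub_cancel, ← inv_pow]
        ring
    have h2 := ((hp.const_mul (∏ i ∈ Finset.range n, ((γ - b * j) / a - i))).fun_mul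
      (hasDerivAt_eulerSol (a := a) (b := b) (γ := γ) hc j hz)).const_mul x
    rw [iteratedDeriv_succ, h1.deriv_eq, h2.deriv, Finset.prod_range_succ]
    ring

theorem eulerSol_eq_shift (ha : 0 < a) (hc : c ≠ 0) (j : ℕ) {z : ℂ}
    (hz : z ∈ Metric.ball c (‖c‖ / 2)) : eulerSol a b γ c j z =
      (z / c) ^ (b / a.gcd b) * eulerSol a b (shiftParam a b γ) c j z := by
  have ha0 : (a : ℂ) ≠ 0 := by exact_mod_cast ha.ne'
  have h0 : z / c ≠ 0 := div_ne_zero (ne_zero_of_mem_ball hc hz) hc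
  rw [eulerSol, eulerSol, shiftParam]
  conv_rhs => rw [← Complex.exp_log h0, ← Complex.exp_nat_mul, Complex.exp_log h0,
    ← Complex.exp_add]
  congr 1
  field_simp
  ring

/-- A step of `p = a / d` in `j` changes the exponent by `b / d`, as `b / d` derivatives do. Hence
both terms of `P` land in the Euler solutions of the shifted parameter. -/
theorem eulerSol_add (ha : 0 < a) (j : ℕ) (z : ℂ) : eulerSol a b γ c (j + a / a.gcd b) z =
    eulerSol a b (shiftParam a b γ) c j z := by
  have ha0 : (a : ℂ) ≠ 0 := by exact_mod_cast ha.ne'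
  have h : (b : ℂ) * (a / a.gcd b : ℕ) = a * (b / a.gcd b : ℕ) := by
    exact_mod_cast mul_div_gcd a b
  rw [eulerSol, eulerSol, shiftParam]
  congr 2
  push_cast at h ⊢
  rw [mul_add, h]
  ring

/-- The reduction of the system to a recurrence for sequences of numbers. The factor `c⁻¹ ^ (b / d)`
in `hgCoeff` comes from normalizing the Euler solutions at `c`. -/
theorem act_opP_solFam (ha : 0 < a) (hc : c ≠ 0) {R : ℝ} (hR : R ≤ ‖c‖ / 2) (x : ℕ → ℂ) :
    act (opP a b _) (solFam a b γ c R x) =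
      solFam a b (shiftParam a b γ) c R (hgRec a b γ c x) := by
  rw [solFam, act_opP_ofCoefs a b (by
    rw [slice_polydisc]; exact differentiableOn_solFam hc hR x)]
  refine ofCoefs_congr fun z hz j => ?_
  have hz' := Metric.ball_subset_ball hR (mem_polydisc.1 hz)
  have hz0 := ne_zero_of_mem_ball hc hz'
  rw [iteratedDeriv_eulerSol hc _ _ _ hz', eulerSol_add ha, eulerSol_eq_shift ha hc j hz', hgRec,
    hgCoeff, div_pow, inv_pow, inv_pow]
  field_simp

/-- For large `j` the coefficient solves a homogeneous first-order equation, so its quotient by the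
normalized solution is constant on the disc, with value `f_j(c)`. -/
theorem exists_local_solFam (ha : 0 < a) (hc : c ≠ 0) {U : Opens X} {s : U → Ger}
    (hs : IsFormal U s) (hcU : ((c, 0) : ℂ × ℂ) ∈ U) (hE : FinSupp (act (opE a b γ U) s)) :
    ∃ R, 0 < R ∧ R ≤ ‖c‖ / 2 ∧ ∃ (k : polydisc c R ≤ U) (x : ℕ → ℂ),
      FinSupp (res k s - solFam a b γ c R x) := by
  have ha0 : (a : ℂ) ≠ 0 := by exact_mod_cast ha.ne'
  obtain ⟨R, hR, hRc, k, f, hf, -, hsf⟩ := exists_local_ofCoefs hs hcU (r := ⊤) (Or.inl rfl)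
    (half_pos (norm_pos_iff.2 hc))
  have hf' : ∀ j, DifferentiableOn ℂ (f j) {z | ((z, 0) : ℂ × ℂ) ∈ polydisc c R} := by
    rwa [slice_polydisc]
  obtain ⟨J, hJ⟩ := hE.res k
  have h1 : res k (act (opE a b γ U) s) = act (opE a b γ _) (ofCoefs (polydisc c R) f) :=
    congrArg (act (opE a b γ _)) hsf
  rw [h1, act_opE_ofCoefs a b γ hf'] at hJ
  refine ⟨R, hR, hRc, k, fun j => f j c, ?_⟩
  rw [hsf, solFam, ofCoefs_sub hf' (by rw [slice_polydisc]; exact differentiableOn_solFam hc hRc _)]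
  refine finSupp_ofCoefs (J := J) fun j hj z hz => ?_
  have hode : ∀ z ∈ Metric.ball c R, a * z * deriv (f j) z + (b * j - γ) * f j z = 0 :=
    fun z hz => by
      have := hJ ⟨(z, 0), mem_polydisc.2 hz⟩ 0 j hj
      rwa [cf_zero_ofCoefs] at this
  have hd : ∀ z ∈ Metric.ball c R,
      HasDerivAt (fun z => f j z / eulerSol a b γ c j z) 0 z := fun z hz => by
    have hz' := Metric.ball_subset_ball hRc hz
    have hz0 := ne_zero_of_mem_ball hc hz'
    have h2 := ((hf j).differentiableAt (Metric.isOpen_ball.mem_nhds hz)).hasDerivAt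
    refine (h2.div (hasDerivAt_eulerSol hc j hz') (eulerSol_ne_zero j z)).congr_deriv ?_
    have h3 := hode z hz
    have h4 := eulerSol_ne_zero (a := a) (b := b) (γ := γ) (c := c) j z
    field_simp
    linear_combination h3
  have hcst := Metric.isOpen_ball.is_const_of_deriv_eq_zero
    (convex_ball c R).isPreconnected
    (fun z hz => (hd z hz).differentiableAt.differentiableWithinAt)
    (fun z hz => (hd z hz).deriv) (mem_polydisc.1 hz) (Metric.mem_ball_self hR)
  simp only [eulerSol_self hc, div_one] at hcst
  rw [← hcst, div_mul_cancel₀ _ (eulerSol_ne_zero j z), sub_self]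

/-- At the origin the Euler operator multiplies Taylor coefficients by `a n + b j - γ`, nonzero for
large `j`: there are no Euler solutions with infinitely many terms. -/
theorem exists_local_finSupp (hb : 0 < b) {U : Opens X} {s : U → Ger}
    (hs : IsFormal U s) (h0 : ((0, 0) : ℂ × ℂ) ∈ U) (hE : FinSupp (act (opE a b γ U) s)) :
    ∃ (V : Opens X) (k : V ≤ U), ((0, 0) : ℂ × ℂ) ∈ V ∧ FinSupp (res k s) := by
  obtain ⟨R, hR, -, k, f, hf, -, hsf⟩ := exists_local_ofCoefs hs h0 (r := ⊤) (Or.inl rfl) one_pos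
  obtain ⟨J, hJ⟩ := hE
  refine ⟨_, k, center_mem_polydisc hR, ?_⟩
  rw [hsf]
  refine finSupp_ofCoefs (J := max J ⌈‖γ‖ + 1⌉₊) fun j hj z hz => ?_
  have hjγ : ‖γ‖ + 1 ≤ j := Nat.ceil_le.1 ((le_max_right _ _).trans hj)
  rw [← Complex.taylorSeries_eq_on_ball (hf j) (mem_polydisc.1 hz)]
  refine (tsum_congr fun n => ?_).trans tsum_zero
  have h1 : cf n j (eulerAt a b γ (0, 0) (s ⟨(0, 0), h0⟩)) = 0 :=
    hJ ⟨(0, 0), h0⟩ n j ((le_max_left _ _).trans hj)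
  rw [cf_eulerAt, mul_zero, zero_mul, zero_add] at h1
  have h2 : (a * n + b * j - γ : ℂ) ≠ 0 := by
    intro h
    have h3 : ((a * n + b * j : ℕ) : ℂ) = γ := by push_cast; linear_combination h
    have h4 : (j : ℝ) ≤ ((a * n + b * j : ℕ) : ℝ) := by
      exact_mod_cast (Nat.le_mul_of_pos_left j hb).trans (Nat.le_add_left _ _)
    rw [← h3, Complex.norm_natCast] at hjγ
    linarith
  have h5 : cf n j (ofCoefs (polydisc 0 R) f ⟨(0, 0), center_mem_polydisc hR⟩) = 0 := by
    rw [← hsf]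
    exact (mul_eq_zero.1 h1).resolve_left h2
  rw [cf_ofCoefs] at h5
  have hn : (n ! : ℂ) ≠ 0 := by exact_mod_cast n.factorial_ne_zero
  rw [(div_eq_zero_iff.1 h5).resolve_right hn]
  simp

end

/-! ### The hypergeometric system on Gevrey series -/

section

variable {a b : ℕ} {β γ c : ℂ}

theorem act_add {U : Opens X} (T : DOp U) (s t : U → Ger) : act T (s + t) = act T s + act T t :=
  funext fun p => map_add (T.1 p) (s p) (t p)

theorem act_mul {U : Opens X} (S T : DOp U) (s : U → Ger) : act (S * T) s = act S (act T s) := rfl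

theorem res_act_opP {U V : Opens X} (k : V ≤ U) (u : U → Ger) :
    res k (act (opP a b U) u) = act (opP a b V) (res k u) := rfl

theorem res_act_opE {U V : Opens X} (k : V ≤ U) (u : U → Ger) :
    res k (act (opE a b γ U) u) = act (opE a b γ V) (res k u) := rfl

theorem res_sub {U V : Opens X} (k : V ≤ U) (u v : U → Ger) :
    res k (u - v) = res k u - res k v := rfl

theorem res_res {U V W : Opens X} (k : V ≤ U) (l : W ≤ V) (u : U → Ger) :
    res l (res k u) = res (l.trans k) u := rfl

theorem IsGevrey.sub {s : ℝ≥0∞} {f g : Ger} (hf : IsGevrey s f) (hg : IsGevrey s g) :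
    IsGevrey s (f - g) := by
  rw [sub_eq_add_neg]
  exact hf.add hg.neg

theorem FinSupp.neg {U : Opens X} {s : U → Ger} (hs : FinSupp s) : FinSupp (-s) := by
  obtain ⟨J, hJ⟩ := hs
  exact ⟨J, fun p i j hj => by rw [Pi.neg_apply, map_neg, hJ p i j hj, neg_zero]⟩

theorem FinSupp.isGevrey {U : Opens X} {s : U → Ger} (hf : FinSupp s) (hs : IsFormal U s)
    {r : ℝ≥0∞} (hr : 1 ≤ r) (p : U) : IsGevrey r (s p) :=
  (hs.gevrey_one_pred hf hr).2 p

/-- Regularity of solutions. Subtracting a series of order `r` with the same image under `E`, up to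
finitely many terms, leaves an Euler solution; at the origin this is finite, elsewhere it is a
sequence to which `SeqGevrey.of_hgRec` applies. -/
theorem isGevrey_of_opP_opE (ha : 0 < a) (hab : a < b) {U : Opens X} {u : U → Ger}
    (hc : ((c, 0) : ℂ × ℂ) ∈ U) {r s : ℝ≥0∞} (hr : 1 ≤ r) (hrs : r ≤ s)
    (h : s < (b : ℝ≥0∞) / a ∨ (b : ℝ≥0∞) / a ≤ r) (hu : IsFormal U u)
    (hus : IsGevrey s (u ⟨(c, 0), hc⟩)) (hP : IsGevrey r (act (opP a b U) u ⟨(c, 0), hc⟩))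
    (hE : IsGevrey r (act (opE a b γ U) u ⟨(c, 0), hc⟩)) : IsGevrey r (u ⟨(c, 0), hc⟩) := by
  have hb : 0 < b := ha.trans hab
  obtain ⟨V, k, hcV, w, hw, hEw⟩ := exists_local_opE_solution ha hb γ (hu.act (opE a b γ U)) hc hr hE
  set v : V → Ger := res k u - w with hv
  have hvf : IsFormal V v := (hu.res k u).sub hw.1
  have hEv : FinSupp (act (opE a b γ V) v) := by
    have e : act (opE a b γ V) v = -(act (opE a b γ V) w - res k (act (opE a b γ U) u)) := by
      rw [hv, act_sub, neg_sub]
      rfl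
    rw [e]
    exact hEw.neg
  have hvs : IsGevrey s (v ⟨(c, 0), hcV⟩) := hus.sub ((hw.2 _).mono hrs)
  have hPv : IsGevrey r (act (opP a b V) v ⟨(c, 0), hcV⟩) := by
    rw [hv, act_sub]
    exact hP.sub (((gevrey ⟨r, hr⟩).act_pred (opP a b V) hw).2 _)
  suffices hvr : IsGevrey r (v ⟨(c, 0), hcV⟩) by
    have e : u ⟨(c, 0), hc⟩ = v ⟨(c, 0), hcV⟩ + w ⟨(c, 0), hcV⟩ := by
      rw [hv, Pi.sub_apply, sub_add_cancel]
      rfl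
    rw [e]
    exact hvr.add (hw.2 _)
  by_cases hc0 : c = 0
  · subst hc0
    obtain ⟨W, l, h0, hfin⟩ := exists_local_finSupp hb hvf hcV hEv
    exact hfin.isGevrey (hvf.res l v) hr ⟨(0, 0), h0⟩
  · obtain ⟨R, hR, hRc, l, x, hfin⟩ := exists_local_solFam ha hc0 hvf hcV hEv
    set y : polydisc c R → Ger := res l v - solFam a b γ c R x with hy
    have hxf : IsFormal _ (solFam a b γ c R x) := isFormal_solFam hc0 hRc x
    have hyf : IsFormal _ y := (hvf.res l v).sub hxf
    have e : solFam a b γ c R x = res l v - y := by rw [hy, sub_sub_cancel]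
    have hxs : SeqGevrey s x := by
      refine seqGevrey_of_solFam (a := a) (b := b) (γ := γ) hc0 hR ?_
      rw [e]
      exact hvs.sub (hfin.isGevrey hyf (hr.trans hrs) _)
    have hRx : SeqGevrey r (hgRec a b γ c x) := by
      refine seqGevrey_of_solFam (a := a) (b := b) (γ := shiftParam a b γ) hc0 hR ?_
      rw [← act_opP_solFam ha hc0 hRc, e, act_sub]
      exact hPv.sub (((gevrey ⟨r, hr⟩).act_pred (opP a b _) (hyf.gevrey_one_pred hfin hr)).2 _)
    have hxr := SeqGevrey.of_hgRec γ ha hab hc0 hr hrs h hxs hRx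
    have e' : v ⟨(c, 0), hcV⟩ = y ⟨(c, 0), center_mem_polydisc hR⟩ +
        solFam a b γ c R x ⟨(c, 0), center_mem_polydisc hR⟩ := by
      rw [hy, Pi.sub_apply, sub_add_cancel]
      rfl
    rw [e']
    exact (hfin.isGevrey hyf hr _).add ((solFam_pred ha hc0 hRc hr hxr).2 _)

theorem finSupp_solFam_sub (hc : c ≠ 0) {R : ℝ} (hR : R ≤ ‖c‖ / 2) {x y : ℕ → ℂ} {K : ℕ}
    (h : ∀ j, K ≤ j → x j = y j) : FinSupp (solFam a b γ c R x - solFam a b γ c R y) := by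
  rw [solFam, solFam, ofCoefs_sub]
  · exact finSupp_ofCoefs (J := K) fun j hj z _ => by rw [h j hj, sub_self]
  all_goals
    rw [slice_polydisc]
    exact differentiableOn_solFam hc hR _

/-- `P` maps Euler solutions of parameter `β` onto those of the shifted parameter, modulo finitely
many terms: this is the solvability of the recurrence. The equation `E w = 0` holds exactly, so a
later correction by `w` does not disturb `E`. -/
theorem exists_local_opP_solution (ha : 0 < a) (hab : a < b) {U : Opens X} {u : U → Ger}
    (hc : ((c, 0) : ℂ × ℂ) ∈ U) {s : ℝ≥0∞} (hs : 1 ≤ s) (hu : IsFormal U u)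
    (hus : IsGevrey s (u ⟨(c, 0), hc⟩)) (hE : FinSupp (act (opE a b (shiftParam a b β) U) u)) :
    ∃ (V : Opens X) (k : V ≤ U), ((c, 0) : ℂ × ℂ) ∈ V ∧ ∃ w : V → Ger,
      (gevrey ⟨s, hs⟩).pred V w ∧ FinSupp (act (opP a b V) w - res k u) ∧
      act (opE a b β V) w = 0 := by
  by_cases hc0 : c = 0
  · subst hc0
    obtain ⟨V, k, h0, hfin⟩ := exists_local_finSupp (ha.trans hab) hu hc hE
    refine ⟨V, k, h0, 0, (gevrey ⟨s, hs⟩).zero V, ?_, ?_⟩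
    · have e : act (opP a b V) 0 - res k u = -res k u := by
        rw [show act (opP a b V) 0 = 0 from funext fun p => map_zero _, zero_sub]
      rw [e]
      exact hfin.neg
    · exact funext fun p => map_zero _
  · obtain ⟨R, hR, hRc, k, x, hfin⟩ := exists_local_solFam ha hc0 hu hc hE
    have hxf : IsFormal _ (solFam a b (shiftParam a b β) c R x) := isFormal_solFam hc0 hRc x
    have hyf := (hu.res k u).sub hxf
    have hxs : SeqGevrey s x := by
      refine seqGevrey_of_solFam (a := a) (b := b) (γ := shiftParam a b β) hc0 hR ?_
      have e : solFam a b (shiftParam a b β) c R x =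
          res k u - (res k u - solFam a b (shiftParam a b β) c R x) := by rw [sub_sub_cancel]
      rw [e]
      exact IsGevrey.sub hus (hfin.isGevrey hyf hs _)
    obtain ⟨z, hz, K, hK⟩ := hxs.exists_hgRec_eq β ha hab hc0 hs
    refine ⟨_, k, center_mem_polydisc hR, solFam a b β c R z, solFam_pred ha hc0 hRc hs hz, ?_,
      act_opE_solFam ha hc0 hRc z⟩
    rw [act_opP_solFam ha hc0 hRc]
    have e : solFam a b (shiftParam a b β) c R (hgRec a b β c z) - res k u =
        (solFam a b (shiftParam a b β) c R (hgRec a b β c z) -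
          solFam a b (shiftParam a b β) c R x) -
        (res k u - solFam a b (shiftParam a b β) c R x) := by abel
    rw [e]
    exact (finSupp_solFam_sub hc0 hRc hK).sub hfin

theorem IsFormal.eq_zero {U : Opens X} (hU : ∀ p ∈ U, p.2 ≠ 0) {s : U → Ger} (hs : IsFormal U s) :
    s = 0 := funext fun p => hs.1 p (hU _ p.2)

/-- The complement of `Y`. -/
def compl : Opens X := ⟨{x : ℂ × ℂ | x.2 ≠ 0}, isOpen_ne_fun continuous_snd continuous_const⟩

/-- Exactness in degree one: first solve `E w = v`, then correct by exact Euler solutions to reach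
`P w = u`. All errors have order `r`, the order of the defect of the cocycle, so the result serves
every quotient considered. -/
theorem exists_local_opE_opP {s : ℝ≥0∞} (hs : 1 ≤ s) (ha : 0 < a) (hab : a < b) {U : Opens X}
    {u v : U → Ger} (hc : ((c, 0) : ℂ × ℂ) ∈ U) {r : ℝ≥0∞} (hr : 1 ≤ r) (hrs : r ≤ s)
    (hu : (gevrey ⟨s, hs⟩).pred U u) (hv : (gevrey ⟨s, hs⟩).pred U v)
    (huv : IsGevrey r ((act (opE a b (shiftParam a b β) U) u - act (opP a b U) v) ⟨(c, 0), hc⟩)) :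
    ∃ (V : Opens X) (k : V ≤ U), ((c, 0) : ℂ × ℂ) ∈ V ∧ ∃ w : V → Ger,
      (gevrey ⟨s, hs⟩).pred V w ∧ (gevrey ⟨r, hr⟩).pred V (act (opP a b V) w - res k u) ∧
      (gevrey ⟨r, hr⟩).pred V (act (opE a b β V) w - res k v) := by
  have hb : 0 < b := ha.trans hab
  obtain ⟨V, k, hcV, w₀, hw₀, hfin₀⟩ := exists_local_opE_solution ha hb β hv.1 hc hs (hv.2 _)
  have hfor₀ : IsFormal V (act (opE a b β V) w₀ - res k v) :=
    (hw₀.1.act _).sub (hv.1.res k v)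
  -- By `E' P = P E`, the cocycle condition makes `E' u₁` of order `r`.
  set u₁ : V → Ger := res k u - act (opP a b V) w₀ with hu₁
  have hu₁s : (gevrey ⟨s, hs⟩).pred V u₁ :=
    (gevrey ⟨s, hs⟩).sub_pred ((gevrey ⟨s, hs⟩).res k u hu) ((gevrey ⟨s, hs⟩).act_pred _ hw₀)
  have hcomm : act (opE a b (shiftParam a b β) V) (act (opP a b V) w₀) =
      act (opP a b V) (act (opE a b β V) w₀) := by
    rw [← act_mul, opE_mul_opP, act_mul]
  have hEu₁ : IsGevrey r (act (opE a b (shiftParam a b β) V) u₁ ⟨(c, 0), hcV⟩) := by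
    have e : act (opE a b (shiftParam a b β) V) u₁ =
        res k (act (opE a b (shiftParam a b β) U) u - act (opP a b U) v) -
        act (opP a b V) (act (opE a b β V) w₀ - res k v) := by
      rw [hu₁, act_sub, act_sub, hcomm, res_sub, res_act_opE, res_act_opP]
      abel
    rw [e]
    exact IsGevrey.sub huv (((gevrey ⟨r, hr⟩).act_pred (opP a b V)
      (hfor₀.gevrey_one_pred hfin₀ hr)).2 _)
  -- Remove a series `w'` of order `r` with the same image under `E'`; what remains of `u₁` is an
  -- Euler solution modulo finitely many terms.
  obtain ⟨V', k', hcV', w', hw', hfin'⟩ := exists_local_opE_solution ha hb (shiftParam a b β)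
    (hu₁s.1.act (opE a b (shiftParam a b β) V)) hcV hr hEu₁
  set u₂ : V' → Ger := res k' u₁ - w' with hu₂
  have hEu₂ : FinSupp (act (opE a b (shiftParam a b β) V') u₂) := by
    have e : act (opE a b (shiftParam a b β) V') u₂ =
        -(act (opE a b (shiftParam a b β) V') w' -
          res k' (act (opE a b (shiftParam a b β) V) u₁)) := by
      rw [hu₂, act_sub, neg_sub, res_act_opE]
    rw [e]
    exact hfin'.neg
  have hu₂f : IsFormal V' u₂ := (hu₁s.1.res k' u₁).sub hw'.1
  obtain ⟨V'', k'', hcV'', w₁, hw₁, hP₁, hE₁⟩ := exists_local_opP_solution (β := β) ha hab hcV' hs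
    hu₂f ((hu₁s.2 ⟨(c, 0), hcV⟩).sub ((hw'.2 ⟨(c, 0), hcV'⟩).mono hrs)) hEu₂
  have hl : V'' ≤ V := k''.trans k'
  refine ⟨V'', hl.trans k, hcV'', res hl w₀ + w₁,
    (gevrey ⟨s, hs⟩).add ((gevrey ⟨s, hs⟩).res hl w₀ hw₀) hw₁, ?_, ?_⟩
  · have e : act (opP a b V'') (res hl w₀ + w₁) - res (hl.trans k) u =
        (act (opP a b V'') w₁ - res k'' u₂) - res k'' w' := by
      have e1 : res k'' u₂ = res (hl.trans k) u - act (opP a b V'') (res hl w₀) - res k'' w' := by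
        rw [hu₂, hu₁, res_sub, res_sub, res_sub, res_act_opP, res_act_opP, res_res, res_res,
          res_res]
      rw [act_add, e1]
      abel
    rw [e]
    exact (gevrey ⟨r, hr⟩).sub_pred
      (((hw₁.1.act _).sub (hu₂f.res k'' u₂)).gevrey_one_pred hP₁ hr)
      ((gevrey ⟨r, hr⟩).res k'' w' hw')
  · have e : act (opE a b β V'') (res hl w₀ + w₁) - res (hl.trans k) v =
        res hl (act (opE a b β V) w₀ - res k v) := by
      rw [act_add, hE₁, add_zero, res_sub, res_act_opE, res_res]
    rw [e]
    exact (hfor₀.res hl _).gevrey_one_pred (hfin₀.res hl) hr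

/-- The sections of `A` are the formal power series whose germs have Gevrey orders in `K`. -/
structure IsGevreyFam (A : DFam) (K : Set ℝ≥0∞) : Prop where
  pred_iff : ∀ {U : Opens X} {u : U → Ger},
    A.pred U u ↔ IsFormal U u ∧ ∀ p, ∃ r ∈ K, IsGevrey r (u p)
  one_le : ∀ r ∈ K, 1 ≤ r
  nonempty : K.Nonempty

namespace IsGevreyFam

variable {A : DFam} {K : Set ℝ≥0∞} (hA : IsGevreyFam A K) {s : ℝ≥0∞} (hs : 1 ≤ s)

theorem pred_of_gevrey (hA : IsGevreyFam A K) {r : ℝ≥0∞} (hr : r ∈ K) {U : Opens X}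
    {u : U → Ger} (hu : (gevrey ⟨r, hA.one_le r hr⟩).pred U u) : A.pred U u :=
  hA.pred_iff.2 ⟨hu.1, fun p => ⟨r, hr, hu.2 p⟩⟩

theorem pred_of_opP_opE (hA : IsGevreyFam A K) (ha : 0 < a) (hab : a < b)
    (hK : ∀ r ∈ K, r ≤ s ∧ (s < (b : ℝ≥0∞) / a ∨ (b : ℝ≥0∞) / a ≤ r)) (U : Opens X) (u : U → Ger)
    (hu : (gevrey ⟨s, hs⟩).pred U u) (hP : A.pred U (act (opP a b U) u))
    (hE : A.pred U (act (opE a b β U) u)) : A.pred U u := by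
  refine hA.pred_iff.2 ⟨hu.1, ?_⟩
  rintro ⟨⟨c, w⟩, hp⟩
  by_cases hw : w = 0
  · subst hw
    obtain ⟨r₁, hr₁, h₁⟩ := (hA.pred_iff.1 hP).2 ⟨(c, 0), hp⟩
    obtain ⟨r₂, hr₂, h₂⟩ := (hA.pred_iff.1 hE).2 ⟨(c, 0), hp⟩
    have hr : max r₁ r₂ ∈ K := by rcases max_choice r₁ r₂ with h | h <;> rwa [h]
    exact ⟨max r₁ r₂, hr, isGevrey_of_opP_opE ha hab hp (hA.one_le _ hr) (hK _ hr).1 (hK _ hr).2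
      hu.1 (hu.2 _) (h₁.mono (le_max_left _ _)) (h₂.mono (le_max_right _ _))⟩
  · obtain ⟨r, hr⟩ := hA.nonempty
    refine ⟨r, hr, ?_⟩
    rw [hu.1.1 ⟨(c, w), hp⟩ hw]
    exact .zero _

/-- Degree one is `exists_local_opE_opP`. Degree two needs only the surjectivity of `E'`, with
second component zero. -/
theorem koszulExact_cokernel (hA : IsGevreyFam A K) (ha : 0 < a) (hab : a < b)
    (hK : ∀ r ∈ K, r ≤ s) (h : ∀ U u, A.pred U u → (gevrey ⟨s, hs⟩).pred U u) :
    koszulExact a b β (cokernel (DFam.incl h)) := by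
  obtain ⟨r₀, hr₀⟩ := hA.nonempty
  refine ⟨DFam.koszulExactOne_cokernel fun U u v hu hv huv => ?_,
    DFam.koszulExactTwo_cokernel fun U u hu => ?_⟩
  · rintro ⟨c, w⟩ hp
    by_cases hw : w = 0
    · subst hw
      obtain ⟨r, hr, hg⟩ := (hA.pred_iff.1 huv).2 ⟨(c, 0), hp⟩
      obtain ⟨V, k, hcV, w, hw, h1, h2⟩ := exists_local_opE_opP (β := β) hs ha hab hp
        (hA.one_le r hr) (hK r hr) hu hv hg
      exact ⟨V, k, hcV, w, hw, hA.pred_of_gevrey hr h1, hA.pred_of_gevrey hr h2⟩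
    -- Off `Y` all sections vanish on a neighbourhood and zero solves everything.
    · have hV : ∀ p ∈ U ⊓ compl, p.2 ≠ 0 := fun p hp => hp.2
      refine ⟨U ⊓ compl, inf_le_left, ⟨hp, hw⟩, 0, (gevrey ⟨s, hs⟩).zero _, ?_, ?_⟩
      · rw [(((IsFormal.zero _).act (opP a b _)).sub (hu.1.res inf_le_left u)).eq_zero hV]
        exact A.zero _
      · rw [(((IsFormal.zero _).act (opE a b β _)).sub (hv.1.res inf_le_left v)).eq_zero hV]
        exact A.zero _
  · rintro ⟨c, w⟩ hp
    by_cases hw : w = 0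
    · subst hw
      obtain ⟨V, k, hcV, w, hw, hfin⟩ := exists_local_opE_solution ha (ha.trans hab)
        (shiftParam a b β) hu.1 hp hs (hu.2 _)
      refine ⟨V, k, hcV, w, 0, hw, (gevrey ⟨s, hs⟩).zero _, hA.pred_of_gevrey hr₀ ?_⟩
      rw [show act (opP a b V) 0 = 0 from funext fun p => map_zero _, sub_zero]
      exact ((hw.1.act _).sub (hu.1.res k u)).gevrey_one_pred hfin _
    · have hV : ∀ p ∈ U ⊓ compl, p.2 ≠ 0 := fun p hp => hp.2
      refine ⟨U ⊓ compl, inf_le_left, ⟨hp, hw⟩, 0, 0, (gevrey ⟨s, hs⟩).zero _,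
        (gevrey ⟨s, hs⟩).zero _, ?_⟩
      rw [((((IsFormal.zero _).act (opE a b (shiftParam a b β) _)).sub
        ((IsFormal.zero _).act (opP a b _))).sub (hu.1.res inf_le_left u)).eq_zero hV]
      exact A.zero _

end IsGevreyFam

theorem isGevreyFam_conv : IsGevreyFam conv {1} where
  pred_iff := by
    intro U u
    rw [conv_pred_iff]
    simp only [Set.mem_singleton_iff, exists_eq_left]
    rfl
  one_le := by simp
  nonempty := ⟨1, rfl⟩

theorem isGevreyFam_gevreyLT (s : Set.Ioi (1 : ℝ≥0∞)) :
    IsGevreyFam (gevreyLT s) {r | 1 ≤ r ∧ r < s.1} where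
  pred_iff := by
    intro U u
    simp only [Set.mem_ofPred_eq, and_assoc]
    rfl
  one_le _ hr := hr.1
  nonempty := ⟨1, le_rfl, s.2⟩

theorem isGevreyFam_gevrey (s : Set.Ici (1 : ℝ≥0∞)) : IsGevreyFam (gevrey s) {s.1} where
  pred_iff := by
    intro U u
    simp only [Set.mem_singleton_iff, exists_eq_left]
    rfl
  one_le := by
    rintro _ rfl
    exact s.2
  nonempty := ⟨s.1, rfl⟩

/-- A solution of Gevrey order `b / a` of the hypergeometric system modulo convergent series. -/
theorem exists_solution_gevrey (ha : 0 < a) (hab : a < b) (β : ℂ) :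
    ∃ (U : Opens X) (u : U → Ger) (p : U),
      (∀ (s : ℝ≥0∞) (hs : 1 ≤ s), (b : ℝ≥0∞) / a ≤ s → (gevrey ⟨s, hs⟩).pred U u) ∧
      (∀ (r : ℝ≥0∞) (hr : 1 ≤ r), (gevrey ⟨r, hr⟩).pred U (act (opP a b U) u)) ∧
      (∀ (r : ℝ≥0∞) (hr : 1 ≤ r), (gevrey ⟨r, hr⟩).pred U (act (opE a b β U) u)) ∧
      ∀ r : ℝ≥0∞, r < (b : ℝ≥0∞) / a → ¬ IsGevrey r (u p) := by
  -- Any `c ≠ 0` would do as centre. Only finitely many terms of the recurrence fail to vanish, so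
  -- the image under `P` is convergent.
  obtain ⟨x, hx, ⟨K, hK⟩, hnx⟩ := exists_hgRec_eq_zero β ha hab (one_ne_zero : (1 : ℂ) ≠ 0)
  have hR : (1 / 2 : ℝ) ≤ ‖(1 : ℂ)‖ / 2 := by simp
  refine ⟨_, solFam a b β 1 (1 / 2) x, ⟨(1, 0), center_mem_polydisc (by norm_num)⟩,
    fun s hs hts => solFam_pred ha one_ne_zero hR hs ?_, fun r hr => ?_, fun r hr => ?_,
    fun r hr h => hnx r hr (seqGevrey_of_solFam one_ne_zero (by norm_num) h)⟩
  · by_cases hs' : s = ⊤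
    · exact Or.inl hs'
    rcases hx with h | h
    · exact absurd h (slope_ne_top ha)
    · exact Or.inr (h.mono (by linarith [ENNReal.toReal_mono hs' hts]))
  · rw [act_opP_solFam ha one_ne_zero hR]
    refine IsFormal.gevrey_one_pred (isFormal_solFam one_ne_zero hR _) ?_ hr
    exact finSupp_ofCoefs (J := K) fun j hj z _ => by rw [hK j hj, zero_mul]
  · rw [act_opE_solFam ha one_ne_zero hR]
    exact (gevrey ⟨r, hr⟩).zero _

end

/-! ### The irregularity of the hypergeometric module -/

section

variable {a b : ℕ} {β : ℂ}

theorem one_lt_slope (ha : 0 < a) (hab : a < b) : (1 : ℝ≥0∞) < (b : ℝ≥0∞) / a := by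
  rw [ENNReal.lt_div_iff_mul_lt (Or.inl (by exact_mod_cast ha.ne'))
    (Or.inl (ENNReal.natCast_ne_top a)), one_mul]
  exact_mod_cast hab

theorem koszulExact_Q (ha : 0 < a) (hab : a < b) (s : Set.Ici (1 : ℝ≥0∞)) :
    koszulExact a b β (Q s) :=
  isGevreyFam_conv.koszulExact_cokernel s.2 ha hab
    (fun _ hr => (Set.mem_singleton_iff.1 hr).trans_le s.2) (conv_le_gevrey s)

theorem koszulExact_grGevrey (ha : 0 < a) (hab : a < b) (s : Set.Ioi (1 : ℝ≥0∞)) :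
    koszulExact a b β (grGevrey s) :=
  (isGevreyFam_gevreyLT s).koszulExact_cokernel (Set.Ioi_subset_Ici_self s.2) ha hab
    (fun _ hr => hr.2.le) (gevreyLT_le s)

theorem isZero_homology_Irr (ha : 0 < a) (hab : a < b) (s : Set.Ici (1 : ℝ≥0∞)) {n : ℤ}
    (hn : n ≠ 0) : IsZero ((DerivedCategory.Plus.homologyFunctor _ n).obj
      (Irr s (hypergeometric a b β))) :=
  isZero_homology_RHom ha hab (koszulExact_Q ha hab s) hn

theorem isZero_Irr (ha : 0 < a) (hab : a < b) (s : Set.Ici (1 : ℝ≥0∞))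
    (hs : s.1 < (b : ℝ≥0∞) / a) : IsZero (Irr s (hypergeometric a b β)) :=
  (isZero_RHom_iff ha hab (koszulExact_Q ha hab s)).2 <|
    DFam.eq_zero_of_smul_eq_zero <| isGevreyFam_conv.pred_of_opP_opE s.2 ha hab
      fun _ hr => ⟨(Set.mem_singleton_iff.1 hr).trans_le s.2, Or.inl hs⟩

theorem not_isZero_Irr (ha : 0 < a) (hab : a < b) (s : Set.Ici (1 : ℝ≥0∞))
    (hs : (b : ℝ≥0∞) / a ≤ s.1) : ¬ IsZero (Irr s (hypergeometric a b β)) := by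
  intro h0
  obtain ⟨U, u, p, hu, hP, hE, hp⟩ := exists_solution_gevrey ha hab β
  obtain ⟨m, hm⟩ := DFam.exists_smul_eq_zero_and_ne_zero (h := conv_le_gevrey s) (hu s.1 s.2 hs)
    (isGevreyFam_conv.pred_of_gevrey rfl (hP 1 le_rfl))
    (isGevreyFam_conv.pred_of_gevrey rfl (hE 1 le_rfl)) fun hA => by
      obtain ⟨r, rfl, hr⟩ := (isGevreyFam_conv.pred_iff.1 hA).2 p
      exact hp 1 (one_lt_slope ha hab) hr
  exact hm.2.2 ((isZero_RHom_iff ha hab (koszulExact_Q ha hab s)).1 h0 U m hm.1 hm.2.1)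

theorem isIso_irrMap (ha : 0 < a) (hab : a < b) {s t : Set.Ici (1 : ℝ≥0∞)} (hst : s ≤ t)
    (hs : (b : ℝ≥0∞) / a ≤ s.1) : IsIso (irrMap hst (hypergeometric a b β)) := by
  have hf : cokernel.π (DFam.incl (conv_le_gevrey s)) ≫ qMap hst =
      DFam.incl (gevrey_mono hst) ≫ cokernel.π (DFam.incl (conv_le_gevrey t)) :=
    cokernel.π_desc _ _ _
  refine (isIso_RHom_map_iff ha hab (koszulExact_Q ha hab s) (koszulExact_Q ha hab t) _).2 <|
    isIso_sheafHom_map _ (DFam.map_cokernel_injective (gevrey_mono hst) hf) <|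
      DFam.exists_local_map_eq (gevrey_mono hst) hf fun U u hu hP hE => ?_
  refine (isGevreyFam_gevrey s).pred_of_opP_opE t.2 ha hab (fun r hr => ?_) U u hu
    (conv_le_gevrey s _ _ hP) (conv_le_gevrey s _ _ hE)
  obtain rfl := Set.mem_singleton_iff.1 hr
  exact ⟨hst, Or.inr hs⟩

/-- If `s < b / a ≤ t` the source is zero and the target is not; otherwise both are zero or
regularity above the slope identifies the solutions. -/
theorem isIso_irrMap_iff (ha : 0 < a) (hab : a < b) {s t : Set.Ici (1 : ℝ≥0∞)} (hst : s ≤ t) :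
    IsIso (irrMap hst (hypergeometric a b β)) ↔
      t.1 < (b : ℝ≥0∞) / a ∨ (b : ℝ≥0∞) / a ≤ s.1 := by
  constructor
  · intro h
    by_contra! hc
    exact not_isZero_Irr ha hab t hc.1 ((isZero_Irr ha hab s hc.2).of_iso
      (asIso (irrMap hst (hypergeometric a b β))).symm)
  · rintro (h | h)
    · exact IsZero.isIso (isZero_Irr ha hab s (lt_of_le_of_lt hst h)) (isZero_Irr ha hab t h) _
    · exact isIso_irrMap ha hab hst h

/-- Gevrey sheaves increase with the order, so only orders close to `s` matter. For `s` above the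
slope, taking `q = b / a` keeps all orders on the same side, as the regularity result requires. -/
theorem isGevreyFam_gevreyLT_of_lt (s : Set.Ioi (1 : ℝ≥0∞)) {q : ℝ≥0∞} (hq : 1 ≤ q)
    (hqs : q < s.1) : IsGevreyFam (gevreyLT s) {r | q ≤ r ∧ r < s.1} where
  pred_iff := by
    intro U u
    refine (isGevreyFam_gevreyLT s).pred_iff.trans (and_congr_right fun _ => forall_congr' fun p =>
      ⟨?_, ?_⟩)
    · rintro ⟨r, hr, h⟩
      exact ⟨max q r, ⟨le_max_left _ _, max_lt hqs hr.2⟩, h.mono (le_max_right _ _)⟩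
    · rintro ⟨r, hr, h⟩
      exact ⟨r, ⟨hq.trans hr.1, hr.2⟩, h⟩
  one_le _ hr := hq.trans hr.1
  nonempty := ⟨q, le_rfl, hqs⟩

theorem isAnalyticSlope_iff (ha : 0 < a) (hab : a < b) (s : Set.Ioi (1 : ℝ≥0∞)) :
    IsAnalyticSlope (hypergeometric a b β) s ↔ s.1 = (b : ℝ≥0∞) / a := by
  have hs : 1 ≤ s.1 := Set.Ioi_subset_Ici_self s.2
  have hz := isZero_RHom_iff ha hab (koszulExact_grGevrey (β := β) ha hab s)
  constructor
  · refine fun h => by_contra fun hne => h (hz.2 (DFam.eq_zero_of_smul_eq_zero ?_))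
    rcases lt_or_gt_of_ne hne with hlt | hgt
    · exact (isGevreyFam_gevreyLT s).pred_of_opP_opE hs ha hab
        fun r hr => ⟨hr.2.le, Or.inl hlt⟩
    · exact (isGevreyFam_gevreyLT_of_lt s (one_lt_slope ha hab).le hgt).pred_of_opP_opE hs ha hab
        fun r hr => ⟨hr.2.le, Or.inr hr.1⟩
  · intro h h0
    obtain ⟨U, u, p, hu, hP, hE, hp⟩ := exists_solution_gevrey ha hab β
    have hA := isGevreyFam_gevreyLT s
    have h1 : (1 : ℝ≥0∞) ∈ {r | 1 ≤ r ∧ r < s.1} := ⟨le_rfl, s.2⟩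
    obtain ⟨m, hm⟩ := DFam.exists_smul_eq_zero_and_ne_zero (h := gevreyLT_le s) (hu s.1 hs h.ge)
      (hA.pred_of_gevrey h1 (hP 1 le_rfl)) (hA.pred_of_gevrey h1 (hE 1 le_rfl)) fun hA' => by
        obtain ⟨r, hr, hr'⟩ := (hA.pred_iff.1 hA').2 p
        exact hp r (hr.2.trans_eq h) hr'
    exact hm.2.2 (hz.1 h0 U m hm.1 hm.2.1)

end

end GevreyIrr

theorem mainTheorem2 (a b : ℕ) (ha : 0 < a) (hab : a < b) (β : ℂ) :
    (∀ s : Set.Ici (1 : ℝ≥0∞),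
      IsZero (GevreyIrr.sheafExt 1 (GevreyIrr.hypergeometric a b β) (GevreyIrr.Q s))) ∧
    (∀ s : Set.Ici (1 : ℝ≥0∞), s.1 < (b : ℝ≥0∞) / a →
      IsZero (GevreyIrr.Irr s (GevreyIrr.hypergeometric a b β))) ∧
    (∀ s : Set.Ici (1 : ℝ≥0∞), (b : ℝ≥0∞) / a ≤ s.1 →
      ¬ IsZero (GevreyIrr.Irr s (GevreyIrr.hypergeometric a b β)) ∧
      ∀ n : ℤ, n ≠ 0 → IsZero ((DerivedCategory.Plus.homologyFunctor _ n).obj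
        (GevreyIrr.Irr s (GevreyIrr.hypergeometric a b β)))) ∧
    (∀ (s t : Set.Ici (1 : ℝ≥0∞)) (hst : s ≤ t),
      IsIso (GevreyIrr.irrMap hst (GevreyIrr.hypergeometric a b β)) ↔
        t.1 < (b : ℝ≥0∞) / a ∨ (b : ℝ≥0∞) / a ≤ s.1) ∧
    (∀ s : Set.Ioi (1 : ℝ≥0∞),
      GevreyIrr.IsAnalyticSlope (GevreyIrr.hypergeometric a b β) s ↔ s.1 = (b : ℝ≥0∞) / a) := by
  exact ⟨fun s => GevreyIrr.isZero_homology_Irr ha hab s one_ne_zero,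
    GevreyIrr.isZero_Irr ha hab,
    fun s hs => ⟨GevreyIrr.not_isZero_Irr ha hab s hs,
      fun _ hn => GevreyIrr.isZero_homology_Irr ha hab s hn⟩,
    fun _ _ hst => GevreyIrr.isIso_irrMap_iff ha hab hst,
    GevreyIrr.isAnalyticSlope_iff ha hab⟩
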